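/- Let $0\le k<1$, $k^2\le b\le 1$, $b>0$, $c^2=b(1-b)(b-k^2)$, $\omega=\tfrac12(1+k^2-3b)$, let $K(k),E(k)$ be the complete elliptic integrals of modulus $k$, $T(k)=2K(k)$, and let $\phi=Re^{i\theta}$ with $R^2=b-k^2\,\mathrm{sn}^2(x,k)$, $\theta(x)=c\int_0^x R^{-2}$ (and $\phi=k\,\mathrm{cn}(x,k)$ if $b=k^2$) be the corresponding elliptic solution of $\omega\phi+\tfrac12\phi''+\phi|\phi|^2=0$. Put $$A=-i\zeta^2+\tfrac i2|\phi|^2+\tfrac i2\omega,\quad B=\zeta\phi+\tfrac i2\phi',\quad C=-\zeta\phi^*+\tfrac i2(\phi^*)',$$ $$\Omega(\zeta)^2=A^2+BC=-\zeta^4+\omega\zeta^2+c\zeta-\tfrac1{16}\bigl(4\omega b+3b^2+(1-k^2)^2\bigr),\qquad \zeta_c^2=\frac{2E(k)-(1+b-k^2)K(k)}{4K(k)}.$$ The Lax spectrum $\sigma_L$ is the set of $\zeta\in\mathbb C$ for which the Lax pair $\chi_x=\begin{pmatrix}-i\zeta&\phi\\-\phi^*&i\zeta\end{pmatrix}\chi$,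 $\chi_t=\begin{pmatrix}A&B\\C&-A\end{pmatrix}\chi$ has a nontrivial solution $\chi=e^{\Omega t}(\varphi_1,\varphi_2)^T$ with $\varphi$ bounded in $x\in\mathbb R$; $\varphi$ is called normalized if $(\varphi_1,\varphi_2)=\gamma\,(-B,A-\Omega)$ with $|\gamma|^2=1/|A-\Omega|$ (wherever $A\neq\Omega$). With $\tilde r=\sqrt2\,\mathrm{Re}\,\phi$, $\tilde\ell=\sqrt2\,\mathrm{Im}\,\phi$ let $$\mathscr L_2=\hat H''(\tilde r,\tilde\ell)=\begin{pmatrix}-\tfrac12\partial_x^2-\tfrac12(3\tilde r^2+\tilde\ell^2)-\omega&-\tilde r\tilde\ell\\-\tilde r\tilde\ell&-\tfrac12\partial_x^2-\tfrac12(\tilde r^2+3\tilde\ell^2)-\omega\end{pmatrix},\qquad J=\begin{pmatrix}0&1\\-1&0\end{pmatrix},$$ and for $P\in\{1,2,\dots\}$ and $W=(\varphi_1^2-\varphi_2^2,\,-i\varphi_1^2-i\varphi_2^2)^T$ let $K_2(\zeta)=\int_{-PT(k)/2}^{PT(k)/2}W^*\mathscr L_2W\,dx$; the Krein signature is the sign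 of $K_2(\zeta)$. (1) Every real $\zeta$ lies in $\sigma_L$, and $\Omega(\zeta)^2$ is real and $\le0$, with $\Omega(\zeta)^2<0$ if $k>0$. If $\zeta\in\mathbb R$ and $\Omega=\Omega(\zeta)\ne0$ is either square root, then a normalized $\varphi$ exists and every solution $\varphi$ is a constant multiple of it; $W$ is nontrivial with $J\mathscr L_2W=2\Omega W$; the functions $(U,V)=(e^{-i\theta}\varphi_1^2-e^{i\theta}\varphi_2^2,\,-ie^{-i\theta}\varphi_1^2-ie^{i\theta}\varphi_2^2)$ form an eigenfunction, with eigenvalue $2\Omega$ and of Floquet form $e^{i\mu x}\times(T(k)\text{-periodic})$, $\mu\in\mathbb R$, of the NLS linearization $\begin{pmatrix}-S&\mathcal L_-\\-\mathcal L_+&-S\end{pmatrix}$, where $\mathcal L_\mp=-\tfrac12\partial_x^2-(2\mp1)R^2-\omega+\tfrac{c^2}{2R^4}$ and $S=\tfrac c{R^2}\partial_x-\tfrac{cR'}{R^3}$ (terms with the factor $c$ being $0$ if $b=k^2$); and for every $P\ge1$ $$K_2(\zeta)=-16\,\Omega(\zeta)^2\,P\,T(k)\,(\zeta^2-\zeta_c^2)=-32\,\Omega(\zeta)^2\,P\,K(k)\,(\zeta^2-\zeta_c^2).$$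 Hence the Krein signature equals the sign of $\zeta^2-\zeta_c^2$. In particular, if $\zeta_c>0$ is real, then $K_2(\zeta)<0$ exactly for $\zeta\in(-\zeta_c,\zeta_c)$ and $K_2(\zeta)>0$ exactly for $|\zeta|>\zeta_c$: it changes sign at $\pm\zeta_c$. (2) Eigenvalues that collide at $\pm\zeta_c$ (at $-\zeta_c$, with $c\ge0$, this is the collision at $2\Omega(-\zeta_c)$, the top of the figure-8 spectrum) have opposite Krein signatures: let the parameters $(k_n,b_n,c_n)$ converge to parameters $(k,b,c)$ as above with $\zeta_c^2>0$, let $\hat\zeta_n\ne\tilde\zeta_n$ be real with $\hat\zeta_n,\tilde\zeta_n\to\zeta_*$, where $\zeta_*=\zeta_c$ or $\zeta_*=-\zeta_c$, and let $\hat\lambda_n=2\Omega(\hat\zeta_n)$, $\tilde\lambda_n=2\Omega(\tilde\zeta_n)$ be eigenvalues with the same Floquet exponent $\mu_n$ (with the eigenfunctions $(U,V)$ of (1)) that converge to a common limit $\lambda_*\neq0$. Then, for all large $n$ and all $P\ge1$, the Krein signatures of $\hat\lambda_n$ and $\tilde\lambda_n$ are nonzero and opposite. -/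

import Mathlib

open Filter Topology
open scoped ComplexConjugate

noncomputable section

namespace NLSKrein

/-! ### Elliptic integrals and Jacobi elliptic functions (modulus `k`, `0 ≤ k < 1`) -/

/-- Complete elliptic integral of the first kind. -/
def ellK (k : ℝ) : ℝ :=
  ∫ y in (0 : ℝ)..(Real.pi / 2), 1 / Real.sqrt (1 - k ^ 2 * Real.sin y ^ 2)

/-- Complete elliptic integral of the second kind. -/
def ellE (k : ℝ) : ℝ :=
  ∫ y in (0 : ℝ)..(Real.pi / 2), Real.sqrt (1 - k ^ 2 * Real.sin y ^ 2)

/-- Incomplete elliptic integral of the first kind. -/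
def ellF (k s : ℝ) : ℝ :=
  ∫ y in (0 : ℝ)..s, 1 / Real.sqrt (1 - k ^ 2 * Real.sin y ^ 2)

/-- Jacobi amplitude: the inverse of `ellF k`, which is a bijection of `ℝ` for `0 ≤ k < 1`
(see `ellF_bijective`). -/
def jacobiAm (k : ℝ) : ℝ → ℝ := Function.invFun (ellF k)

def jacobiSn (k x : ℝ) : ℝ := Real.sin (jacobiAm k x)

def jacobiCn (k x : ℝ) : ℝ := Real.cos (jacobiAm k x)

theorem ellF_bijective {k : ℝ} (hk0 : 0 ≤ k) (hk1 : k < 1) : Function.Bijective (ellF k) := by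
  have hlow : ∀ y : ℝ, 0 < 1 - k ^ 2 * Real.sin y ^ 2 := by
    intro y
    have h1 : Real.sin y ^ 2 ≤ 1 := Real.sin_sq_le_one y
    have h2 : k ^ 2 < 1 := by nlinarith
    nlinarith [sq_nonneg (Real.sin y), sq_nonneg k]
  have hcont : Continuous (fun y : ℝ => 1 / Real.sqrt (1 - k ^ 2 * Real.sin y ^ 2)) := by
    refine continuous_const.div (by fun_prop) ?_
    intro y
    exact (Real.sqrt_pos.mpr (hlow y)).ne'
  have hge : ∀ y : ℝ, 1 ≤ 1 / Real.sqrt (1 - k ^ 2 * Real.sin y ^ 2) := by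
    intro y
    rw [le_div_iff₀ (Real.sqrt_pos.mpr (hlow y)), one_mul]
    apply Real.sqrt_le_one.mpr
    nlinarith [mul_nonneg (sq_nonneg k) (sq_nonneg (Real.sin y))]
  have hint : ∀ a b : ℝ, IntervalIntegrable
      (fun y : ℝ => 1 / Real.sqrt (1 - k ^ 2 * Real.sin y ^ 2)) MeasureTheory.volume a b :=
    fun a b => hcont.intervalIntegrable a b
  have hdiff : ∀ a b : ℝ, a ≤ b → b - a ≤ ellF k b - ellF k a := by
    intro a b hab
    have h1 : ellF k b - ellF k a
        = ∫ y in a..b, 1 / Real.sqrt (1 - k ^ 2 * Real.sin y ^ 2) :=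
      intervalIntegral.integral_interval_sub_left (hint 0 b) (hint 0 a)
    have h2 : (∫ _y in a..b, (1 : ℝ)) ≤
        ∫ y in a..b, 1 / Real.sqrt (1 - k ^ 2 * Real.sin y ^ 2) :=
      intervalIntegral.integral_mono_on hab (by simp) (hint a b) (fun y _ => hge y)
    rw [h1]
    simpa using h2
  have h0 : ellF k 0 = 0 := by simp [ellF]
  refine ⟨?_, ?_⟩
  · intro a b hab
    rcases le_total a b with h | h
    · have := hdiff a b h
      linarith
    · have := hdiff b a h
      linarith
  · have hc : Continuous (ellF k) := intervalIntegral.continuous_primitive hint 0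
    refine hc.surjective ?_ ?_
    · refine tendsto_atTop_mono' atTop ?_ tendsto_id
      filter_upwards [eventually_ge_atTop 0] with x hx
      have := hdiff 0 x hx
      simp only [id]
      linarith
    · refine tendsto_atBot_mono' atBot ?_ tendsto_id
      filter_upwards [eventually_le_atBot 0] with x hx
      have := hdiff x 0 hx
      simp only [id]
      linarith

/-! ### The elliptic solutions -/

/-- Parameters of an elliptic solution of the focusing NLS equation; only the zero solution
`k = b = 0` is left out. -/
structure EllipticParams where
  k : ℝ
  b : ℝ
  c : ℝ
  k_nonneg : 0 ≤ k
  k_lt_one : k < 1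
  b_pos : 0 < b
  k_sq_le : k ^ 2 ≤ b
  b_le_one : b ≤ 1
  c_sq : c ^ 2 = b * (1 - b) * (b - k ^ 2)

namespace EllipticParams

variable (p : EllipticParams)

/-- The period of the squared amplitude. -/
def T : ℝ := 2 * ellK p.k

def omega : ℝ := (1 + p.k ^ 2 - 3 * p.b) / 2

/-- The amplitude, with `R ^ 2 = b - k ^ 2 * sn ^ 2`; when `b = k ^ 2` this is the smooth root
`k * cn`. -/
def R (x : ℝ) : ℝ :=
  if p.b = p.k ^ 2 then p.k * jacobiCn p.k x
  else Real.sqrt (p.b - p.k ^ 2 * jacobiSn p.k x ^ 2)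

def theta (x : ℝ) : ℝ := ∫ y in (0 : ℝ)..x, p.c / p.R y ^ 2

/-- The stationary solution `φ = R e ^ (i θ)`. -/
def phi (x : ℝ) : ℂ := (p.R x : ℂ) * Complex.exp (Complex.I * (p.theta x : ℂ))

/-- `ζ_c ^ 2`, a real number of either sign. -/
def zetaCSq : ℝ :=
  (2 * ellE p.k - (1 + p.b - p.k ^ 2) * ellK p.k) / (4 * ellK p.k)

/-! ### The Lax pair and the Lax spectrum -/

def A (ζ : ℂ) (x : ℝ) : ℂ :=
  -Complex.I * ζ ^ 2 + Complex.I / 2 * ((‖p.phi x‖ ^ 2 : ℝ) : ℂ)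
    + Complex.I / 2 * (p.omega : ℂ)

def B (ζ : ℂ) (x : ℝ) : ℂ := ζ * p.phi x + Complex.I / 2 * deriv p.phi x

def C (ζ : ℂ) (x : ℝ) : ℂ :=
  -ζ * conj (p.phi x) + Complex.I / 2 * conj (deriv p.phi x)

/-- `Ω(ζ) ^ 2 = A ^ 2 + B C`, as a polynomial in `ζ`. -/
def OmegaSq (ζ : ℂ) : ℂ :=
  -ζ ^ 4 + (p.omega : ℂ) * ζ ^ 2 + (p.c : ℂ) * ζ
    - (1 / 16) * ((4 * p.omega * p.b + 3 * p.b ^ 2 + (1 - p.k ^ 2) ^ 2 : ℝ) : ℂ)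

/-- `e ^ (Ω t) (f₁(x), f₂(x))` is a nontrivial, bounded (in `x`) solution of both equations
`χ_x = [[-iζ, φ], [-φ*, iζ]] χ` and `χ_t = [[A, B], [C, -A]] χ` of the Lax pair. -/
structure IsLaxEigenfunction (ζ Ω : ℂ) (f₁ f₂ : ℝ → ℂ) : Prop where
  deriv_fst : ∀ x, HasDerivAt f₁ (-Complex.I * ζ * f₁ x + p.phi x * f₂ x) x
  deriv_snd : ∀ x, HasDerivAt f₂ (-conj (p.phi x) * f₁ x + Complex.I * ζ * f₂ x) x
  time_fst : ∀ x, p.A ζ x * f₁ x + p.B ζ x * f₂ x = Ω * f₁ x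
  time_snd : ∀ x, p.C ζ x * f₁ x - p.A ζ x * f₂ x = Ω * f₂ x
  nontrivial : ∃ x, f₁ x ≠ 0 ∨ f₂ x ≠ 0
  bounded : ∃ M : ℝ, ∀ x, ‖f₁ x‖ ≤ M ∧ ‖f₂ x‖ ≤ M

/-- The Lax spectrum `σ_L`. -/
def LaxSpectrum : Set ℂ := {ζ | ∃ Ω f₁ f₂, p.IsLaxEigenfunction ζ Ω f₁ f₂}

/-- The normalization `(f₁, f₂) = γ (-B, A - Ω)` with `|γ| ^ 2 = 1 / |A - Ω|`. Nothing is asked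
at the isolated points where `A = Ω` (there `(-B, A - Ω)` vanishes). -/
def IsNormalized (ζ Ω : ℂ) (f₁ f₂ : ℝ → ℂ) : Prop :=
  ∀ x, p.A ζ x ≠ Ω → ∃ γ : ℂ,
    f₁ x = -γ * p.B ζ x ∧ f₂ x = γ * (p.A ζ x - Ω) ∧ ‖γ‖ ^ 2 = 1 / ‖p.A ζ x - Ω‖

/-! ### The linearization in the frame rotating with the phase `θ` -/

def Lminus (V : ℝ → ℂ) (x : ℝ) : ℂ :=
  -(1 / 2) * deriv (deriv V) x
    + ((-p.R x ^ 2 - p.omega + p.c ^ 2 / (2 * p.R x ^ 4) : ℝ) : ℂ) * V x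

def Lplus (U : ℝ → ℂ) (x : ℝ) : ℂ :=
  -(1 / 2) * deriv (deriv U) x
    + ((-3 * p.R x ^ 2 - p.omega + p.c ^ 2 / (2 * p.R x ^ 4) : ℝ) : ℂ) * U x

def S (U : ℝ → ℂ) (x : ℝ) : ℂ :=
  ((p.c / p.R x ^ 2 : ℝ) : ℂ) * deriv U x
    - ((p.c * deriv p.R x / p.R x ^ 3 : ℝ) : ℂ) * U x

/-- `(U, V)` is an eigenfunction, with eigenvalue `lam`, of the linearized operator
`[[-S, L₋], [-L₊, -S]]`, of Floquet form `e ^ (i μ x)` times a `T`-periodic function; that is,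
`lam` is an eigenvalue of the Bloch operator with Floquet exponent `μ`. -/
structure IsBlochEigenfunction (lam : ℂ) (μ : ℝ) (U V : ℝ → ℂ) : Prop where
  contDiff_fst : ContDiff ℝ 2 U
  contDiff_snd : ContDiff ℝ 2 V
  nontrivial : ∃ x, U x ≠ 0 ∨ V x ≠ 0
  eigen_fst : ∀ x, -p.S U x + p.Lminus V x = lam * U x
  eigen_snd : ∀ x, -p.Lplus U x - p.S V x = lam * V x
  floquet_fst : ∀ x, U (x + p.T) = Complex.exp (Complex.I * μ * p.T) * U x
  floquet_snd : ∀ x, V (x + p.T) = Complex.exp (Complex.I * μ * p.T) * V x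

/-- The squared eigenfunction `(U, V)` of the linearized operator. -/
def sqU (f₁ f₂ : ℝ → ℂ) (x : ℝ) : ℂ :=
  Complex.exp (-Complex.I * p.theta x) * f₁ x ^ 2
    - Complex.exp (Complex.I * p.theta x) * f₂ x ^ 2

def sqV (f₁ f₂ : ℝ → ℂ) (x : ℝ) : ℂ :=
  -Complex.I * Complex.exp (-Complex.I * p.theta x) * f₁ x ^ 2
    - Complex.I * Complex.exp (Complex.I * p.theta x) * f₂ x ^ 2

/-! ### The Hessian of the Hamiltonian and the Krein signature

In the real variables `ψ = (r + i ℓ) / √2` the equation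
`i ψ_t + ω ψ + ψ_xx / 2 + ψ |ψ| ^ 2 = 0` is `(r, ℓ)_t = J Ĥ'(r, ℓ)`, `J = [[0, 1], [-1, 0]]`, with
`Ĥ = ∫ (r_x ^ 2 + ℓ_x ^ 2) / 4 - (r ^ 2 + ℓ ^ 2) ^ 2 / 8 - ω (r ^ 2 + ℓ ^ 2) / 2`. -/

def rTilde (x : ℝ) : ℝ := Real.sqrt 2 * (p.phi x).re

def lTilde (x : ℝ) : ℝ := Real.sqrt 2 * (p.phi x).im

/-- First component of `Ĥ''(r̃, ℓ̃) (W₁, W₂)`. -/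
def hessFst (W₁ W₂ : ℝ → ℂ) (x : ℝ) : ℂ :=
  -(1 / 2) * deriv (deriv W₁) x
    - (((3 * p.rTilde x ^ 2 + p.lTilde x ^ 2) / 2 + p.omega : ℝ) : ℂ) * W₁ x
    - ((p.rTilde x * p.lTilde x : ℝ) : ℂ) * W₂ x

/-- Second component of `Ĥ''(r̃, ℓ̃) (W₁, W₂)`. -/
def hessSnd (W₁ W₂ : ℝ → ℂ) (x : ℝ) : ℂ :=
  -((p.rTilde x * p.lTilde x : ℝ) : ℂ) * W₁ x
    - (1 / 2) * deriv (deriv W₂) x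
    - (((p.rTilde x ^ 2 + 3 * p.lTilde x ^ 2) / 2 + p.omega : ℝ) : ℂ) * W₂ x

/-- `(W₁, W₂)` is a nontrivial `C²` solution of `J Ĥ''(r̃, ℓ̃) W = lam W`. -/
structure IsHamEigenfunction (lam : ℂ) (W₁ W₂ : ℝ → ℂ) : Prop where
  contDiff_fst : ContDiff ℝ 2 W₁
  contDiff_snd : ContDiff ℝ 2 W₂
  nontrivial : ∃ x, W₁ x ≠ 0 ∨ W₂ x ≠ 0
  eigen_fst : ∀ x, p.hessSnd W₁ W₂ x = lam * W₁ x
  eigen_snd : ∀ x, -p.hessFst W₁ W₂ x = lam * W₂ x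

/-- `⟨W, Ĥ''(r̃, ℓ̃) W⟩` over `P` periods. -/
def energy (P : ℕ) (W₁ W₂ : ℝ → ℂ) : ℂ :=
  ∫ x in (-(P * p.T / 2))..(P * p.T / 2),
    conj (W₁ x) * p.hessFst W₁ W₂ x + conj (W₂ x) * p.hessSnd W₁ W₂ x

end EllipticParams

/-- The squared eigenfunction `(W₁, W₂)` of `J Ĥ''(r̃, ℓ̃)`. -/
def sqW₁ (f₁ f₂ : ℝ → ℂ) (x : ℝ) : ℂ := f₁ x ^ 2 - f₂ x ^ 2

def sqW₂ (f₁ f₂ : ℝ → ℂ) (x : ℝ) : ℂ := -Complex.I * f₁ x ^ 2 - Complex.I * f₂ x ^ 2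

/-- `K₂`, for the squared eigenfunction obtained from the Lax eigenfunction `(f₁, f₂)`. -/
def K₂ (p : EllipticParams) (P : ℕ) (f₁ f₂ : ℝ → ℂ) : ℂ :=
  p.energy P (sqW₁ f₁ f₂) (sqW₂ f₁ f₂)

/-- The Krein signature: the sign of `K₂` (which is real for the eigenfunctions at hand). -/
def kreinSignature (p : EllipticParams) (P : ℕ) (f₁ f₂ : ℝ → ℂ) : SignType :=
  SignType.sign (K₂ p P f₁ f₂).re

end NLSKrein

end

namespace NLSKrein

/-! ### Jacobi elliptic functions -/

/-! For real `ζ` both Lax matrices are skew-Hermitian: `A = i a` with `a = -ζ² + |φ|²/2 + ω/2` real,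
and `C = -B*`. Hence `-Ω² = a² + |B|² ≥ 0`, so `Ω = i w` with `w` real and `|a| ≤ |w|`, and `|φ₁|² +
|φ₂|²` does not depend on `x`; this gives boundedness. If `Ω ≠ 0`, the `Ω`-eigenspace of the
trace-free time matrix has dimension at most one, so Lax eigenfunctions are unique up to a factor.
Translation by a period, corrected by a constant gauge, therefore multiplies them by a number of
modulus one, which is the Floquet form.

The time equations also give `(w - a)|φ₁|² = (w + a)|φ₂|²`, and the normalization amounts to `|φ₁|²
+ |φ₂|² = 2|w|`. Differentiating `φ₁²` and `φ₂²` twice and eliminating the product terms by the time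
equations gives the linearized NLS equation for the squares. By that equation the energy density is
`4iΩ(|φ₁|⁴ - |φ₂|⁴) = -16 w² a`. Since `|φ|² = b - 1 + dn²` and the integral of `dn²` over a period
is `2E`, the mean of `a` is `ζ_c² - ζ²`; this is the formula for `K₂` (`integral_aReal`,
`IsLaxEigenfunction.K₂_eq`).

For existence, the quotient `φ₂/φ₁ = iB*/(a + w)` solves a Riccati equation wherever `a + w ≠ 0`,
and a quadrature then yields `φ₁`. The symmetry `(φ₂*, -φ₁*)`, which replaces `w` by `-w`, covers
the case where `a - w` has no zero. If both have zeros, the solution is dnoidal and `ζ = 0`, where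
`(cn, -sn)` is explicit. The case `Ω = 0` forces `k = 0` and is explicit too.

For collisions, the Floquet exponent is controlled by the increment `G(ζ)` of the argument of `φ₁`
over a period. The `ζ`-derivative of its density is `-a/w` plus the `x`-derivative of a periodic
function, so `G'(ζ) = (T/w)(ζ² - ζ_c²)`: the same mean of `a` governs `G'` and `K₂`. Two nearby
parameters with equal Floquet multiplier have equal `G`, and Rolle's theorem puts a zero of `ζ² -
ζ_c²` strictly between them. Away from `ζ = 0` the function `ζ²` is monotone, so the two signatures
are opposite. Along the sequence this needs bounds uniform in the parameters
(`exists_uniform_neighborhood`). -/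

theorem one_sub_sq_mul_sin_sq_pos {k : ℝ} (hk0 : 0 ≤ k) (hk1 : k < 1) (y : ℝ) :
    0 < 1 - k ^ 2 * Real.sin y ^ 2 := by
  have h1 : Real.sin y ^ 2 ≤ 1 := Real.sin_sq_le_one y
  nlinarith [sq_nonneg (Real.sin y), sq_nonneg k]

theorem continuous_ellF_integrand {k : ℝ} (hk0 : 0 ≤ k) (hk1 : k < 1) :
    Continuous (fun y : ℝ => 1 / Real.sqrt (1 - k ^ 2 * Real.sin y ^ 2)) :=
  continuous_const.div (by fun_prop)
    fun y => (Real.sqrt_pos.mpr (one_sub_sq_mul_sin_sq_pos hk0 hk1 y)).ne'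

/-- An even `π`-periodic function over `P` quarter periods. -/
theorem integral_zero_nat_mul_half_pi {f : ℝ → ℝ} (hf : Continuous f)
    (heven : ∀ y, f (-y) = f y) (hper : Function.Periodic f Real.pi) (P : ℕ) :
    ∫ y in (0 : ℝ)..(P * (Real.pi / 2)), f y = P * ∫ y in (0 : ℝ)..(Real.pi / 2), f y := by
  have hi : ∀ a b, IntervalIntegrable f MeasureTheory.volume a b :=
    fun a b => hf.intervalIntegrable a b
  have hsym : ∀ s, ∫ y in (-s)..s, f y = 2 * ∫ y in (0 : ℝ)..s, f y := by
    intro s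
    have h1 : ∫ y in (-s)..0, f y = ∫ y in (0 : ℝ)..s, f y := by
      have h := intervalIntegral.integral_comp_neg (a := -s) (b := 0) f
      simpa [heven] using h
    rw [← intervalIntegral.integral_add_adjacent_intervals (hi (-s) 0) (hi 0 s), h1]
    ring
  -- The symmetric interval of length `P π` consists of `P` whole periods, whatever the parity of
  -- `P`; evenness then halves it.
  have h2 : ∫ y in (-(P * (Real.pi / 2)))..(P * (Real.pi / 2)), f y
      = P * ∫ y in (0 : ℝ)..Real.pi, f y := by
    have h := hper.intervalIntegral_add_zsmul_eq (P : ℤ) (-(P * (Real.pi / 2)))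
    have e : -(P * (Real.pi / 2)) + (P : ℤ) • Real.pi = P * (Real.pi / 2) := by
      simp; ring
    rw [e] at h
    rw [h hi, hper.intervalIntegral_add_eq _ 0]
    simp
  have h3 : ∫ y in (0 : ℝ)..Real.pi, f y = 2 * ∫ y in (0 : ℝ)..(Real.pi / 2), f y := by
    have h := hper.intervalIntegral_add_eq 0 (-(Real.pi / 2))
    rw [zero_add] at h
    rw [h, show -(Real.pi / 2) + Real.pi = Real.pi / 2 by ring, hsym]
  have h4 := hsym (P * (Real.pi / 2))
  rw [h2, h3] at h4
  linarith

section Jacobi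

variable {k : ℝ}

noncomputable def jacobiDn (k x : ℝ) : ℝ := Real.sqrt (1 - k ^ 2 * jacobiSn k x ^ 2)

theorem ellF_nat_mul_half_pi (hk0 : 0 ≤ k) (hk1 : k < 1) (P : ℕ) :
    ellF k (P * (Real.pi / 2)) = P * ellK k :=
  integral_zero_nat_mul_half_pi (continuous_ellF_integrand hk0 hk1) (by simp)
    (by intro y; simp [Real.sin_add_pi]) P

theorem ellF_neg (s : ℝ) : ellF k (-s) = -ellF k s := by
  have h := intervalIntegral.integral_comp_neg (a := 0) (b := s)
    (fun y => 1 / Real.sqrt (1 - k ^ 2 * Real.sin y ^ 2))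
  simp only [Real.sin_neg, neg_sq, neg_zero] at h
  rw [ellF, ellF, h, intervalIntegral.integral_symm]

theorem ellF_add_pi (hk0 : 0 ≤ k) (hk1 : k < 1) (s : ℝ) :
    ellF k (s + Real.pi) = ellF k s + 2 * ellK k := by
  have hper : Function.Periodic
      (fun y : ℝ => 1 / Real.sqrt (1 - k ^ 2 * Real.sin y ^ 2)) Real.pi := by
    intro y; simp [Real.sin_add_pi]
  have hi := fun a b => (continuous_ellF_integrand hk0 hk1).intervalIntegrable
    (μ := MeasureTheory.volume) a b
  have h := ellF_nat_mul_half_pi hk0 hk1 2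
  have e : ((2 : ℕ) : ℝ) * (Real.pi / 2) = 0 + Real.pi := by push_cast; ring
  rw [e] at h
  have h1 := hper.intervalIntegral_add_eq 0 s
  unfold ellF at h ⊢
  rw [← intervalIntegral.integral_add_adjacent_intervals (hi 0 s) (hi s (s + Real.pi)), ← h1, h]
  push_cast; ring

theorem hasDerivAt_ellF (hk0 : 0 ≤ k) (hk1 : k < 1) (s : ℝ) :
    HasDerivAt (ellF k) (1 / Real.sqrt (1 - k ^ 2 * Real.sin s ^ 2)) s :=
  (continuous_ellF_integrand hk0 hk1).integral_hasStrictDerivAt 0 s |>.hasDerivAt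

theorem strictMono_ellF (hk0 : 0 ≤ k) (hk1 : k < 1) : StrictMono (ellF k) := by
  refine strictMono_of_deriv_pos fun s => ?_
  rw [(hasDerivAt_ellF hk0 hk1 s).deriv]
  exact one_div_pos.mpr (Real.sqrt_pos.mpr (one_sub_sq_mul_sin_sq_pos hk0 hk1 s))

theorem ellF_jacobiAm (hk0 : 0 ≤ k) (hk1 : k < 1) (x : ℝ) : ellF k (jacobiAm k x) = x :=
  Function.invFun_eq ((ellF_bijective hk0 hk1).2 x)

theorem jacobiAm_ellF (hk0 : 0 ≤ k) (hk1 : k < 1) (s : ℝ) : jacobiAm k (ellF k s) = s :=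
  (ellF_bijective hk0 hk1).1 (ellF_jacobiAm hk0 hk1 _)

theorem continuous_jacobiAm (hk0 : 0 ≤ k) (hk1 : k < 1) : Continuous (jacobiAm k) := by
  have hs := (strictMono_ellF hk0 hk1)
  let e := hs.orderIsoOfSurjective _ (ellF_bijective hk0 hk1).2
  have h : jacobiAm k = e.symm := by
    funext x
    apply hs.injective
    rw [ellF_jacobiAm hk0 hk1]
    exact (e.apply_symm_apply x).symm
  rw [h]
  exact e.symm.continuous

theorem hasDerivAt_jacobiAm (hk0 : 0 ≤ k) (hk1 : k < 1) (x : ℝ) :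
    HasDerivAt (jacobiAm k) (jacobiDn k x) x := by
  have h := HasDerivAt.of_local_left_inverse (continuous_jacobiAm hk0 hk1).continuousAt
    (hasDerivAt_ellF hk0 hk1 (jacobiAm k x))
    (one_div_pos.mpr (Real.sqrt_pos.mpr (one_sub_sq_mul_sin_sq_pos hk0 hk1 _))).ne'
    (Eventually.of_forall (ellF_jacobiAm hk0 hk1))
  simpa [jacobiDn, jacobiSn] using h

theorem jacobiAm_zero (hk0 : 0 ≤ k) (hk1 : k < 1) : jacobiAm k 0 = 0 := by
  have h := jacobiAm_ellF hk0 hk1 0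
  simpa [ellF] using h

theorem jacobiAm_nat_mul_ellK (hk0 : 0 ≤ k) (hk1 : k < 1) (P : ℕ) :
    jacobiAm k (P * ellK k) = P * (Real.pi / 2) := by
  rw [← ellF_nat_mul_half_pi hk0 hk1, jacobiAm_ellF hk0 hk1]

theorem jacobiAm_neg (hk0 : 0 ≤ k) (hk1 : k < 1) (x : ℝ) : jacobiAm k (-x) = -jacobiAm k x := by
  apply (ellF_bijective hk0 hk1).1
  rw [ellF_neg, ellF_jacobiAm hk0 hk1, ellF_jacobiAm hk0 hk1]

theorem jacobiAm_add_two_mul_ellK (hk0 : 0 ≤ k) (hk1 : k < 1) (x : ℝ) :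
    jacobiAm k (x + 2 * ellK k) = jacobiAm k x + Real.pi := by
  apply (ellF_bijective hk0 hk1).1
  rw [ellF_add_pi hk0 hk1, ellF_jacobiAm hk0 hk1, ellF_jacobiAm hk0 hk1]

theorem jacobiSn_zero (hk0 : 0 ≤ k) (hk1 : k < 1) : jacobiSn k 0 = 0 := by
  simp [jacobiSn, jacobiAm_zero hk0 hk1]

theorem jacobiCn_zero (hk0 : 0 ≤ k) (hk1 : k < 1) : jacobiCn k 0 = 1 := by
  simp [jacobiCn, jacobiAm_zero hk0 hk1]

theorem jacobiSn_ellK (hk0 : 0 ≤ k) (hk1 : k < 1) : jacobiSn k (ellK k) = 1 := by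
  have h := jacobiAm_nat_mul_ellK hk0 hk1 1
  simp only [Nat.cast_one, one_mul] at h
  simp [jacobiSn, h]

theorem jacobiSn_add_two_mul_ellK (hk0 : 0 ≤ k) (hk1 : k < 1) (x : ℝ) :
    jacobiSn k (x + 2 * ellK k) = -jacobiSn k x := by
  rw [jacobiSn, jacobiAm_add_two_mul_ellK hk0 hk1, Real.sin_add_pi, jacobiSn]

theorem jacobiCn_add_two_mul_ellK (hk0 : 0 ≤ k) (hk1 : k < 1) (x : ℝ) :
    jacobiCn k (x + 2 * ellK k) = -jacobiCn k x := by
  rw [jacobiCn, jacobiAm_add_two_mul_ellK hk0 hk1, Real.cos_add_pi, jacobiCn]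

theorem jacobiSn_sq_add_jacobiCn_sq (x : ℝ) : jacobiSn k x ^ 2 + jacobiCn k x ^ 2 = 1 :=
  Real.sin_sq_add_cos_sq _

theorem jacobiDn_pos (hk0 : 0 ≤ k) (hk1 : k < 1) (x : ℝ) : 0 < jacobiDn k x :=
  Real.sqrt_pos.mpr (one_sub_sq_mul_sin_sq_pos hk0 hk1 _)

theorem jacobiDn_sq (hk0 : 0 ≤ k) (hk1 : k < 1) (x : ℝ) :
    jacobiDn k x ^ 2 = 1 - k ^ 2 * jacobiSn k x ^ 2 :=
  Real.sq_sqrt (one_sub_sq_mul_sin_sq_pos hk0 hk1 _).le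

theorem hasDerivAt_jacobiSn (hk0 : 0 ≤ k) (hk1 : k < 1) (x : ℝ) :
    HasDerivAt (jacobiSn k) (jacobiCn k x * jacobiDn k x) x :=
  (hasDerivAt_jacobiAm hk0 hk1 x).sin

theorem hasDerivAt_jacobiCn (hk0 : 0 ≤ k) (hk1 : k < 1) (x : ℝ) :
    HasDerivAt (jacobiCn k) (-jacobiSn k x * jacobiDn k x) x :=
  (hasDerivAt_jacobiAm hk0 hk1 x).cos

theorem hasDerivAt_jacobiDn (hk0 : 0 ≤ k) (hk1 : k < 1) (x : ℝ) :
    HasDerivAt (jacobiDn k) (-k ^ 2 * jacobiSn k x * jacobiCn k x) x := by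
  have h1 : HasDerivAt (fun x => 1 - k ^ 2 * jacobiSn k x ^ 2)
      (-2 * k ^ 2 * jacobiSn k x * (jacobiCn k x * jacobiDn k x)) x := by
    refine ((((hasDerivAt_jacobiSn hk0 hk1 x).pow 2).const_mul (k ^ 2)).const_sub 1).congr_deriv ?_
    norm_num; ring
  refine (h1.sqrt (one_sub_sq_mul_sin_sq_pos hk0 hk1 _).ne').congr_deriv ?_
  have h2 := (jacobiDn_pos hk0 hk1 x).ne'
  change _ / (2 * jacobiDn k x) = _
  field_simp

/-! ### Complete elliptic integrals -/

theorem ellK_pos (hk0 : 0 ≤ k) (hk1 : k < 1) : 0 < ellK k := by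
  have h := strictMono_ellF hk0 hk1 (show (0 : ℝ) < Real.pi / 2 by positivity)
  simpa [ellF, ellK] using h

theorem ellK_le (hk0 : 0 ≤ k) (hk1 : k < 1) : ellK k ≤ Real.pi / 2 / Real.sqrt (1 - k ^ 2) := by
  have hk : 0 < 1 - k ^ 2 := by nlinarith
  have h : ellK k ≤ ∫ _y in (0 : ℝ)..(Real.pi / 2), 1 / Real.sqrt (1 - k ^ 2) := by
    refine intervalIntegral.integral_mono_on (by positivity)
      ((continuous_ellF_integrand hk0 hk1).intervalIntegrable _ _) (by simp) fun y _ => ?_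
    refine one_div_le_one_div_of_le (Real.sqrt_pos.mpr hk) (Real.sqrt_le_sqrt ?_)
    nlinarith [Real.sin_sq_le_one y, sq_nonneg k]
  refine h.trans (le_of_eq ?_)
  simp; ring

theorem ellE_nonneg : 0 ≤ ellE k :=
  intervalIntegral.integral_nonneg (by positivity) fun _ _ => Real.sqrt_nonneg _

theorem ellE_le_ellK (hk0 : 0 ≤ k) (hk1 : k < 1) : ellE k ≤ ellK k := by
  refine intervalIntegral.integral_mono_on (by positivity)
      ((by fun_prop : Continuous _).intervalIntegrable _ _)
      ((continuous_ellF_integrand hk0 hk1).intervalIntegrable _ _) fun y _ => ?_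
  have h := one_sub_sq_mul_sin_sq_pos hk0 hk1 y
  rw [le_div_iff₀ (Real.sqrt_pos.mpr h), Real.mul_self_sqrt h.le]
  nlinarith [mul_nonneg (sq_nonneg k) (sq_nonneg (Real.sin y))]

theorem continuous_jacobiDn (hk0 : 0 ≤ k) (hk1 : k < 1) : Continuous (jacobiDn k) :=
  continuous_iff_continuousAt.mpr fun x => (hasDerivAt_jacobiDn hk0 hk1 x).continuousAt

/-- Substitute `y = am x`, `dy = dn dx`: one factor `dn` is the Jacobian and the other is the
integrand of `ellE`. -/
theorem integral_jacobiDn_sq (hk0 : 0 ≤ k) (hk1 : k < 1) (P : ℕ) :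
    ∫ x in (0 : ℝ)..(P * ellK k), jacobiDn k x ^ 2 = P * ellE k := by
  have hg : Continuous fun y : ℝ => Real.sqrt (1 - k ^ 2 * Real.sin y ^ 2) := by fun_prop
  have h := intervalIntegral.integral_comp_mul_deriv (a := 0) (b := P * ellK k)
    (fun x _ => hasDerivAt_jacobiAm hk0 hk1 x)
    (continuous_jacobiDn hk0 hk1).continuousOn hg
  rw [jacobiAm_zero hk0 hk1, jacobiAm_nat_mul_ellK hk0 hk1,
    integral_zero_nat_mul_half_pi hg (by simp) (by intro y; simp [Real.sin_add_pi])] at h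
  rw [ellE, ← h]
  refine intervalIntegral.integral_congr fun x _ => ?_
  simp only [Function.comp, jacobiDn, jacobiSn]
  ring

end Jacobi

end NLSKrein

namespace NLSKrein

namespace EllipticParams

variable (p : EllipticParams)

/-! ### The elliptic solution and its first integrals -/

/-- The squared amplitude `|φ| ^ 2 = b - k ^ 2 sn ^ 2`. -/
noncomputable def ampSq (x : ℝ) : ℝ := p.b - p.k ^ 2 * jacobiSn p.k x ^ 2

/-- Half of the derivative of the squared amplitude. -/
noncomputable def halfDerivAmpSq (x : ℝ) : ℝ :=
  -p.k ^ 2 * jacobiSn p.k x * jacobiCn p.k x * jacobiDn p.k x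

/-- The constant `|φ'| ^ 2 + |φ| ^ 4 + 2 ω |φ| ^ 2`. -/
noncomputable def firstIntegral : ℝ :=
  2 * p.b + 2 * p.b * p.k ^ 2 - 3 * p.b ^ 2 - p.k ^ 2

theorem hasDerivAt_ampSq (x : ℝ) : HasDerivAt p.ampSq (2 * p.halfDerivAmpSq x) x := by
  refine ((((hasDerivAt_jacobiSn p.k_nonneg p.k_lt_one x).pow 2).const_mul
    (p.k ^ 2)).const_sub p.b).congr_deriv ?_
  rw [halfDerivAmpSq]; norm_num; ring

theorem hasDerivAt_halfDerivAmpSq (x : ℝ) : HasDerivAt p.halfDerivAmpSq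
    (-3 * p.ampSq x ^ 2 - 4 * p.omega * p.ampSq x + p.firstIntegral) x := by
  have hs := hasDerivAt_jacobiSn p.k_nonneg p.k_lt_one x
  have hc := hasDerivAt_jacobiCn p.k_nonneg p.k_lt_one x
  have hd := hasDerivAt_jacobiDn p.k_nonneg p.k_lt_one x
  refine (((hs.const_mul (-p.k ^ 2)).mul hc).mul hd).congr_deriv ?_
  have e1 := jacobiDn_sq p.k_nonneg p.k_lt_one x
  have e2 : jacobiCn p.k x ^ 2 = 1 - jacobiSn p.k x ^ 2 := by
    have := jacobiSn_sq_add_jacobiCn_sq (k := p.k) x; linarith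
  rw [ampSq, firstIntegral, omega]
  simp only [Pi.mul_apply]
  linear_combination (-p.k ^ 2 * jacobiCn p.k x ^ 2 + p.k ^ 2 * jacobiSn p.k x ^ 2) * e1
    + (-p.k ^ 2 * (1 - p.k ^ 2 * jacobiSn p.k x ^ 2) + p.k ^ 4 * jacobiSn p.k x ^ 2) * e2

/-- This is the first integral for `|φ'|²` multiplied by `|φ|²`, since `φ' φ* = h + i c` with `h`
half the derivative of `|φ|²`. In this form it involves no division by the amplitude, so it also
holds in the cnoidal case. -/
theorem halfDerivAmpSq_sq (x : ℝ) : p.halfDerivAmpSq x ^ 2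
    = -p.ampSq x ^ 3 - 2 * p.omega * p.ampSq x ^ 2 + p.firstIntegral * p.ampSq x - p.c ^ 2 := by
  have e1 := jacobiDn_sq p.k_nonneg p.k_lt_one x
  have e2 : jacobiCn p.k x ^ 2 = 1 - jacobiSn p.k x ^ 2 := by
    have := jacobiSn_sq_add_jacobiCn_sq (k := p.k) x; linarith
  rw [p.c_sq, ampSq, firstIntegral, omega, halfDerivAmpSq]
  linear_combination (p.k ^ 4 * jacobiSn p.k x ^ 2 * jacobiCn p.k x ^ 2) * e1
    + (p.k ^ 4 * jacobiSn p.k x ^ 2 * (1 - p.k ^ 2 * jacobiSn p.k x ^ 2)) * e2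

theorem continuous_ampSq : Continuous p.ampSq :=
  continuous_iff_continuousAt.mpr fun x => (p.hasDerivAt_ampSq x).continuousAt

theorem continuous_halfDerivAmpSq : Continuous p.halfDerivAmpSq :=
  continuous_iff_continuousAt.mpr fun x => (p.hasDerivAt_halfDerivAmpSq x).continuousAt

theorem ampSq_le (x : ℝ) : p.ampSq x ≤ p.b := by
  rw [ampSq]; nlinarith [mul_nonneg (sq_nonneg p.k) (sq_nonneg (jacobiSn p.k x))]

theorem le_ampSq (x : ℝ) : p.b - p.k ^ 2 ≤ p.ampSq x := by
  rw [ampSq]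
  have := jacobiSn_sq_add_jacobiCn_sq (k := p.k) x
  nlinarith [mul_nonneg (sq_nonneg p.k) (sq_nonneg (jacobiCn p.k x))]

theorem ampSq_zero : p.ampSq 0 = p.b := by
  simp [ampSq, jacobiSn_zero p.k_nonneg p.k_lt_one]

theorem ampSq_ellK : p.ampSq (ellK p.k) = p.b - p.k ^ 2 := by
  simp [ampSq, jacobiSn_ellK p.k_nonneg p.k_lt_one]

theorem ampSq_add_T (x : ℝ) : p.ampSq (x + p.T) = p.ampSq x := by
  simp [ampSq, T, jacobiSn_add_two_mul_ellK p.k_nonneg p.k_lt_one]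

theorem halfDerivAmpSq_add_T (x : ℝ) : p.halfDerivAmpSq (x + p.T) = p.halfDerivAmpSq x := by
  simp [halfDerivAmpSq, T, jacobiDn, jacobiSn_add_two_mul_ellK p.k_nonneg p.k_lt_one,
    jacobiCn_add_two_mul_ellK p.k_nonneg p.k_lt_one]

theorem T_pos : 0 < p.T := by
  have := ellK_pos p.k_nonneg p.k_lt_one
  rw [T]; linarith

theorem R_sq (x : ℝ) : p.R x ^ 2 = p.ampSq x := by
  rw [R, ampSq]
  split_ifs with h
  · have := jacobiSn_sq_add_jacobiCn_sq (k := p.k) x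
    rw [h]; linear_combination p.k ^ 2 * this
  · refine Real.sq_sqrt ?_
    have := p.le_ampSq x
    have := p.k_sq_le
    rw [ampSq] at *; linarith

theorem ampSq_nonneg (x : ℝ) : 0 ≤ p.ampSq x := p.R_sq x ▸ sq_nonneg _

theorem c_eq_zero_of_b_eq (h : p.b = p.k ^ 2) : p.c = 0 := by
  have := p.c_sq
  rw [h, sub_self, mul_zero] at this
  exact pow_eq_zero_iff (two_ne_zero) |>.mp this

theorem ampSq_pos (h : p.b ≠ p.k ^ 2) (x : ℝ) : 0 < p.ampSq x := by
  have := lt_of_le_of_ne p.k_sq_le (Ne.symm h)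
  have := p.le_ampSq x
  linarith

/-- The derivative of `θ`. -/
noncomputable def thetaDeriv (x : ℝ) : ℝ := p.c / p.ampSq x

theorem thetaDeriv_eq (x : ℝ) : p.c / p.R x ^ 2 = p.thetaDeriv x := by
  rw [R_sq, thetaDeriv]

theorem hasDerivAt_thetaDeriv (x : ℝ) : HasDerivAt p.thetaDeriv
    (-2 * p.c * p.halfDerivAmpSq x / p.ampSq x ^ 2) x := by
  by_cases h : p.b = p.k ^ 2
  · have : p.thetaDeriv = fun _ => 0 := by funext y; simp [thetaDeriv, p.c_eq_zero_of_b_eq h]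
    rw [this, p.c_eq_zero_of_b_eq h]
    simpa using hasDerivAt_const x (0 : ℝ)
  · refine ((hasDerivAt_const x p.c).div (p.hasDerivAt_ampSq x) (p.ampSq_pos h x).ne').congr_deriv ?_
    ring

theorem continuous_thetaDeriv : Continuous p.thetaDeriv :=
  continuous_iff_continuousAt.mpr fun x => (p.hasDerivAt_thetaDeriv x).continuousAt

theorem theta_eq (x : ℝ) : p.theta x = ∫ y in (0 : ℝ)..x, p.thetaDeriv y := by
  simp only [theta, thetaDeriv_eq]

theorem hasDerivAt_theta (x : ℝ) : HasDerivAt p.theta (p.thetaDeriv x) x := by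
  have : p.theta = fun x => ∫ y in (0 : ℝ)..x, p.thetaDeriv y := funext p.theta_eq
  rw [this]
  exact (p.continuous_thetaDeriv.integral_hasStrictDerivAt 0 x).hasDerivAt

theorem thetaDeriv_add_T (x : ℝ) : p.thetaDeriv (x + p.T) = p.thetaDeriv x := by
  rw [thetaDeriv, ampSq_add_T, thetaDeriv]

theorem theta_add_T (x : ℝ) : p.theta (x + p.T) = p.theta x + p.theta p.T := by
  have hi := fun a b => p.continuous_thetaDeriv.intervalIntegrable
    (μ := MeasureTheory.volume) a b
  have hper : Function.Periodic p.thetaDeriv p.T := p.thetaDeriv_add_T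
  have h1 := hper.intervalIntegral_add_eq 0 x
  rw [zero_add] at h1
  rw [theta_eq, theta_eq, theta_eq,
    ← intervalIntegral.integral_add_adjacent_intervals (hi 0 x) (hi x (x + p.T)), h1]

theorem theta_of_c_eq_zero (h : p.c = 0) (x : ℝ) : p.theta x = 0 := by simp [theta, h]

/-- Away from `b = k²` this is `R R' = h`. If `b = k²`, the amplitude may vanish, but then `c = 0`
and both sides are `0`. -/
theorem R_div_cube (x : ℝ) : p.c * deriv p.R x / p.R x ^ 3
    = p.c * p.halfDerivAmpSq x / p.ampSq x ^ 2 := by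
  by_cases h : p.b = p.k ^ 2
  · simp [p.c_eq_zero_of_b_eq h]
  · have hR : p.R = fun x => Real.sqrt (p.ampSq x) := by
      funext y; rw [R, if_neg h, ampSq]
    have hq := p.ampSq_pos h x
    have hd : HasDerivAt p.R (2 * p.halfDerivAmpSq x / (2 * p.R x)) x := by
      have := (p.hasDerivAt_ampSq x).sqrt hq.ne'
      rw [hR]; exact this
    have h0 : p.R x ≠ 0 := by
      intro h0; have := p.R_sq x; rw [h0] at this; norm_num at this; linarith
    rw [hd.deriv, ← R_sq]
    field_simp

/-- `φ' / φ` away from the case `b = k ^ 2`. -/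
theorem hasDerivAt_phi_of_ne (h : p.b ≠ p.k ^ 2) (x : ℝ) : HasDerivAt p.phi
    (((p.halfDerivAmpSq x : ℂ) + Complex.I * p.c) / p.ampSq x * p.phi x) x := by
  have hR : p.R = fun x => Real.sqrt (p.ampSq x) := by
    funext y; rw [R, if_neg h, ampSq]
  have hq := p.ampSq_pos h x
  have hd : HasDerivAt p.R (2 * p.halfDerivAmpSq x / (2 * p.R x)) x := by
    have := (p.hasDerivAt_ampSq x).sqrt hq.ne'
    rw [hR]; exact this
  have h0 : p.R x ≠ 0 := by
    intro h0; have := p.R_sq x; rw [h0] at this; norm_num at this; linarith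
  refine (hd.ofReal_comp.mul ((((p.hasDerivAt_theta x).ofReal_comp).const_mul
    Complex.I).cexp)).congr_deriv ?_
  have h0' : (p.R x : ℂ) ≠ 0 := by exact_mod_cast h0
  rw [thetaDeriv, ← R_sq, phi]
  push_cast
  field_simp

theorem phi_of_eq (h : p.b = p.k ^ 2) (x : ℝ) : p.phi x = ((p.k * jacobiCn p.k x : ℝ) : ℂ) := by
  rw [phi, p.theta_of_c_eq_zero (p.c_eq_zero_of_b_eq h), R, if_pos h]
  simp

theorem hasDerivAt_phi_of_eq (h : p.b = p.k ^ 2) (x : ℝ) : HasDerivAt p.phi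
    ((-(p.k * jacobiSn p.k x * jacobiDn p.k x) : ℝ) : ℂ) x := by
  have : p.phi = fun x => ((p.k * jacobiCn p.k x : ℝ) : ℂ) := funext (p.phi_of_eq h)
  rw [this]
  have := ((hasDerivAt_jacobiCn p.k_nonneg p.k_lt_one x).const_mul p.k).ofReal_comp
  refine this.congr_deriv ?_
  push_cast; ring

theorem hasDerivAt_phi (x : ℝ) : HasDerivAt p.phi (deriv p.phi x) x := by
  by_cases h : p.b = p.k ^ 2
  · exact (p.hasDerivAt_phi_of_eq h x).differentiableAt.hasDerivAt
  · exact (p.hasDerivAt_phi_of_ne h x).differentiableAt.hasDerivAt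

theorem norm_phi_sq (x : ℝ) : ‖p.phi x‖ ^ 2 = p.ampSq x := by
  have : ‖Complex.exp (Complex.I * (p.theta x : ℂ))‖ = 1 := by
    rw [mul_comm]; exact Complex.norm_exp_ofReal_mul_I _
  rw [phi, norm_mul, this, mul_one, Complex.norm_real, Real.norm_eq_abs, sq_abs, R_sq]

theorem phi_mul_conj (x : ℝ) : p.phi x * conj (p.phi x) = p.ampSq x := by
  rw [Complex.mul_conj, Complex.normSq_eq_norm_sq, norm_phi_sq]

/-- The real part is half the derivative of `|φ|²` and the imaginary part is `R² θ' = c`. Later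
computations use `φ` through such identities, without separating the cnoidal case. -/
theorem deriv_phi_mul_conj (x : ℝ) :
    deriv p.phi x * conj (p.phi x) = p.halfDerivAmpSq x + Complex.I * p.c := by
  by_cases h : p.b = p.k ^ 2
  · rw [(p.hasDerivAt_phi_of_eq h x).deriv, p.phi_of_eq h, p.c_eq_zero_of_b_eq h,
      Complex.conj_ofReal, halfDerivAmpSq]
    push_cast; ring
  · have hq : (p.ampSq x : ℂ) ≠ 0 := by exact_mod_cast (p.ampSq_pos h x).ne'
    rw [(p.hasDerivAt_phi_of_ne h x).deriv, mul_assoc, phi_mul_conj, div_mul_cancel₀ _ hq]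

theorem hasDerivAt_deriv_phi (x : ℝ) : HasDerivAt (deriv p.phi)
    (-2 * p.omega * p.phi x - 2 * p.ampSq x * p.phi x) x := by
  by_cases h : p.b = p.k ^ 2
  · have e : deriv p.phi = fun x => ((-(p.k * jacobiSn p.k x * jacobiDn p.k x) : ℝ) : ℂ) :=
      funext fun y => (p.hasDerivAt_phi_of_eq h y).deriv
    rw [e, p.phi_of_eq h]
    have hs := hasDerivAt_jacobiSn p.k_nonneg p.k_lt_one x
    have hd := hasDerivAt_jacobiDn p.k_nonneg p.k_lt_one x
    have := ((hs.const_mul p.k).mul hd).neg.ofReal_comp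
    refine this.congr_deriv ?_
    have e1 := jacobiDn_sq p.k_nonneg p.k_lt_one x
    rw [ampSq, omega, h]
    rw [← sub_eq_zero]
    rw [← sub_eq_zero] at e1
    have e1' := congrArg (fun r : ℝ => (r : ℂ)) e1
    push_cast at e1' ⊢
    linear_combination (-p.k * jacobiCn p.k x : ℂ) * e1'
  · have e : deriv p.phi = fun x =>
        ((p.halfDerivAmpSq x : ℂ) + Complex.I * p.c) / p.ampSq x * p.phi x :=
      funext fun y => (p.hasDerivAt_phi_of_ne h y).deriv
    have hq : (p.ampSq x : ℂ) ≠ 0 := by exact_mod_cast (p.ampSq_pos h x).ne'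
    rw [e]
    refine ((((p.hasDerivAt_halfDerivAmpSq x).ofReal_comp.add_const (Complex.I * p.c)).div
      (p.hasDerivAt_ampSq x).ofReal_comp hq).mul (p.hasDerivAt_phi_of_ne h x)).congr_deriv ?_
    have e2 : (p.halfDerivAmpSq x : ℂ) ^ 2 = -p.ampSq x ^ 3 - 2 * p.omega * p.ampSq x ^ 2
      + p.firstIntegral * p.ampSq x - p.c ^ 2 := by exact_mod_cast p.halfDerivAmpSq_sq x
    have hI := Complex.I_sq
    simp only [Pi.div_apply]
    push_cast
    field_simp
    linear_combination -p.phi x * e2 + p.phi x * (p.c : ℂ) ^ 2 * hI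

theorem norm_deriv_phi_sq (x : ℝ) : deriv p.phi x * conj (deriv p.phi x)
    = ((-p.ampSq x ^ 2 - 2 * p.omega * p.ampSq x + p.firstIntegral : ℝ) : ℂ) := by
  by_cases h : p.b = p.k ^ 2
  · rw [(p.hasDerivAt_phi_of_eq h x).deriv, Complex.conj_ofReal]
    norm_cast
    have e1 := jacobiDn_sq p.k_nonneg p.k_lt_one x
    rw [ampSq, omega, firstIntegral, h]
    linear_combination (p.k ^ 2 * jacobiSn p.k x ^ 2) * e1
  · have hq : (p.ampSq x : ℂ) ≠ 0 := by exact_mod_cast (p.ampSq_pos h x).ne'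
    have e2 : (p.halfDerivAmpSq x : ℂ) ^ 2 = -p.ampSq x ^ 3 - 2 * p.omega * p.ampSq x ^ 2
      + p.firstIntegral * p.ampSq x - p.c ^ 2 := by exact_mod_cast p.halfDerivAmpSq_sq x
    have hI := Complex.I_sq
    have e3 := p.deriv_phi_mul_conj x
    have e4 := congrArg conj e3
    simp only [map_mul, map_add, Complex.conj_conj, Complex.conj_I, Complex.conj_ofReal] at e4
    have e5 := p.phi_mul_conj x
    -- After multiplication by `|φ|²` the left side is `|φ' φ*|² = h² + c²`, to which the cubic
    -- first integral applies.
    apply mul_left_cancel₀ hq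
    push_cast
    linear_combination conj (deriv p.phi x) * p.phi x * e3
      + ((p.halfDerivAmpSq x : ℂ) + Complex.I * p.c) * e4 + e2 - (p.c : ℂ) ^ 2 * hI
      - deriv p.phi x * conj (deriv p.phi x) * e5

/-- The sign `s` is `-1` in the cnoidal case, where `cn` is antiperiodic with respect to `T = 2K`,
and `1` otherwise. -/
theorem phi_add_T : ∃ s : ℂ, s ^ 2 = 1 ∧
    ∀ x, p.phi (x + p.T) = s * Complex.exp (Complex.I * p.theta p.T) * p.phi x := by
  by_cases h : p.b = p.k ^ 2
  · refine ⟨-1, by norm_num, fun x => ?_⟩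
    rw [p.phi_of_eq h, p.phi_of_eq h, p.theta_of_c_eq_zero (p.c_eq_zero_of_b_eq h), T,
      jacobiCn_add_two_mul_ellK p.k_nonneg p.k_lt_one]
    simp
  · refine ⟨1, by norm_num, fun x => ?_⟩
    have hR : p.R (x + p.T) = p.R x := by
      rw [R, R, if_neg h, if_neg h]
      exact congrArg Real.sqrt (p.ampSq_add_T x)
    rw [phi, phi, hR, theta_add_T]
    push_cast
    rw [mul_add, Complex.exp_add]
    ring

theorem deriv_phi_add_T {s : ℂ}
    (h : ∀ x, p.phi (x + p.T) = s * p.phi x) (x : ℝ) :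
    deriv p.phi (x + p.T) = s * deriv p.phi x := by
  have h1 : HasDerivAt (fun x => p.phi (x + p.T)) (deriv p.phi (x + p.T)) x :=
    (p.hasDerivAt_phi (x + p.T)).comp_add_const x p.T
  have h2 : HasDerivAt (fun x => p.phi (x + p.T)) (s * deriv p.phi x) x := by
    rw [funext h]; exact (p.hasDerivAt_phi x).const_mul s
  exact h1.unique h2

end EllipticParams

end NLSKrein

namespace NLSKrein

/-! ### Calculus of complex-valued functions of a real variable -/

theorem _root_.HasDerivAt.complex_conj {f : ℝ → ℂ} {f' : ℂ} {x : ℝ} (h : HasDerivAt f f' x) :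
    HasDerivAt (fun x => conj (f x)) (conj f') x :=
  Complex.conjCLE.hasFDerivAt.comp_hasDerivAt x h

theorem contDiff_two_of_hasDerivAt {f f' f'' : ℝ → ℂ} (h : ∀ x, HasDerivAt f (f' x) x)
    (h' : ∀ x, HasDerivAt f' (f'' x) x) (hc : Continuous f'') : ContDiff ℝ 2 f := by
  have e : deriv f = f' := funext fun x => (h x).deriv
  have e' : deriv f' = f'' := funext fun x => (h' x).deriv
  rw [show (2 : WithTop ℕ∞) = 1 + 1 by norm_num, contDiff_succ_iff_deriv]
  refine ⟨fun x => (h x).differentiableAt, by simp, ?_⟩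
  rw [e, contDiff_one_iff_deriv, e']
  exact ⟨fun x => (h' x).differentiableAt, hc⟩

theorem deriv_deriv_of_hasDerivAt {f f' f'' : ℝ → ℂ} (h : ∀ x, HasDerivAt f (f' x) x)
    (h' : ∀ x, HasDerivAt f' (f'' x) x) (x : ℝ) : deriv (deriv f) x = f'' x := by
  rw [show deriv f = f' from funext fun x => (h x).deriv, (h' x).deriv]

namespace EllipticParams

variable (p : EllipticParams)

theorem continuous_phi : Continuous p.phi :=
  continuous_iff_continuousAt.mpr fun x => (p.hasDerivAt_phi x).continuousAt

theorem A_eq (ζ : ℂ) (x : ℝ) : p.A ζ x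
    = -Complex.I * ζ ^ 2 + Complex.I / 2 * p.ampSq x + Complex.I / 2 * p.omega := by
  rw [A, norm_phi_sq]

/-! ### The squares of Lax eigenfunctions -/

section Squares

variable {p} {ζ Ω : ℂ} {f₁ f₂ : ℝ → ℂ} (hf : p.IsLaxEigenfunction ζ Ω f₁ f₂)
include hf

theorem IsLaxEigenfunction.hasDerivAt_fst_sq (x : ℝ) : HasDerivAt (fun x => f₁ x ^ 2)
    (2 * (-Complex.I * ζ * f₁ x ^ 2 + p.phi x * (f₁ x * f₂ x))) x := by
  refine ((hf.deriv_fst x).pow 2).congr_deriv ?_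
  norm_num; ring

theorem IsLaxEigenfunction.hasDerivAt_snd_sq (x : ℝ) : HasDerivAt (fun x => f₂ x ^ 2)
    (2 * (-conj (p.phi x) * (f₁ x * f₂ x) + Complex.I * ζ * f₂ x ^ 2)) x := by
  refine ((hf.deriv_snd x).pow 2).congr_deriv ?_
  norm_num; ring

/-- Differentiation produces `f₁² ζ²` and the products `ζ φ f₁ f₂`, `φ' f₁ f₂`; these are the terms
of `f₁ (A f₁ + B f₂)`, so the time equation trades them for `Ω f₁²`. The second derivatives of the
squares thus close up on the squares, with no explicit `ζ` left. -/
theorem IsLaxEigenfunction.hasDerivAt_fst_sq_deriv (x : ℝ) : HasDerivAt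
    (fun x => 2 * (-Complex.I * ζ * f₁ x ^ 2 + p.phi x * (f₁ x * f₂ x)))
    ((-4 * p.ampSq x - 2 * p.omega - 4 * Complex.I * Ω) * f₁ x ^ 2
      + 2 * p.phi x ^ 2 * f₂ x ^ 2) x := by
  refine ((((hf.hasDerivAt_fst_sq x).const_mul (-Complex.I * ζ)).add
    ((p.hasDerivAt_phi x).mul ((hf.deriv_fst x).mul (hf.deriv_snd x)))).const_mul 2).congr_deriv ?_
  have h1 := hf.time_fst x
  have h2 := p.phi_mul_conj x
  rw [A_eq, B] at h1
  have hI := Complex.I_sq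
  simp only [Pi.mul_apply]
  linear_combination (-4 * Complex.I * f₁ x) * h1 - 2 * f₁ x ^ 2 * h2
    + (2 * f₁ x ^ 2 * p.ampSq x + 2 * f₁ x ^ 2 * p.omega
      + 2 * f₁ x * f₂ x * deriv p.phi x) * hI

theorem IsLaxEigenfunction.hasDerivAt_snd_sq_deriv (x : ℝ) : HasDerivAt
    (fun x => 2 * (-conj (p.phi x) * (f₁ x * f₂ x) + Complex.I * ζ * f₂ x ^ 2))
    ((-4 * p.ampSq x - 2 * p.omega + 4 * Complex.I * Ω) * f₂ x ^ 2
      + 2 * conj (p.phi x) ^ 2 * f₁ x ^ 2) x := by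
  refine (((((p.hasDerivAt_phi x).complex_conj.neg).mul
    ((hf.deriv_fst x).mul (hf.deriv_snd x))).add
    ((hf.hasDerivAt_snd_sq x).const_mul (Complex.I * ζ))).const_mul 2).congr_deriv ?_
  have h1 := hf.time_snd x
  have h2 := p.phi_mul_conj x
  rw [A_eq, C] at h1
  have hI := Complex.I_sq
  simp only [Pi.mul_apply, Pi.neg_apply]
  linear_combination (4 * Complex.I * f₂ x) * h1 - 2 * f₂ x ^ 2 * h2
    + (2 * f₂ x ^ 2 * p.ampSq x + 2 * f₂ x ^ 2 * p.omega
      - 2 * f₁ x * f₂ x * conj (deriv p.phi x)) * hI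

theorem IsLaxEigenfunction.continuous_fst : Continuous f₁ :=
  continuous_iff_continuousAt.mpr fun x => (hf.deriv_fst x).continuousAt

theorem IsLaxEigenfunction.continuous_snd : Continuous f₂ :=
  continuous_iff_continuousAt.mpr fun x => (hf.deriv_snd x).continuousAt

theorem IsLaxEigenfunction.isHamEigenfunction :
    p.IsHamEigenfunction (2 * Ω) (sqW₁ f₁ f₂) (sqW₂ f₁ f₂) := by
  have c1 := hf.continuous_fst
  have c2 := hf.continuous_snd
  have cφ := p.continuous_phi
  have cq : Continuous fun x => (p.ampSq x : ℂ) :=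
    Complex.continuous_ofReal.comp p.continuous_ampSq
  have cφ' : Continuous fun x => conj (p.phi x) := Complex.continuous_conj.comp cφ
  have d1 := fun x => (hf.hasDerivAt_fst_sq x).sub (hf.hasDerivAt_snd_sq x)
  have d1' := fun x => (hf.hasDerivAt_fst_sq_deriv x).sub (hf.hasDerivAt_snd_sq_deriv x)
  have d2 := fun x => ((hf.hasDerivAt_fst_sq x).const_mul (-Complex.I)).sub
    ((hf.hasDerivAt_snd_sq x).const_mul Complex.I)
  have d2' := fun x => ((hf.hasDerivAt_fst_sq_deriv x).const_mul (-Complex.I)).sub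
    ((hf.hasDerivAt_snd_sq_deriv x).const_mul Complex.I)
  have hφ : ∀ x, p.phi x = (p.phi x).re + Complex.I * (p.phi x).im := fun x => by
    rw [mul_comm]; exact (Complex.re_add_im _).symm
  have hφ' : ∀ x, conj (p.phi x) = (p.phi x).re - Complex.I * (p.phi x).im := fun x => by
    conv_lhs => rw [hφ x]
    simp [sub_eq_add_neg]
  have hq : ∀ x, (p.ampSq x : ℂ) = (p.phi x).re ^ 2 + (p.phi x).im ^ 2 := fun x => by
    rw [← p.phi_mul_conj, hφ', hφ]
    simp only [Complex.add_re, Complex.ofReal_re, Complex.mul_re, Complex.I_re, Complex.I_im,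
      Complex.ofReal_im, Complex.add_im, Complex.mul_im]
    ring_nf
    rw [Complex.I_sq]; ring
  have hs : (Real.sqrt 2) ^ 2 = 2 := Real.sq_sqrt (by norm_num)
  have hr : ∀ x, p.rTilde x ^ 2 = 2 * (p.phi x).re ^ 2 := fun x => by
    rw [rTilde, mul_pow, hs]
  have hl : ∀ x, p.lTilde x ^ 2 = 2 * (p.phi x).im ^ 2 := fun x => by
    rw [lTilde, mul_pow, hs]
  have hrl : ∀ x, p.rTilde x * p.lTilde x = 2 * (p.phi x).re * (p.phi x).im := fun x => by
    rw [rTilde, lTilde]; linear_combination ((p.phi x).re * (p.phi x).im) * hs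
  have hI := Complex.I_sq
  refine ⟨contDiff_two_of_hasDerivAt d1 d1' (by fun_prop),
    contDiff_two_of_hasDerivAt d2 d2' (by fun_prop), ?_, fun x => ?_, fun x => ?_⟩
  -- The map from `(f₁², f₂²)` to `W` is invertible, so `W` vanishes only where both components do.
  · obtain ⟨x, hx⟩ := hf.nontrivial
    refine ⟨x, ?_⟩
    by_contra! h
    obtain ⟨h1, h2⟩ := h
    rw [sqW₁] at h1
    rw [sqW₂] at h2
    have e1 : f₁ x ^ 2 = 0 := by
      linear_combination (1 / 2) * h1 + (Complex.I / 2) * h2 + (1 / 2) * (f₁ x ^ 2 + f₂ x ^ 2) * hI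
    have e2 : f₂ x ^ 2 = 0 := by linear_combination e1 - h1
    rw [sq_eq_zero_iff] at e1 e2
    tauto
  · have e := deriv_deriv_of_hasDerivAt d2 d2' x
    change deriv (deriv (sqW₂ f₁ f₂)) x = _ at e
    rw [hessSnd, e, hrl, hr, hl, hq, hφ', sqW₁, sqW₂]
    generalize hX : (p.phi x).re = X
    generalize hY : (p.phi x).im = Y
    rw [show p.phi x = X + Complex.I * Y by rw [← hX, ← hY]; exact hφ x]
    push_cast
    generalize f₁ x = F; generalize f₂ x = G; generalize (p.omega : ℂ) = w
    linear_combination (Complex.I * ((Y : ℂ) ^ 2 * (F ^ 2 + G ^ 2)) + 2 * X * Y * (G ^ 2 - F ^ 2)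
      + 2 * Ω * (-F ^ 2 + G ^ 2)) * hI
  · have e := deriv_deriv_of_hasDerivAt d1 d1' x
    change deriv (deriv (sqW₁ f₁ f₂)) x = _ at e
    rw [hessFst, e, hrl, hr, hl, hq, hφ', sqW₁, sqW₂]
    generalize hX : (p.phi x).re = X
    generalize hY : (p.phi x).im = Y
    rw [show p.phi x = X + Complex.I * Y by rw [← hX, ← hY]; exact hφ x]
    push_cast
    generalize f₁ x = F; generalize f₂ x = G; generalize (p.omega : ℂ) = w
    linear_combination (Y : ℂ) ^ 2 * (G ^ 2 - F ^ 2) * hI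

/-- The eigenvalue equation replaces the Hessian by `-2Ω W₂` and `2Ω W₁`, and in `2Ω(W₁ W₂* - W₁*
W₂)` the cross terms `f₁² (f₂*)²` cancel. -/
theorem IsLaxEigenfunction.energy_density (x : ℝ) :
    conj (sqW₁ f₁ f₂ x) * p.hessFst (sqW₁ f₁ f₂) (sqW₂ f₁ f₂) x
      + conj (sqW₂ f₁ f₂ x) * p.hessSnd (sqW₁ f₁ f₂) (sqW₂ f₁ f₂) x
    = 4 * Complex.I * Ω * ((f₁ x * conj (f₁ x)) ^ 2 - (f₂ x * conj (f₂ x)) ^ 2) := by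
  have h := hf.isHamEigenfunction
  rw [h.eigen_fst, ← neg_neg (p.hessFst _ _ _), h.eigen_snd]
  simp only [sqW₁, sqW₂, map_sub, map_mul, map_neg, map_pow, Complex.conj_I]
  ring

end Squares

end EllipticParams

end NLSKrein

namespace NLSKrein

namespace EllipticParams

variable (p : EllipticParams)

/-! ### Floquet form of the squared eigenfunctions in the rotating frame -/

section Rotating

variable {p} {ζ Ω : ℂ} {f₁ f₂ : ℝ → ℂ} (hf : p.IsLaxEigenfunction ζ Ω f₁ f₂)
include hf

/-- The computation is carried out for `e^{-iθ} f₁²` and `e^{iθ} f₂²` separately; `U` and `V` are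
constant linear combinations of them, so the Floquet property may be assumed for these two
functions. -/
theorem IsLaxEigenfunction.isBlochEigenfunction {μ : ℝ}
    (h₁ : ∀ x, Complex.exp (-Complex.I * p.theta (x + p.T)) * f₁ (x + p.T) ^ 2
      = Complex.exp (Complex.I * μ * p.T) * (Complex.exp (-Complex.I * p.theta x) * f₁ x ^ 2))
    (h₂ : ∀ x, Complex.exp (Complex.I * p.theta (x + p.T)) * f₂ (x + p.T) ^ 2
      = Complex.exp (Complex.I * μ * p.T) * (Complex.exp (Complex.I * p.theta x) * f₂ x ^ 2)) :
    p.IsBlochEigenfunction (2 * Ω) μ (p.sqU f₁ f₂) (p.sqV f₁ f₂) := by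
  have c1 := hf.continuous_fst
  have c2 := hf.continuous_snd
  have cφ := p.continuous_phi
  have cq : Continuous fun x => (p.ampSq x : ℂ) :=
    Complex.continuous_ofReal.comp p.continuous_ampSq
  have cφ' : Continuous fun x => conj (p.phi x) := Complex.continuous_conj.comp cφ
  have cκ : Continuous fun x => (p.thetaDeriv x : ℂ) :=
    Complex.continuous_ofReal.comp p.continuous_thetaDeriv
  have cθ : Continuous fun x => (p.theta x : ℂ) := Complex.continuous_ofReal.comp
    (continuous_iff_continuousAt.mpr fun x => (p.hasDerivAt_theta x).continuousAt)
  -- `κ' = θ''`, tied to the zeroth-order coefficient of `S`. The case `b = k²` is separate only for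
  -- continuity, where zeros of the amplitude are harmless because `c = 0`.
  obtain ⟨κ', hκ', cκ'⟩ : ∃ κ' : ℝ → ℝ,
      (∀ x, κ' x = -2 * (p.c * deriv p.R x / p.R x ^ 3)) ∧ Continuous κ' := by
    refine ⟨fun x => -2 * p.c * p.halfDerivAmpSq x / p.ampSq x ^ 2,
      fun x => by rw [R_div_cube]; ring, ?_⟩
    by_cases h : p.b = p.k ^ 2
    · simp only [p.c_eq_zero_of_b_eq h]; simpa using continuous_const
    · exact (continuous_const.mul p.continuous_halfDerivAmpSq).div (p.continuous_ampSq.pow 2)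
        fun x => (pow_pos (p.ampSq_pos h x) 2).ne'
  have cκ'' : Continuous fun x => (κ' x : ℂ) := Complex.continuous_ofReal.comp cκ'
  have dκ : ∀ x, HasDerivAt (fun x => (p.thetaDeriv x : ℂ)) (κ' x : ℂ) x := fun x => by
    refine (p.hasDerivAt_thetaDeriv x).ofReal_comp.congr_deriv ?_
    rw [hκ', R_div_cube]; push_cast; ring
  have de : ∀ x, HasDerivAt (fun x => Complex.exp (-Complex.I * p.theta x))
      (Complex.exp (-Complex.I * p.theta x) * (-Complex.I * p.thetaDeriv x)) x := fun x =>
    (((p.hasDerivAt_theta x).ofReal_comp).const_mul (-Complex.I)).cexp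
  have de' : ∀ x, HasDerivAt (fun x => Complex.exp (Complex.I * p.theta x))
      (Complex.exp (Complex.I * p.theta x) * (Complex.I * p.thetaDeriv x)) x := fun x =>
    (((p.hasDerivAt_theta x).ofReal_comp).const_mul (Complex.I)).cexp
  -- the two rotated squares and their derivatives
  let g₁ : ℝ → ℂ := fun x => 2 * (-Complex.I * ζ * f₁ x ^ 2 + p.phi x * (f₁ x * f₂ x))
  let g₂ : ℝ → ℂ := fun x => 2 * (-conj (p.phi x) * (f₁ x * f₂ x) + Complex.I * ζ * f₂ x ^ 2)
  have cg₁ : Continuous g₁ := by fun_prop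
  have cg₂ : Continuous g₂ := by fun_prop
  let P₁ : ℝ → ℂ := fun x => Complex.exp (-Complex.I * p.theta x) * f₁ x ^ 2
  let P₂ : ℝ → ℂ := fun x => Complex.exp (Complex.I * p.theta x) * f₂ x ^ 2
  let P₁' : ℝ → ℂ := fun x => Complex.exp (-Complex.I * p.theta x) *
    (g₁ x - Complex.I * p.thetaDeriv x * f₁ x ^ 2)
  let P₂' : ℝ → ℂ := fun x => Complex.exp (Complex.I * p.theta x) *
    (g₂ x + Complex.I * p.thetaDeriv x * f₂ x ^ 2)
  have dP₁ : ∀ x, HasDerivAt P₁ (P₁' x) x := fun x =>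
    ((de x).mul (hf.hasDerivAt_fst_sq x)).congr_deriv (by simp only [P₁', g₁]; ring)
  have dP₂ : ∀ x, HasDerivAt P₂ (P₂' x) x := fun x =>
    ((de' x).mul (hf.hasDerivAt_snd_sq x)).congr_deriv (by simp only [P₂', g₂]; ring)
  have hexp : ∀ x, Complex.exp (-Complex.I * p.theta x) * Complex.exp (Complex.I * p.theta x)
      = 1 := fun x => by rw [← Complex.exp_add]; simp
  have hexp' : ∀ x, conj (Complex.exp (Complex.I * p.theta x))
      = Complex.exp (-Complex.I * p.theta x) := fun x => by
    rw [← Complex.exp_conj]; simp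
  -- The rotation turns the coupling coefficient `φ²` into the real coefficient `R²`.
  have hφ : ∀ x, p.phi x ^ 2 * Complex.exp (-Complex.I * p.theta x)
      = p.ampSq x * Complex.exp (Complex.I * p.theta x) := fun x => by
    have := congrArg (fun r : ℝ => (r : ℂ)) (p.R_sq x)
    push_cast at this
    rw [phi]
    linear_combination ((p.R x : ℂ) ^ 2 * Complex.exp (Complex.I * p.theta x)) * hexp x
      + Complex.exp (Complex.I * p.theta x) * this
  have hφ' : ∀ x, conj (p.phi x) ^ 2 * Complex.exp (Complex.I * p.theta x)
      = p.ampSq x * Complex.exp (-Complex.I * p.theta x) := fun x => by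
    have := congrArg (fun r : ℝ => (r : ℂ)) (p.R_sq x)
    push_cast at this
    rw [phi, map_mul, hexp', Complex.conj_ofReal]
    linear_combination ((p.R x : ℂ) ^ 2 * Complex.exp (-Complex.I * p.theta x)) * hexp x
      + Complex.exp (-Complex.I * p.theta x) * this
  let P₁'' : ℝ → ℂ := fun x => (-4 * p.ampSq x - 2 * p.omega - 4 * Complex.I * Ω) * P₁ x
    + 2 * p.ampSq x * P₂ x - 2 * Complex.I * p.thetaDeriv x * P₁' x
    + (p.thetaDeriv x ^ 2 - Complex.I * κ' x) * P₁ x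
  let P₂'' : ℝ → ℂ := fun x => (-4 * p.ampSq x - 2 * p.omega + 4 * Complex.I * Ω) * P₂ x
    + 2 * p.ampSq x * P₁ x + 2 * Complex.I * p.thetaDeriv x * P₂' x
    + (p.thetaDeriv x ^ 2 + Complex.I * κ' x) * P₂ x
  have hI := Complex.I_sq
  have dP₁' : ∀ x, HasDerivAt P₁' (P₁'' x) x := fun x => by
    refine ((de x).mul ((hf.hasDerivAt_fst_sq_deriv x).sub
      (((dκ x).const_mul Complex.I).mul (hf.hasDerivAt_fst_sq x)))).congr_deriv ?_
    simp only [P₁'', P₁, P₂, P₁', g₁, Pi.mul_apply, Pi.sub_apply]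
    linear_combination (2 * f₂ x ^ 2) * hφ x - (p.thetaDeriv x : ℂ) ^ 2 * f₁ x ^ 2
      * Complex.exp (-Complex.I * p.theta x) * hI
  have dP₂' : ∀ x, HasDerivAt P₂' (P₂'' x) x := fun x => by
    refine ((de' x).mul ((hf.hasDerivAt_snd_sq_deriv x).add
      (((dκ x).const_mul Complex.I).mul (hf.hasDerivAt_snd_sq x)))).congr_deriv ?_
    simp only [P₂'', P₁, P₂, P₂', g₂, Pi.mul_apply, Pi.add_apply]
    linear_combination (2 * f₁ x ^ 2) * hφ' x - (p.thetaDeriv x : ℂ) ^ 2 * f₂ x ^ 2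
      * Complex.exp (Complex.I * p.theta x) * hI
  have cP₁ : Continuous P₁ := continuous_iff_continuousAt.mpr fun x => (dP₁ x).continuousAt
  have cP₂ : Continuous P₂ := continuous_iff_continuousAt.mpr fun x => (dP₂ x).continuousAt
  have cP₁' : Continuous P₁' := continuous_iff_continuousAt.mpr fun x => (dP₁' x).continuousAt
  have cP₂' : Continuous P₂' := continuous_iff_continuousAt.mpr fun x => (dP₂' x).continuousAt
  have cP₁'' : Continuous P₁'' := by fun_prop
  have cP₂'' : Continuous P₂'' := by fun_prop
  have eU : p.sqU f₁ f₂ = fun x => P₁ x - P₂ x := rfl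
  have eV : p.sqV f₁ f₂ = fun x => -Complex.I * (P₁ x + P₂ x) := by
    funext x; simp only [sqV, P₁, P₂]; ring
  have dU : ∀ x, HasDerivAt (p.sqU f₁ f₂) (P₁' x - P₂' x) x := fun x => by
    rw [eU]; exact (dP₁ x).sub (dP₂ x)
  have dU' : ∀ x, HasDerivAt (fun x => P₁' x - P₂' x) (P₁'' x - P₂'' x) x :=
    fun x => (dP₁' x).sub (dP₂' x)
  have dV : ∀ x, HasDerivAt (p.sqV f₁ f₂) (-Complex.I * (P₁' x + P₂' x)) x := fun x => by
    rw [eV]; exact ((dP₁ x).add (dP₂ x)).const_mul _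
  have dV' : ∀ x, HasDerivAt (fun x => -Complex.I * (P₁' x + P₂' x))
      (-Complex.I * (P₁'' x + P₂'' x)) x :=
    fun x => ((dP₁' x).add (dP₂' x)).const_mul _
  have hc : ∀ x, p.c ^ 2 / (2 * p.R x ^ 4) = p.thetaDeriv x ^ 2 / 2 := fun x => by
    rw [← thetaDeriv_eq, div_pow, div_div]; ring
  have hκ2 : ∀ x, p.c * deriv p.R x / p.R x ^ 3 = -κ' x / 2 := fun x => by rw [hκ']; ring
  refine ⟨contDiff_two_of_hasDerivAt dU dU' (by fun_prop),
    contDiff_two_of_hasDerivAt dV dV' (by fun_prop), ?_, fun x => ?_, fun x => ?_,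
    fun x => ?_, fun x => ?_⟩
  · obtain ⟨x, hx⟩ := hf.nontrivial
    refine ⟨x, ?_⟩
    by_contra! h
    obtain ⟨h1, h2⟩ := h
    rw [eU] at h1
    rw [eV] at h2
    simp only at h1 h2
    have e1 : P₁ x = 0 := by
      linear_combination (1 / 2) * h1 + (Complex.I / 2) * h2 + (1 / 2) * (P₁ x + P₂ x) * hI
    have e2 : P₂ x = 0 := by linear_combination e1 - h1
    simp only [P₁, P₂, mul_eq_zero, Complex.exp_ne_zero, false_or, sq_eq_zero_iff] at e1 e2
    tauto
  · rw [S, Lminus, deriv_deriv_of_hasDerivAt dV dV', (dU x).deriv, hκ2, hc, thetaDeriv_eq, R_sq,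
      eU, eV]
    simp only [P₁'', P₂'']
    push_cast
    linear_combination (-(1/2) * (κ' x : ℂ) * (P₁ x - P₂ x) - p.thetaDeriv x * (P₁' x - P₂' x)
      - 2 * Ω * (P₁ x - P₂ x)) * hI
  · rw [S, Lplus, deriv_deriv_of_hasDerivAt dU dU', (dV x).deriv, hκ2, hc, thetaDeriv_eq, R_sq,
      eU, eV]
    simp only [P₁'', P₂'']
    push_cast
    ring
  · rw [eU]
    simp only [P₁, P₂]
    rw [h₁, h₂]; ring
  · rw [eV]
    simp only [P₁, P₂]
    rw [h₁, h₂]; ring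

end Rotating

/-- Since `U + i V` is twice the first rotated square, the Floquet property passes from `(U, V)`
back to each square. -/
theorem IsBlochEigenfunction.fst_sq_add_T {p : EllipticParams} {lam : ℂ} {μ : ℝ} {f₁ f₂ : ℝ → ℂ}
    (h : p.IsBlochEigenfunction lam μ (p.sqU f₁ f₂) (p.sqV f₁ f₂)) (x : ℝ) :
    Complex.exp (-Complex.I * p.theta (x + p.T)) * f₁ (x + p.T) ^ 2
      = Complex.exp (Complex.I * μ * p.T) * (Complex.exp (-Complex.I * p.theta x) * f₁ x ^ 2) := by
  have h1 := h.floquet_fst x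
  have h2 := h.floquet_snd x
  rw [sqU, sqU] at h1
  rw [sqV, sqV] at h2
  have hI := Complex.I_sq
  linear_combination (1 / 2) * h1 + (Complex.I / 2) * h2
    + (1 / 2) * (Complex.exp (-Complex.I * p.theta (x + p.T)) * f₁ (x + p.T) ^ 2
      + Complex.exp (Complex.I * p.theta (x + p.T)) * f₂ (x + p.T) ^ 2
      - Complex.exp (Complex.I * μ * p.T) * (Complex.exp (-Complex.I * p.theta x) * f₁ x ^ 2
      + Complex.exp (Complex.I * p.theta x) * f₂ x ^ 2)) * hI

theorem IsBlochEigenfunction.snd_sq_add_T {p : EllipticParams} {lam : ℂ} {μ : ℝ} {f₁ f₂ : ℝ → ℂ}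
    (h : p.IsBlochEigenfunction lam μ (p.sqU f₁ f₂) (p.sqV f₁ f₂)) (x : ℝ) :
    Complex.exp (Complex.I * p.theta (x + p.T)) * f₂ (x + p.T) ^ 2
      = Complex.exp (Complex.I * μ * p.T) * (Complex.exp (Complex.I * p.theta x) * f₂ x ^ 2) := by
  have h1 := h.floquet_fst x
  have h2 := h.fst_sq_add_T x
  rw [sqU, sqU] at h1
  linear_combination h2 - h1

end EllipticParams

end NLSKrein

namespace NLSKrein

namespace EllipticParams

variable (p : EllipticParams)

/-! ### The Lax pair at a real spectral parameter -/

/-- `A = i a` for real `ζ`. -/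
noncomputable def aReal (ζ x : ℝ) : ℝ := -ζ ^ 2 + p.ampSq x / 2 + p.omega / 2

/-- `-Ω(ζ) ^ 2` for real `ζ`. -/
noncomputable def negOmegaSq (ζ : ℝ) : ℝ :=
  ζ ^ 4 - p.omega * ζ ^ 2 - p.c * ζ
    + (1 / 16) * (4 * p.omega * p.b + 3 * p.b ^ 2 + (1 - p.k ^ 2) ^ 2)

theorem negOmegaSq_eq (ζ : ℝ) : p.negOmegaSq ζ
    = (p.omega / 2 - ζ ^ 2) ^ 2 - p.c * ζ + p.firstIntegral / 4 := by
  rw [negOmegaSq, firstIntegral, omega]; ring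

theorem A_ofReal (ζ x : ℝ) : p.A ζ x = Complex.I * p.aReal ζ x := by
  rw [A_eq, aReal]; push_cast; ring

theorem C_ofReal (ζ x : ℝ) : p.C ζ x = -conj (p.B ζ x) := by
  simp only [B, C, map_add, map_mul, Complex.conj_ofReal, map_div₀, Complex.conj_I, map_ofNat]
  ring

theorem OmegaSq_ofReal (ζ : ℝ) : p.OmegaSq ζ = -(p.negOmegaSq ζ : ℂ) := by
  rw [OmegaSq, negOmegaSq]; push_cast; ring

theorem B_mul_conj_phi (ζ x : ℝ) : p.B ζ x * conj (p.phi x)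
    = ((ζ * p.ampSq x - p.c / 2 : ℝ) : ℂ) + Complex.I * ((p.halfDerivAmpSq x / 2 : ℝ) : ℂ) := by
  have h1 := p.phi_mul_conj x
  have h2 := p.deriv_phi_mul_conj x
  rw [B]; push_cast
  linear_combination (ζ : ℂ) * h1 + Complex.I / 2 * h2 + (p.c : ℂ) / 2 * Complex.I_sq

/-- This is `-Ω² = a² + |B|²`, the determinant of the time matrix. The dependence on `x` cancels by
the first integrals of `φ`. -/
theorem B_mul_conj (ζ x : ℝ) : p.B ζ x * conj (p.B ζ x)
    = ((p.negOmegaSq ζ - p.aReal ζ x ^ 2 : ℝ) : ℂ) := by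
  have h1 := p.phi_mul_conj x
  have h2 := p.deriv_phi_mul_conj x
  have h3 := p.norm_deriv_phi_sq x
  have h4 := congrArg conj h2
  simp only [map_mul, map_add, Complex.conj_conj, Complex.conj_I, Complex.conj_ofReal] at h4
  rw [negOmegaSq_eq, aReal]
  simp only [B, map_add, map_mul, Complex.conj_ofReal, map_div₀, Complex.conj_I, map_ofNat]
  push_cast at h3 ⊢
  linear_combination (ζ : ℂ) ^ 2 * h1 + (ζ : ℂ) * Complex.I / 2 * h2 - (ζ : ℂ) * Complex.I / 2 * h4
    + h3 / 4 + (-deriv p.phi x * conj (deriv p.phi x) / 4 + (ζ : ℂ) * p.c) * Complex.I_sq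

theorem norm_B_sq (ζ x : ℝ) : ‖p.B ζ x‖ ^ 2 = p.negOmegaSq ζ - p.aReal ζ x ^ 2 := by
  have h := p.B_mul_conj ζ x
  rw [Complex.mul_conj, Complex.normSq_eq_norm_sq] at h
  exact_mod_cast h

theorem aReal_sq_le (ζ x : ℝ) : p.aReal ζ x ^ 2 ≤ p.negOmegaSq ζ := by
  have := p.norm_B_sq ζ x
  nlinarith [sq_nonneg ‖p.B ζ x‖]

theorem negOmegaSq_nonneg (ζ : ℝ) : 0 ≤ p.negOmegaSq ζ :=
  (sq_nonneg _).trans (p.aReal_sq_le ζ 0)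

theorem B_eq_zero_of_aReal_sq_eq {ζ x : ℝ} (h : p.aReal ζ x ^ 2 = p.negOmegaSq ζ) :
    p.B ζ x = 0 := by
  have := p.norm_B_sq ζ x
  rw [h, sub_self] at this
  exact norm_eq_zero.mp (pow_eq_zero_iff two_ne_zero |>.mp this)

theorem mul_ampSq_of_B_eq_zero {ζ x : ℝ} (h : p.B ζ x = 0) : ζ * p.ampSq x = p.c / 2 := by
  have := congrArg Complex.re (p.B_mul_conj_phi ζ x)
  simp [h] at this
  linarith

/-- The points `0` and `K` are where `|φ|²` takes its extreme values `b` and `b - k²`. -/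
theorem k_eq_zero_of_aReal_eq {ζ : ℝ}
    (h : p.aReal ζ 0 = p.aReal ζ (ellK p.k)) : p.k = 0 := by
  rw [aReal, aReal, ampSq_zero, ampSq_ellK] at h
  have : p.k ^ 2 = 0 := by linarith
  exact pow_eq_zero_iff two_ne_zero |>.mp this

theorem ampSq_of_k_eq_zero (h : p.k = 0) (x : ℝ) : p.ampSq x = p.b := by simp [ampSq, h]

/-- When `k = 0`, the vector `(B, A - Ω)` can only vanish where `Ω = 0`. -/
theorem aReal_eq_zero_of_B_eq_zero {ζ x : ℝ} (hk : p.k = 0) (h : p.B ζ x = 0) :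
    p.aReal ζ x = 0 ∧ p.c = 2 * p.b * ζ ∧ 4 * ζ ^ 2 = 1 - p.b := by
  have h1 := p.mul_ampSq_of_B_eq_zero h
  rw [p.ampSq_of_k_eq_zero hk] at h1
  have h2 := p.c_sq
  have hc : p.c = 2 * p.b * ζ := by linarith
  rw [hk, hc] at h2
  have hb := p.b_pos.ne'
  have h3 : 4 * ζ ^ 2 = 1 - p.b := by
    have : p.b ^ 2 * (4 * ζ ^ 2 - (1 - p.b)) = 0 := by linear_combination h2
    rcases mul_eq_zero.mp this with h | h
    · exact absurd (pow_eq_zero_iff two_ne_zero |>.mp h) hb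
    · linarith
  refine ⟨?_, hc, h3⟩
  rw [aReal, p.ampSq_of_k_eq_zero hk, omega, hk]
  linarith

theorem aReal_eq_zero_of_negOmegaSq_eq_zero {ζ : ℝ} (h : p.negOmegaSq ζ = 0) (x : ℝ) :
    p.aReal ζ x = 0 := by
  have := p.aReal_sq_le ζ x
  rw [h] at this
  exact pow_eq_zero_iff two_ne_zero |>.mp (le_antisymm this (sq_nonneg _))

theorem k_eq_zero_of_negOmegaSq_eq_zero {ζ : ℝ} (h : p.negOmegaSq ζ = 0) : p.k = 0 :=
  p.k_eq_zero_of_aReal_eq 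
    ((p.aReal_eq_zero_of_negOmegaSq_eq_zero h _).trans
      (p.aReal_eq_zero_of_negOmegaSq_eq_zero h _).symm)

/-- This makes the normalization a real constraint: `A = Ω` identically would force `k = 0` and `B =
0`, and then `Ω = 0`. -/
theorem exists_aReal_ne {ζ w : ℝ} (hw : w ≠ 0) (hw2 : w ^ 2 = p.negOmegaSq ζ) :
    ∃ x, p.aReal ζ x ≠ w := by
  by_contra! h
  have hk := p.k_eq_zero_of_aReal_eq ((h 0).trans (h (ellK p.k)).symm)
  have hB := p.B_eq_zero_of_aReal_sq_eq (x := 0) (by rw [h 0, hw2])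
  exact hw ((h 0).symm.trans (p.aReal_eq_zero_of_B_eq_zero hk hB).1)

theorem exists_real_of_sq_eq {ζ : ℝ} {Ω : ℂ} (h : Ω ^ 2 = p.OmegaSq ζ) :
    ∃ w : ℝ, Ω = Complex.I * w ∧ w ^ 2 = p.negOmegaSq ζ := by
  have hs := Real.sq_sqrt (p.negOmegaSq_nonneg ζ)
  have e : Ω ^ 2 = (Complex.I * Real.sqrt (p.negOmegaSq ζ)) ^ 2 := by
    rw [h, OmegaSq_ofReal, mul_pow, Complex.I_sq, ← Complex.ofReal_pow, hs]; ring
  rcases sq_eq_sq_iff_eq_or_eq_neg.mp e with h | h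
  · exact ⟨_, h, hs⟩
  · exact ⟨-Real.sqrt (p.negOmegaSq ζ), by rw [h]; push_cast; ring, by rw [neg_sq, hs]⟩

/-! ### Conservation, normalization and uniqueness of Lax eigenfunctions -/

section Lax

variable {p}

theorem IsLaxEigenfunction.sq_eq {ζ Ω : ℂ} {f₁ f₂ : ℝ → ℂ}
    (hf : p.IsLaxEigenfunction ζ Ω f₁ f₂) (x : ℝ) (hx : f₁ x ≠ 0 ∨ f₂ x ≠ 0) :
    Ω ^ 2 = p.A ζ x ^ 2 + p.B ζ x * p.C ζ x := by
  have h1 := hf.time_fst x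
  have h2 := hf.time_snd x
  rcases hx with hx | hx
  · apply mul_right_cancel₀ hx
    linear_combination -p.A ζ x * h1 - p.B ζ x * h2 - Ω * h1
  · apply mul_right_cancel₀ hx
    linear_combination p.A ζ x * h2 - p.C ζ x * h1 - Ω * h2

theorem IsLaxEigenfunction.sq_eq_OmegaSq {ζ : ℝ} {Ω : ℂ} {f₁ f₂ : ℝ → ℂ}
    (hf : p.IsLaxEigenfunction ζ Ω f₁ f₂) : Ω ^ 2 = p.OmegaSq ζ := by
  obtain ⟨x, hx⟩ := hf.nontrivial
  have h := p.B_mul_conj ζ x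
  rw [hf.sq_eq x hx, A_ofReal, C_ofReal, OmegaSq_ofReal]
  push_cast at h ⊢
  linear_combination -h + (p.aReal ζ x : ℂ) ^ 2 * Complex.I_sq

/-- For real `ζ` the `x`-equation is skew-Hermitian. -/
theorem lax_inner_const {ζ : ℝ} {f₁ f₂ g₁ g₂ : ℝ → ℂ}
    (hf₁ : ∀ x, HasDerivAt f₁ (-Complex.I * ζ * f₁ x + p.phi x * f₂ x) x)
    (hf₂ : ∀ x, HasDerivAt f₂ (-conj (p.phi x) * f₁ x + Complex.I * ζ * f₂ x) x)
    (hg₁ : ∀ x, HasDerivAt g₁ (-Complex.I * ζ * g₁ x + p.phi x * g₂ x) x)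
    (hg₂ : ∀ x, HasDerivAt g₂ (-conj (p.phi x) * g₁ x + Complex.I * ζ * g₂ x) x) (x y : ℝ) :
    f₁ x * conj (g₁ x) + f₂ x * conj (g₂ x) = f₁ y * conj (g₁ y) + f₂ y * conj (g₂ y) := by
  have hd : ∀ x, HasDerivAt (fun x => f₁ x * conj (g₁ x) + f₂ x * conj (g₂ x)) 0 x := fun x => by
    refine (((hf₁ x).mul (hg₁ x).complex_conj).add
      ((hf₂ x).mul (hg₂ x).complex_conj)).congr_deriv ?_
    simp only [map_add, map_mul, map_neg, Complex.conj_ofReal, Complex.conj_I, Complex.conj_conj]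
    ring
  exact is_const_of_deriv_eq_zero (fun x => (hd x).differentiableAt) (fun x => (hd x).deriv) x y

theorem lax_norm_const {ζ : ℝ} {f₁ f₂ : ℝ → ℂ}
    (hf₁ : ∀ x, HasDerivAt f₁ (-Complex.I * ζ * f₁ x + p.phi x * f₂ x) x)
    (hf₂ : ∀ x, HasDerivAt f₂ (-conj (p.phi x) * f₁ x + Complex.I * ζ * f₂ x) x) (x y : ℝ) :
    ‖f₁ x‖ ^ 2 + ‖f₂ x‖ ^ 2 = ‖f₁ y‖ ^ 2 + ‖f₂ y‖ ^ 2 := by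
  have h := lax_inner_const hf₁ hf₂ hf₁ hf₂ x y
  simp only [Complex.mul_conj, Complex.normSq_eq_norm_sq] at h
  exact_mod_cast h

/-- For real `ζ` every solution of the Lax pair is bounded. -/
theorem isLaxEigenfunction_of_real {ζ : ℝ} {Ω : ℂ} {f₁ f₂ : ℝ → ℂ}
    (hf₁ : ∀ x, HasDerivAt f₁ (-Complex.I * ζ * f₁ x + p.phi x * f₂ x) x)
    (hf₂ : ∀ x, HasDerivAt f₂ (-conj (p.phi x) * f₁ x + Complex.I * ζ * f₂ x) x)
    (ht₁ : ∀ x, p.A ζ x * f₁ x + p.B ζ x * f₂ x = Ω * f₁ x)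
    (ht₂ : ∀ x, p.C ζ x * f₁ x - p.A ζ x * f₂ x = Ω * f₂ x)
    (hn : ∃ x, f₁ x ≠ 0 ∨ f₂ x ≠ 0) : p.IsLaxEigenfunction ζ Ω f₁ f₂ := by
  refine ⟨hf₁, hf₂, ht₁, ht₂, hn, Real.sqrt (‖f₁ 0‖ ^ 2 + ‖f₂ 0‖ ^ 2), fun x => ⟨?_, ?_⟩⟩
  all_goals
    rw [lax_norm_const hf₁ hf₂ 0 x]
    apply Real.le_sqrt_of_sq_le
    nlinarith [sq_nonneg ‖f₁ x‖, sq_nonneg ‖f₂ x‖]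

/-- The symmetry `φ ↦ (φ₂*, -φ₁*)`, which changes the sign of `Ω`. -/
theorem IsLaxEigenfunction.conj_swap {ζ w : ℝ} {f₁ f₂ : ℝ → ℂ}
    (hf : p.IsLaxEigenfunction ζ (Complex.I * w) f₁ f₂) :
    p.IsLaxEigenfunction ζ (Complex.I * (-w : ℝ)) (fun x => conj (f₂ x))
      (fun x => -conj (f₁ x)) := by
  refine isLaxEigenfunction_of_real (fun x => ?_) (fun x => ?_) (fun x => ?_) (fun x => ?_) ?_
  · refine (hf.deriv_snd x).complex_conj.congr_deriv ?_
    simp only [map_add, map_mul, map_neg, Complex.conj_ofReal, Complex.conj_I, Complex.conj_conj]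
    ring
  · refine (hf.deriv_fst x).complex_conj.neg.congr_deriv ?_
    simp only [map_add, map_mul, map_neg, Complex.conj_ofReal, Complex.conj_I]
    ring
  · have h := congrArg conj (hf.time_snd x)
    rw [A_ofReal, C_ofReal] at h
    simp only [map_sub, map_mul, map_neg, Complex.conj_ofReal, Complex.conj_I,
      Complex.conj_conj] at h
    rw [A_ofReal]; push_cast
    linear_combination h
  · have h := congrArg conj (hf.time_fst x)
    rw [A_ofReal] at h
    simp only [map_add, map_mul, Complex.conj_ofReal, Complex.conj_I] at h
    rw [A_ofReal, C_ofReal]; push_cast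
    linear_combination -h
  · obtain ⟨x, hx⟩ := hf.nontrivial
    exact ⟨x, by simpa [or_comm] using hx⟩

variable {ζ w : ℝ} {f₁ f₂ : ℝ → ℂ}

theorem IsLaxEigenfunction.sq_eq_negOmegaSq
    (hf : p.IsLaxEigenfunction ζ (Complex.I * w) f₁ f₂) : w ^ 2 = p.negOmegaSq ζ := by
  have h := hf.sq_eq_OmegaSq
  rw [OmegaSq_ofReal, mul_pow, Complex.I_sq] at h
  have : (w : ℂ) ^ 2 = p.negOmegaSq ζ := by linear_combination -h
  exact_mod_cast this

theorem IsLaxEigenfunction.norm_sq_add_pos {Ω : ℂ}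
    (hf : p.IsLaxEigenfunction ζ Ω f₁ f₂) (x : ℝ) : 0 < ‖f₁ x‖ ^ 2 + ‖f₂ x‖ ^ 2 := by
  obtain ⟨y, hy⟩ := hf.nontrivial
  rw [lax_norm_const hf.deriv_fst hf.deriv_snd x y]
  rcases hy with h | h
  · have := norm_pos_iff.mpr h; positivity
  · have := norm_pos_iff.mpr h; positivity

/-- Both sides, multiplied by `i`, equal `B f₂ f₁*`: one by the first time equation, the other by
the conjugate of the second. -/
theorem IsLaxEigenfunction.norm_sq_ratio
    (hf : p.IsLaxEigenfunction ζ (Complex.I * w) f₁ f₂) (x : ℝ) :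
    (w - p.aReal ζ x) * ‖f₁ x‖ ^ 2 = (w + p.aReal ζ x) * ‖f₂ x‖ ^ 2 := by
  have h1 := hf.time_fst x
  have h2 := congrArg conj (hf.time_snd x)
  rw [A_ofReal] at h1
  rw [A_ofReal, C_ofReal] at h2
  simp only [map_sub, map_mul, map_neg, Complex.conj_ofReal, Complex.conj_I,
    Complex.conj_conj] at h2
  have e1 : f₁ x * conj (f₁ x) = ((‖f₁ x‖ ^ 2 : ℝ) : ℂ) := by
    rw [Complex.mul_conj, Complex.normSq_eq_norm_sq]
  have e2 : f₂ x * conj (f₂ x) = ((‖f₂ x‖ ^ 2 : ℝ) : ℂ) := by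
    rw [Complex.mul_conj, Complex.normSq_eq_norm_sq]
  have : (((w - p.aReal ζ x) * ‖f₁ x‖ ^ 2 : ℝ) : ℂ)
      = (((w + p.aReal ζ x) * ‖f₂ x‖ ^ 2 : ℝ) : ℂ) := by
    rw [Complex.ofReal_mul, Complex.ofReal_mul, ← e1, ← e2]
    push_cast
    linear_combination Complex.I * (conj (f₁ x) * h1 + f₂ x * h2)
      + (w - p.aReal ζ x) * f₁ x * conj (f₁ x) * Complex.I_sq
      - (w + p.aReal ζ x) * f₂ x * conj (f₂ x) * Complex.I_sq
  exact_mod_cast this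

theorem norm_A_sub (ζ w x : ℝ) : ‖p.A ζ x - Complex.I * w‖ = |w - p.aReal ζ x| := by
  rw [A_ofReal, ← mul_sub, norm_mul, Complex.norm_I, one_mul, ← Complex.ofReal_sub,
    Complex.norm_real, Real.norm_eq_abs, abs_sub_comm]

/-- When `|a| ≤ |w|`, the difference `w - a` is zero or has the sign of `w`. -/
theorem mul_abs_sub_of_sq_le {w a : ℝ} (h : a ^ 2 ≤ w ^ 2) : w * |w - a| = |w| * (w - a) := by
  have h1 := sq_le_sq.mp h
  rcases le_total 0 w with hw | hw
  · rw [abs_of_nonneg hw] at h1 ⊢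
    rw [abs_of_nonneg (by linarith [le_abs_self a])]
  · rw [abs_of_nonpos hw] at h1 ⊢
    rw [abs_of_nonpos (by linarith [neg_abs_le a])]
    ring

/-- By conservation one point with `A ≠ Ω` suffices. There the normalization gives `|f₂|² = |w -
a|`, and the ratio of the moduli gives `|f₁|² = |w + a|`; as `|a| ≤ |w|`, these add up to `2|w|`. -/
theorem IsLaxEigenfunction.norm_sq_add_of_isNormalized (hw : w ≠ 0)
    (hf : p.IsLaxEigenfunction ζ (Complex.I * w) f₁ f₂)
    (hn : p.IsNormalized ζ (Complex.I * w) f₁ f₂) (x : ℝ) :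
    ‖f₁ x‖ ^ 2 + ‖f₂ x‖ ^ 2 = 2 * |w| := by
  have hw2 := hf.sq_eq_negOmegaSq
  obtain ⟨y, hy⟩ := p.exists_aReal_ne hw hw2
  rw [lax_norm_const hf.deriv_fst hf.deriv_snd x y]
  have hy' : 0 < |w - p.aReal ζ y| := abs_pos.mpr (sub_ne_zero.mpr hy.symm)
  obtain ⟨γ, -, h2, h3⟩ := hn y (by
    rw [← sub_ne_zero, ← norm_pos_iff, norm_A_sub]; exact hy')
  have h4 : ‖f₂ y‖ ^ 2 = |w - p.aReal ζ y| := by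
    rw [h2, norm_mul, mul_pow, h3, norm_A_sub]
    field_simp
  have h5 := hf.norm_sq_ratio y
  have h6 := mul_abs_sub_of_sq_le (hw2 ▸ p.aReal_sq_le ζ y)
  apply mul_left_cancel₀ (sub_ne_zero.mpr hy.symm)
  rw [h4] at h5 ⊢
  linear_combination h5 + 2 * h6

/-- The converse of the previous lemma, which reduces normalizing an eigenfunction to scaling a
conserved quantity. The factor `γ` is read off from the second component. -/
theorem IsLaxEigenfunction.isNormalized
    (hf : p.IsLaxEigenfunction ζ (Complex.I * w) f₁ f₂)
    (hN : ∀ x, ‖f₁ x‖ ^ 2 + ‖f₂ x‖ ^ 2 = 2 * |w|) : p.IsNormalized ζ (Complex.I * w) f₁ f₂ := by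
  intro x hx
  have hw2 := hf.sq_eq_negOmegaSq
  have hx' := sub_ne_zero.mpr hx
  have h0 := norm_pos_iff.mpr hx'
  refine ⟨f₂ x / (p.A ζ x - Complex.I * w), ?_, by field_simp, ?_⟩
  · field_simp
    linear_combination hf.time_fst x
  · have h5 := hf.norm_sq_ratio x
    have h6 := mul_abs_sub_of_sq_le (hw2 ▸ p.aReal_sq_le ζ x)
    have h7 := hN x
    rw [norm_A_sub] at h0
    have hw : w ≠ 0 := by
      rintro rfl
      have h8 := hf.norm_sq_add_pos x
      rw [h7] at h8; simp at h8
    have h4 : ‖f₂ x‖ ^ 2 = |w - p.aReal ζ x| := by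
      apply mul_left_cancel₀ hw
      linear_combination -h5 / 2 + (w - p.aReal ζ x) / 2 * h7 - h6
    rw [norm_div, div_pow, h4, norm_A_sub]
    field_simp

/-- Simplicity of the eigenvalue. -/
theorem IsLaxEigenfunction.eq_const_mul {Ω : ℂ} {g₁ g₂ : ℝ → ℂ} (hΩ : Ω ≠ 0)
    (hf : p.IsLaxEigenfunction ζ Ω f₁ f₂) (hg : p.IsLaxEigenfunction ζ Ω g₁ g₂) :
    ∃ a : ℂ, ∀ x, g₁ x = a * f₁ x ∧ g₂ x = a * f₂ x := by
  have hN0 : ((‖f₁ 0‖ ^ 2 + ‖f₂ 0‖ ^ 2 : ℝ) : ℂ) ≠ 0 := by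
    exact_mod_cast (hf.norm_sq_add_pos 0).ne'
  -- The factor is the projection coefficient of `g` on `f`. It does not depend on `x` because
  -- Hermitian products of solutions are conserved.
  refine ⟨(g₁ 0 * conj (f₁ 0) + g₂ 0 * conj (f₂ 0)) / ((‖f₁ 0‖ ^ 2 + ‖f₂ 0‖ ^ 2 : ℝ) : ℂ),
    fun x => ?_⟩
  have hin := lax_inner_const hg.deriv_fst hg.deriv_snd hf.deriv_fst hf.deriv_snd x 0
  have hN := lax_norm_const hf.deriv_fst hf.deriv_snd x 0
  have hff : f₁ x * conj (f₁ x) + f₂ x * conj (f₂ x) = ((‖f₁ 0‖ ^ 2 + ‖f₂ 0‖ ^ 2 : ℝ) : ℂ) := by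
    rw [← hN, Complex.mul_conj, Complex.mul_conj, Complex.normSq_eq_norm_sq,
      Complex.normSq_eq_norm_sq]
    push_cast; rfl
  -- At each `x` both vectors are eigenvectors of the same trace-free matrix for `Ω ≠ 0`, hence
  -- parallel.
  have hW : f₁ x * g₂ x - f₂ x * g₁ x = 0 := by
    have a1 := hf.time_fst x
    have a2 := hf.time_snd x
    have b1 := hg.time_fst x
    have b2 := hg.time_snd x
    have : 2 * Ω * (f₁ x * g₂ x - f₂ x * g₁ x) = 0 := by
      linear_combination -g₂ x * a1 + f₂ x * b1 + g₁ x * a2 - f₁ x * b2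
    simpa [hΩ] using this
  rw [← hin]
  constructor
  · field_simp
    rw [← hff]
    linear_combination -conj (f₂ x) * hW
  · field_simp
    rw [← hff]
    linear_combination conj (f₁ x) * hW

/-- The Floquet multiplier of the squared eigenfunctions has modulus one. -/
theorem IsLaxEigenfunction.exists_isBlochEigenfunction {Ω : ℂ} (hΩ : Ω ≠ 0)
    (hf : p.IsLaxEigenfunction ζ Ω f₁ f₂) :
    ∃ μ : ℝ, p.IsBlochEigenfunction (2 * Ω) μ (p.sqU f₁ f₂) (p.sqV f₁ f₂) := by
  obtain ⟨s, hs, hφ⟩ := p.phi_add_T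
  set e := Complex.exp (Complex.I * p.theta p.T) with he
  have he1 : ‖e‖ = 1 := by rw [he, mul_comm]; exact Complex.norm_exp_ofReal_mul_I _
  have hs' : conj s = s := by
    have : (s - 1) * (s + 1) = 0 := by linear_combination hs
    rcases mul_eq_zero.mp this with h | h
    · rw [sub_eq_zero.mp h]; simp
    · rw [eq_neg_of_add_eq_zero_left h]; simp
  have hs1 : ‖s‖ = 1 := by
    have h := congrArg norm hs
    rw [norm_pow, norm_one] at h
    exact (pow_eq_one_iff_of_nonneg (norm_nonneg _) two_ne_zero).mp h
  -- With `φ(x + T) = η² φ(x)` and `|η| = 1`, the constant gauge `diag(η*, η)` makes the translated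
  -- eigenfunction a solution of the original Lax pair. By simplicity it is `m f`, and conservation
  -- gives `|m| = 1`; the squares then have multiplier `s m²`.
  obtain ⟨η, hη⟩ := IsAlgClosed.exists_pow_nat_eq (s * e) (n := 2) (by norm_num)
  have hη1 : ‖η‖ = 1 := by
    have h := congrArg norm hη
    rw [norm_pow, norm_mul, hs1, he1, one_mul] at h
    exact (pow_eq_one_iff_of_nonneg (norm_nonneg _) two_ne_zero).mp h
  have hηc : η * conj η = 1 := by
    rw [Complex.mul_conj, Complex.normSq_eq_norm_sq, hη1]; simp
  have hec : e * conj e = 1 := by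
    rw [Complex.mul_conj, Complex.normSq_eq_norm_sq, he1]; simp
  rw [← hη] at hφ
  have hφ' := p.deriv_phi_add_T hφ
  have hA : ∀ x, p.A ζ (x + p.T) = p.A ζ x := fun x => by rw [A_eq, A_eq, ampSq_add_T]
  have hB : ∀ x, p.B ζ (x + p.T) = η ^ 2 * p.B ζ x := fun x => by
    rw [B, B, hφ, hφ']; ring
  have hg : p.IsLaxEigenfunction ζ Ω (fun x => conj η * f₁ (x + p.T))
      (fun x => η * f₂ (x + p.T)) := by
    refine isLaxEigenfunction_of_real (fun x => ?_) (fun x => ?_) (fun x => ?_) (fun x => ?_) ?_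
    · refine (((hf.deriv_fst (x + p.T)).comp_add_const x p.T).const_mul (conj η)).congr_deriv ?_
      rw [hφ]
      linear_combination (η * p.phi x * f₂ (x + p.T)) * hηc
    · refine (((hf.deriv_snd (x + p.T)).comp_add_const x p.T).const_mul η).congr_deriv ?_
      rw [hφ, map_mul, map_pow]
      linear_combination (-conj η * conj (p.phi x) * f₁ (x + p.T)) * hηc
    · have h := hf.time_fst (x + p.T)
      rw [hA, hB] at h
      linear_combination conj η * h - (η * p.B ζ x * f₂ (x + p.T)) * hηc
    · have h := hf.time_snd (x + p.T)
      rw [C_ofReal, hA, hB, map_mul, map_pow] at h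
      rw [C_ofReal]
      linear_combination η * h + (conj η * conj (p.B ζ x) * f₁ (x + p.T)) * hηc
    · refine ⟨0, ?_⟩
      by_contra! h
      have hη0 : η ≠ 0 := by rintro rfl; simp at hη1
      have h2 := hf.norm_sq_add_pos (0 + p.T)
      simp only [mul_eq_zero, hη0, map_eq_zero, false_or] at h
      rw [h.1, h.2] at h2
      simp at h2
  obtain ⟨m, hm⟩ := hf.eq_const_mul hΩ hg
  have hm1 : ‖m‖ = 1 := by
    have h0 := hf.norm_sq_add_pos 0
    have h1 := lax_norm_const hf.deriv_fst hf.deriv_snd (0 + p.T) 0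
    have h2 := congrArg norm (hm 0).1
    have h3 := congrArg norm (hm 0).2
    simp only [norm_mul, RCLike.norm_conj, hη1, one_mul] at h2 h3
    rw [h2, h3, mul_pow, mul_pow, ← mul_add] at h1
    have h4 := mul_eq_right₀ h0.ne' |>.mp h1
    exact (pow_eq_one_iff_of_nonneg (norm_nonneg _) two_ne_zero).mp h4
  have hM : ∃ μ : ℝ, Complex.exp (Complex.I * μ * p.T) = s * m ^ 2 := by
    refine ⟨Complex.arg (s * m ^ 2) / p.T, ?_⟩
    have hn : ‖s * m ^ 2‖ = 1 := by rw [norm_mul, norm_pow, hs1, hm1]; norm_num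
    have hT : (p.T : ℂ) ≠ 0 := by exact_mod_cast p.T_pos.ne'
    have h := Complex.norm_mul_exp_arg_mul_I (s * m ^ 2)
    rw [hn, Complex.ofReal_one, one_mul] at h
    rw [← h, h]
    conv_rhs => rw [← h]
    congr 1
    push_cast
    field_simp
  obtain ⟨μ, hμ⟩ := hM
  refine ⟨μ, hf.isBlochEigenfunction (fun x => ?_) (fun x => ?_)⟩
  · have h1 : f₁ (x + p.T) = m * η * f₁ x := by
      linear_combination η * (hm x).1 - f₁ (x + p.T) * hηc
    have h2 : Complex.exp (-Complex.I * p.theta (x + p.T))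
        = conj e * Complex.exp (-Complex.I * p.theta x) := by
      rw [he, ← Complex.exp_conj, ← Complex.exp_add, theta_add_T]
      congr 1
      simp; ring
    rw [h1, h2, hμ]
    linear_combination (m ^ 2 * conj e * Complex.exp (-Complex.I * p.theta x) * f₁ x ^ 2) * hη
      + (m ^ 2 * s * Complex.exp (-Complex.I * p.theta x) * f₁ x ^ 2) * hec
  · have h1 : f₂ (x + p.T) = m * conj η * f₂ x := by
      linear_combination conj η * (hm x).2 - f₂ (x + p.T) * hηc
    have h2 : Complex.exp (Complex.I * p.theta (x + p.T))
        = e * Complex.exp (Complex.I * p.theta x) := by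
      rw [he, ← Complex.exp_add, theta_add_T]
      congr 1
      push_cast; ring
    have hη' := congrArg conj hη
    rw [map_pow, map_mul, hs'] at hη'
    rw [h1, h2, hμ]
    linear_combination (m ^ 2 * e * Complex.exp (Complex.I * p.theta x) * f₂ x ^ 2) * hη'
      + (m ^ 2 * s * Complex.exp (Complex.I * p.theta x) * f₂ x ^ 2) * hec

/-! ### The Krein signature -/

/-- The origin of `ζ_c²`: it is the mean of `a` over a period at `ζ = 0`. -/
theorem integral_aReal (p : EllipticParams) (ζ : ℝ) (P : ℕ) :
    ∫ x in (-(P * p.T / 2))..(P * p.T / 2), p.aReal ζ x = P * p.T * (p.zetaCSq - ζ ^ 2) := by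
  have hT : P * p.T / 2 = P * ellK p.k := by rw [T]; ring
  have hd := continuous_jacobiDn p.k_nonneg p.k_lt_one
  have hd2 : Continuous fun x => jacobiDn p.k x ^ 2 := hd.pow 2
  -- Here `|φ|² = b - 1 + dn²`, which leaves a constant and the integral defining `E`.
  have he : ∀ x, p.aReal ζ x
      = (-ζ ^ 2 + p.omega / 2 + (p.b - 1) / 2) + 1 / 2 * jacobiDn p.k x ^ 2 := fun x => by
    rw [jacobiDn_sq p.k_nonneg p.k_lt_one, aReal, ampSq]; ring
  have hi : ∀ a b, IntervalIntegrable (fun x => jacobiDn p.k x ^ 2) MeasureTheory.volume a b :=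
    fun a b => hd2.intervalIntegrable a b
  have hneg := intervalIntegral.integral_comp_neg (a := -(P * ellK p.k)) (b := 0)
    (fun x => jacobiDn p.k x ^ 2)
  have hev : ∀ x, jacobiDn p.k (-x) = jacobiDn p.k x := fun x => by
    simp [jacobiDn, jacobiSn, jacobiAm_neg p.k_nonneg p.k_lt_one]
  simp only [hev, neg_zero, neg_neg] at hneg
  have hK := (ellK_pos p.k_nonneg p.k_lt_one).ne'
  rw [hT]
  simp only [he]
  rw [intervalIntegral.integral_add (by simp) ((hi _ _).const_mul _),
    intervalIntegral.integral_const_mul,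
    ← intervalIntegral.integral_add_adjacent_intervals (hi _ 0) (hi 0 _), hneg,
    integral_jacobiDn_sq p.k_nonneg p.k_lt_one, zetaCSq, T, omega]
  simp
  field_simp
  ring

/-- The normalization makes `|f₁|² + |f₂|² = 2|w|`, and the ratio of the moduli makes `w(|f₁|² -
|f₂|²) = 2a|w|`. The product of sum and difference is `4aw`, so the energy density is `-16 w² a`. -/
theorem IsLaxEigenfunction.K₂_eq (hw : w ≠ 0)
    (hf : p.IsLaxEigenfunction ζ (Complex.I * w) f₁ f₂)
    (hn : p.IsNormalized ζ (Complex.I * w) f₁ f₂) (P : ℕ) :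
    K₂ p P f₁ f₂ = ((16 * w ^ 2 * P * p.T * (ζ ^ 2 - p.zetaCSq) : ℝ) : ℂ) := by
  have hd : ∀ x, conj (sqW₁ f₁ f₂ x) * p.hessFst (sqW₁ f₁ f₂) (sqW₂ f₁ f₂) x
      + conj (sqW₂ f₁ f₂ x) * p.hessSnd (sqW₁ f₁ f₂) (sqW₂ f₁ f₂) x
      = ((-16 * w ^ 2 * p.aReal ζ x : ℝ) : ℂ) := fun x => by
    have h1 := hf.norm_sq_add_of_isNormalized hw hn x
    have h2 := hf.norm_sq_ratio x
    have h3 : w * (‖f₁ x‖ ^ 2 - ‖f₂ x‖ ^ 2) = 2 * p.aReal ζ x * |w| := by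
      linear_combination h2 + p.aReal ζ x * h1
    have h4 : (‖f₁ x‖ ^ 2) ^ 2 - (‖f₂ x‖ ^ 2) ^ 2 = 4 * p.aReal ζ x * w := by
      apply mul_left_cancel₀ hw
      linear_combination (w * (‖f₁ x‖ ^ 2 - ‖f₂ x‖ ^ 2)) * h1 + 2 * |w| * h3
        + 4 * p.aReal ζ x * sq_abs w
    rw [hf.energy_density, Complex.mul_conj, Complex.mul_conj, Complex.normSq_eq_norm_sq,
      Complex.normSq_eq_norm_sq, ← Complex.ofReal_pow, ← Complex.ofReal_pow,
      ← Complex.ofReal_sub, h4]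
    push_cast
    linear_combination (16 * (p.aReal ζ x : ℂ) * w ^ 2) * Complex.I_sq
  rw [K₂, energy]
  simp only [hd]
  rw [intervalIntegral.integral_ofReal, intervalIntegral.integral_const_mul, integral_aReal]
  congr 1; ring

theorem IsLaxEigenfunction.kreinSignature_eq (hw : w ≠ 0)
    (hf : p.IsLaxEigenfunction ζ (Complex.I * w) f₁ f₂)
    (hn : p.IsNormalized ζ (Complex.I * w) f₁ f₂) {P : ℕ} (hP : 1 ≤ P) :
    kreinSignature p P f₁ f₂ = SignType.sign (ζ ^ 2 - p.zetaCSq) := by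
  have hT := p.T_pos
  have hP' : (0 : ℝ) < P := by exact_mod_cast hP
  rw [kreinSignature, hf.K₂_eq hw hn, Complex.ofReal_re, sign_mul, sign_pos (by positivity),
    one_mul]

end Lax

end EllipticParams

end NLSKrein

namespace NLSKrein

namespace EllipticParams

/-! ### Existence of Lax eigenfunctions for real `ζ` -/

variable {p : EllipticParams}

theorem IsLaxEigenfunction.const_mul {ζ : ℝ} {Ω : ℂ} {f₁ f₂ : ℝ → ℂ}
    (hf : p.IsLaxEigenfunction ζ Ω f₁ f₂) {r : ℂ} (hr : r ≠ 0) :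
    p.IsLaxEigenfunction ζ Ω (fun x => r * f₁ x) (fun x => r * f₂ x) := by
  refine isLaxEigenfunction_of_real (fun x => ?_) (fun x => ?_) (fun x => ?_) (fun x => ?_) ?_
  · refine ((hf.deriv_fst x).const_mul r).congr_deriv ?_
    ring
  · refine ((hf.deriv_snd x).const_mul r).congr_deriv ?_
    ring
  · linear_combination r * hf.time_fst x
  · linear_combination r * hf.time_snd x
  · obtain ⟨x, hx⟩ := hf.nontrivial
    exact ⟨x, by simpa [hr] using hx⟩

theorem IsLaxEigenfunction.exists_isNormalized {ζ w : ℝ} {f₁ f₂ : ℝ → ℂ} (hw : w ≠ 0)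
    (hf : p.IsLaxEigenfunction ζ (Complex.I * w) f₁ f₂) :
    ∃ g₁ g₂ : ℝ → ℂ, p.IsLaxEigenfunction ζ (Complex.I * w) g₁ g₂ ∧
      p.IsNormalized ζ (Complex.I * w) g₁ g₂ := by
  have hN := hf.norm_sq_add_pos 0
  have hw' := abs_pos.mpr hw
  have hr : 0 < 2 * |w| / (‖f₁ 0‖ ^ 2 + ‖f₂ 0‖ ^ 2) := by positivity
  have hg := hf.const_mul (r := (Real.sqrt (2 * |w| / (‖f₁ 0‖ ^ 2 + ‖f₂ 0‖ ^ 2)) : ℂ))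
    (by exact_mod_cast (Real.sqrt_pos.mpr hr).ne')
  refine ⟨_, _, hg, hg.isNormalized fun x => ?_⟩
  rw [lax_norm_const hg.deriv_fst hg.deriv_snd x 0]
  simp only [norm_mul, Complex.norm_real, Real.norm_eq_abs, mul_pow, sq_abs, Real.sq_sqrt hr.le]
  field_simp

theorem hasDerivAt_B (p : EllipticParams) (ζ x : ℝ) : HasDerivAt (p.B ζ)
    (-2 * Complex.I * ζ * p.B ζ x - 2 * Complex.I * p.aReal ζ x * p.phi x) x := by
  refine (((p.hasDerivAt_phi x).const_mul (ζ : ℂ)).add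
    ((p.hasDerivAt_deriv_phi x).const_mul (Complex.I / 2))).congr_deriv ?_
  rw [B, aReal]
  push_cast
  linear_combination (ζ : ℂ) * deriv p.phi x * Complex.I_sq

theorem hasDerivAt_aReal (p : EllipticParams) (ζ x : ℝ) :
    HasDerivAt (p.aReal ζ) (p.halfDerivAmpSq x) x := by
  refine ((((p.hasDerivAt_ampSq x).div_const 2).const_add (-ζ ^ 2)).add_const
    (p.omega / 2)).congr_deriv ?_
  ring

/-- The quotient `φ₂ / φ₁` of the components of a Lax eigenfunction. -/
noncomputable def laxQuotient (p : EllipticParams) (ζ w x : ℝ) : ℂ :=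
  Complex.I * conj (p.B ζ x) / ((p.aReal ζ x + w : ℝ) : ℂ)

/-- The Riccati equation of the `x`-part of the Lax pair, which follows from `|B|² = w² - a²` and
from `a'` being minus twice the imaginary part of `φ B*`. -/
theorem hasDerivAt_laxQuotient {ζ w : ℝ} (hw : w ^ 2 = p.negOmegaSq ζ)
    (h : ∀ x, p.aReal ζ x + w ≠ 0) (x : ℝ) : HasDerivAt (p.laxQuotient ζ w)
    (-conj (p.phi x) + 2 * Complex.I * ζ * p.laxQuotient ζ w x
      - p.phi x * p.laxQuotient ζ w x ^ 2) x := by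
  have hx : ((p.aReal ζ x + w : ℝ) : ℂ) ≠ 0 := by exact_mod_cast h x
  refine ((((p.hasDerivAt_B ζ x).complex_conj.const_mul Complex.I).div
    ((p.hasDerivAt_aReal ζ x).add_const w).ofReal_comp hx)).congr_deriv ?_
  have h1 := p.B_mul_conj ζ x
  have h2 := p.B_mul_conj_phi ζ x
  have h3 := congrArg conj h2
  simp only [map_mul, map_add, Complex.conj_conj, Complex.conj_I, Complex.conj_ofReal] at h3
  rw [← hw] at h1
  rw [laxQuotient]
  simp only [map_sub, map_mul, map_neg, Complex.conj_ofReal, Complex.conj_I, map_ofNat]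
  field_simp
  push_cast at h1 h2 h3 ⊢
  have hI := Complex.I_sq
  linear_combination -conj (p.B ζ x) * h3 + conj (p.B ζ x) * h2 - conj (p.phi x) * h1
    + (conj (p.B ζ x) ^ 2 * p.phi x + 2 * p.aReal ζ x * conj (p.phi x) * w
      + 2 * p.aReal ζ x ^ 2 * conj (p.phi x)) * hI

theorem continuous_aReal (p : EllipticParams) (ζ : ℝ) : Continuous (p.aReal ζ) :=
  continuous_iff_continuousAt.mpr fun x => (p.hasDerivAt_aReal ζ x).continuousAt

/-- With the quotient `v = f₂/f₁` known, the first equation becomes `f₁' = (-iζ + φ v) f₁` and is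
solved by a quadrature. -/
theorem exists_isLaxEigenfunction_of_add_ne {ζ w : ℝ} (hw : w ^ 2 = p.negOmegaSq ζ)
    (h : ∀ x, p.aReal ζ x + w ≠ 0) :
    ∃ f₁ f₂ : ℝ → ℂ, p.IsLaxEigenfunction ζ (Complex.I * w) f₁ f₂ := by
  have dv := hasDerivAt_laxQuotient hw h
  have cv : Continuous (p.laxQuotient ζ w) :=
    continuous_iff_continuousAt.mpr fun x => (dv x).continuousAt
  have cφ := p.continuous_phi
  have cE : Continuous fun x => -Complex.I * ζ + p.phi x * p.laxQuotient ζ w x := by fun_prop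
  have d1 : ∀ x, HasDerivAt (fun x => Complex.exp
      (∫ y in (0 : ℝ)..x, (-Complex.I * ζ + p.phi y * p.laxQuotient ζ w y)))
      (Complex.exp (∫ y in (0 : ℝ)..x, (-Complex.I * ζ + p.phi y * p.laxQuotient ζ w y))
        * (-Complex.I * ζ + p.phi x * p.laxQuotient ζ w x)) x :=
    fun x => (cE.integral_hasStrictDerivAt 0 x).hasDerivAt.cexp
  have hx : ∀ x, (p.aReal ζ x + w : ℂ) ≠ 0 := fun x => by exact_mod_cast h x
  have hI := Complex.I_sq
  refine ⟨_, fun x => Complex.exp (∫ y in (0 : ℝ)..x,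
      (-Complex.I * ζ + p.phi y * p.laxQuotient ζ w y)) * p.laxQuotient ζ w x,
    isLaxEigenfunction_of_real (fun x => (d1 x).congr_deriv ?_)
      (fun x => ((d1 x).mul (dv x)).congr_deriv ?_) (fun x => ?_) (fun x => ?_)
      ⟨0, Or.inl (Complex.exp_ne_zero _)⟩⟩
  · ring
  · ring
  · have h1 := p.B_mul_conj ζ x
    rw [← hw] at h1
    have h2 := hx x
    rw [A_ofReal, laxQuotient]
    push_cast at h1 ⊢
    field_simp
    linear_combination h1
  · have h2 := hx x
    rw [A_ofReal, C_ofReal, laxQuotient]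
    push_cast
    field_simp
    linear_combination (-conj (p.B ζ x) * (w + p.aReal ζ x)) * hI

/-- The solution of dnoidal type at `ζ = 0`. -/
theorem isLaxEigenfunction_dnoidal (hb : p.b = 1) :
    p.IsLaxEigenfunction (0 : ℝ) (Complex.I * (p.k ^ 2 / 4 : ℝ))
      (fun x => (jacobiCn p.k x : ℂ)) (fun x => -(jacobiSn p.k x : ℂ)) := by
  have hc : p.c = 0 := by
    have := p.c_sq
    rw [hb] at this
    exact pow_eq_zero_iff two_ne_zero |>.mp (by linarith)
  have hne : p.b ≠ p.k ^ 2 := by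
    have := p.k_nonneg
    have := p.k_lt_one
    rw [hb]; nlinarith
  have hφ : p.phi = fun x => (jacobiDn p.k x : ℂ) := by
    funext x
    rw [phi, p.theta_of_c_eq_zero hc, R, if_neg hne, hb, jacobiDn]
    simp
  have hφ' : ∀ x, deriv p.phi x = ((-p.k ^ 2 * jacobiSn p.k x * jacobiCn p.k x : ℝ) : ℂ) :=
    fun x => by
      rw [hφ]; exact (hasDerivAt_jacobiDn p.k_nonneg p.k_lt_one x).ofReal_comp.deriv
  have h2 : ∀ x, (jacobiSn p.k x : ℂ) ^ 2 + (jacobiCn p.k x : ℂ) ^ 2 = 1 := fun x => by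
    exact_mod_cast jacobiSn_sq_add_jacobiCn_sq (k := p.k) x
  have hB : ∀ x, p.B (0 : ℝ) x
      = Complex.I / 2 * ((-p.k ^ 2 * jacobiSn p.k x * jacobiCn p.k x : ℝ) : ℂ) := fun x => by
    rw [B, hφ']; simp
  refine isLaxEigenfunction_of_real (fun x => ?_) (fun x => ?_) (fun x => ?_) (fun x => ?_) ?_
  · refine (hasDerivAt_jacobiCn p.k_nonneg p.k_lt_one x).ofReal_comp.congr_deriv ?_
    rw [hφ]; push_cast; ring
  · refine (hasDerivAt_jacobiSn p.k_nonneg p.k_lt_one x).ofReal_comp.neg.congr_deriv ?_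
    rw [hφ, Complex.conj_ofReal]; push_cast; ring
  · rw [A_ofReal, hB, aReal, omega, ampSq, hb]
    push_cast
    ring
  · rw [C_ofReal, A_ofReal, hB, aReal, omega, ampSq, hb]
    simp only [map_mul, map_div₀, Complex.conj_I, Complex.conj_ofReal, map_ofNat]
    push_cast
    linear_combination (-Complex.I * p.k ^ 2 * jacobiSn p.k x / 2) * h2 x
  · refine ⟨0, Or.inl ?_⟩
    simp [jacobiCn_zero p.k_nonneg p.k_lt_one]

/-- The quotient construction fails for both signs of `w` only if `a` takes both values `w` and
`-w`. Then `B` vanishes at two points with different `|φ|²`; as `ζ|φ|² = c/2` at both, `ζ = c = 0`.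
This leaves `b = k²`, which is excluded, or the dnoidal wave `b = 1`. -/
theorem exists_isLaxEigenfunction {ζ w : ℝ} (hw0 : w ≠ 0) (hw : w ^ 2 = p.negOmegaSq ζ) :
    ∃ f₁ f₂ : ℝ → ℂ, p.IsLaxEigenfunction ζ (Complex.I * w) f₁ f₂ := by
  by_cases h1 : ∀ x, p.aReal ζ x + w ≠ 0
  · exact exists_isLaxEigenfunction_of_add_ne hw h1
  by_cases h2 : ∀ x, p.aReal ζ x + -w ≠ 0
  · obtain ⟨f₁, f₂, hf⟩ := exists_isLaxEigenfunction_of_add_ne (by rw [neg_sq, hw]) h2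
    have := hf.conj_swap
    rw [neg_neg] at this
    exact ⟨_, _, this⟩
  push Not at h1 h2
  obtain ⟨x, hx⟩ := h1
  obtain ⟨y, hy⟩ := h2
  have hBx : p.B ζ x = 0 := p.B_eq_zero_of_aReal_sq_eq (by
    rw [← hw, eq_neg_of_add_eq_zero_left hx, neg_sq])
  have hBy : p.B ζ y = 0 := p.B_eq_zero_of_aReal_sq_eq (by
    rw [← hw, eq_neg_of_add_eq_zero_left hy, neg_neg])
  have hqx := p.mul_ampSq_of_B_eq_zero hBx
  have hqy := p.mul_ampSq_of_B_eq_zero hBy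
  have hq : p.ampSq x ≠ p.ampSq y := by
    intro h
    rw [aReal, h] at hx
    rw [aReal] at hy
    exact hw0 (by linarith)
  have hζ : ζ = 0 := by
    have : ζ * (p.ampSq x - p.ampSq y) = 0 := by linear_combination hqx - hqy
    exact (mul_eq_zero.mp this).resolve_right (sub_ne_zero.mpr hq)
  have hc : p.c = 0 := by rw [hζ] at hqx; linarith
  have hb : p.b = 1 := by
    by_contra hb
    have hb' : 0 < 1 - p.b := by
      have := lt_of_le_of_ne p.b_le_one hb
      linarith
    have h := p.c_sq
    rw [hc] at h
    have hbk : p.b = p.k ^ 2 := by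
      have h0 := p.b_pos
      have : p.b - p.k ^ 2 = 0 := by
        have : p.b * (1 - p.b) * (p.b - p.k ^ 2) = 0 := by linarith
        exact (mul_eq_zero.mp this).resolve_left (by positivity)
      linarith
    -- For `b = k² < 1` and `ζ = 0`, a zero of `B` is a critical point of `φ`, and the first
    -- integral forces `|φ|² = b` there. Hence both points would have the same `|φ|²`.
    have key : ∀ z, p.B ζ z = 0 → p.ampSq z = p.b := fun z hz => by
      rw [hζ, B] at hz
      have hz' : deriv p.phi z = 0 := by simpa using hz
      have h3 := p.norm_deriv_phi_sq z
      rw [hz', zero_mul] at h3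
      have h4 : -p.ampSq z ^ 2 - 2 * p.omega * p.ampSq z + p.firstIntegral = 0 := by
        exact_mod_cast h3.symm
      have h5 : (p.b - p.ampSq z) * (p.ampSq z + (1 - p.b)) = 0 := by
        rw [omega, firstIntegral, ← hbk] at h4
        linear_combination h4
      have h6 := p.ampSq_nonneg z
      rcases mul_eq_zero.mp h5 with h | h <;> linarith
    exact hq ((key x hBx).trans (key y hBy).symm)
  have hf := isLaxEigenfunction_dnoidal hb
  have hw' := hf.sq_eq_negOmegaSq
  rw [← hζ, ← hw] at hw'
  rw [hζ]
  rcases sq_eq_sq_iff_eq_or_eq_neg.mp hw' with h | h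
  · rw [← h]; exact ⟨_, _, hf⟩
  · rw [← neg_eq_iff_eq_neg.mpr h]; exact ⟨_, _, hf.conj_swap⟩

/-- The case `Ω = 0`, which only occurs for the plane waves `k = 0`. -/
theorem exists_isLaxEigenfunction_zero {ζ : ℝ} (h : p.negOmegaSq ζ = 0) :
    ∃ f₁ f₂ : ℝ → ℂ, p.IsLaxEigenfunction ζ 0 f₁ f₂ := by
  have hk := p.k_eq_zero_of_negOmegaSq_eq_zero h
  have ha := p.aReal_eq_zero_of_negOmegaSq_eq_zero h
  have hB : ∀ x, p.B ζ x = 0 := fun x => p.B_eq_zero_of_aReal_sq_eq (by rw [ha x, h]; norm_num)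
  obtain ⟨-, -, hζ⟩ := p.aReal_eq_zero_of_B_eq_zero hk (hB 0)
  have hζ' : 4 * (ζ : ℂ) ^ 2 = 1 - p.b := by exact_mod_cast hζ
  have hφ' : ∀ x, deriv p.phi x = 2 * Complex.I * ζ * p.phi x := fun x => by
    have h1 := hB x
    rw [B] at h1
    linear_combination (-2 * Complex.I) * h1 + deriv p.phi x * Complex.I_sq
  have hq : ∀ x, p.phi x * conj (p.phi x) = p.b := fun x => by
    rw [phi_mul_conj, p.ampSq_of_k_eq_zero hk]
  have hE : ∀ x : ℝ, HasDerivAt (fun x : ℝ => Complex.exp (Complex.I * (1 - ζ) * x))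
      (Complex.exp (Complex.I * (1 - ζ) * x) * (Complex.I * (1 - ζ))) x := fun x => by
    have := ((hasDerivAt_id x).ofReal_comp.const_mul (Complex.I * (1 - (ζ : ℂ)))).cexp
    simpa using this
  have hI := Complex.I_sq
  -- The time matrix vanishes identically, so only the `x`-equation matters. After removing `φ'/φ =
  -- 2iζ` it has constant coefficients, and `4ζ² = 1 - b` makes `1 - ζ` one of its exponents.
  refine ⟨fun x => p.phi x * Complex.exp (Complex.I * (1 - ζ) * x),
    fun x => Complex.I * (1 + 2 * ζ) * Complex.exp (Complex.I * (1 - ζ) * x),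
    isLaxEigenfunction_of_real (fun x => ?_) (fun x => ?_) (fun x => ?_) (fun x => ?_) ?_⟩
  · refine ((p.hasDerivAt_phi x).mul (hE x)).congr_deriv ?_
    rw [hφ']; ring
  · refine ((hE x).const_mul (Complex.I * (1 + 2 * (ζ : ℂ)))).congr_deriv ?_
    linear_combination Complex.exp (Complex.I * (1 - ζ) * x) * hq x
      + Complex.exp (Complex.I * (1 - ζ) * x) * (1 + ζ - 2 * ζ ^ 2 - ζ - 2 * ζ ^ 2) * hI
      + Complex.exp (Complex.I * (1 - ζ) * x) * hζ'
  · rw [A_ofReal, ha, hB]; simp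
  · rw [A_ofReal, C_ofReal, ha, hB]; simp
  · refine ⟨0, Or.inl (mul_ne_zero ?_ (Complex.exp_ne_zero _))⟩
    intro h0
    have h1 := hq 0
    rw [h0, zero_mul] at h1
    exact p.b_pos.ne (by exact_mod_cast h1)

theorem ofReal_mem_laxSpectrum (p : EllipticParams) (ζ : ℝ) : (ζ : ℂ) ∈ p.LaxSpectrum := by
  rcases eq_or_lt_of_le (p.negOmegaSq_nonneg ζ) with h | h
  · obtain ⟨f₁, f₂, hf⟩ := exists_isLaxEigenfunction_zero h.symm
    exact ⟨_, _, _, hf⟩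
  · obtain ⟨f₁, f₂, hf⟩ := exists_isLaxEigenfunction (Real.sqrt_pos.mpr h).ne'
      (Real.sq_sqrt h.le)
    exact ⟨_, _, _, hf⟩

end EllipticParams

end NLSKrein

namespace NLSKrein

namespace EllipticParams

/-! ### The Floquet exponent as a function of `ζ` -/

variable (p : EllipticParams)

/-- A branch of `-i Ω(ζ)` for real `ζ`; the sign `s` is `1` or `-1`. -/
noncomputable def branch (s ζ : ℝ) : ℝ := s * Real.sqrt (p.negOmegaSq ζ)

/-- The derivative of `branch`. -/
noncomputable def branchDeriv (s ζ : ℝ) : ℝ :=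
  (4 * ζ ^ 3 - 2 * p.omega * ζ - p.c) / (2 * p.branch s ζ)

/-- The derivative of the argument of the first component of a Lax eigenfunction. -/
noncomputable def phaseDensity (s ζ x : ℝ) : ℝ :=
  -ζ + (ζ * p.ampSq x - p.c / 2) / (p.aReal ζ x + p.branch s ζ)

/-- The derivative of `phaseDensity` in `ζ`. -/
noncomputable def phaseDensityDeriv (s ζ x : ℝ) : ℝ :=
  -1 + p.ampSq x / (p.aReal ζ x + p.branch s ζ)
    - (ζ * p.ampSq x - p.c / 2) * (-2 * ζ + p.branchDeriv s ζ)
      / (p.aReal ζ x + p.branch s ζ) ^ 2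

/-- The increment of the argument of the first component of a Lax eigenfunction over a period. -/
noncomputable def floquetPhase (s ζ : ℝ) : ℝ := ∫ x in (0 : ℝ)..p.T, p.phaseDensity s ζ x

section Phase

variable {p} {s ζ : ℝ}

theorem branch_sq (hs : s ^ 2 = 1) (ζ : ℝ) : p.branch s ζ ^ 2 = p.negOmegaSq ζ := by
  rw [branch, mul_pow, hs, one_mul, Real.sq_sqrt (p.negOmegaSq_nonneg ζ)]

theorem branch_ne_zero (hs : s ^ 2 = 1) (hpos : 0 < p.negOmegaSq ζ) : p.branch s ζ ≠ 0 := by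
  intro h
  have := branch_sq (p := p) hs ζ
  rw [h] at this
  norm_num at this
  exact hpos.ne this

theorem continuous_negOmegaSq : Continuous p.negOmegaSq := by
  unfold negOmegaSq; fun_prop

theorem continuous_branch : Continuous (p.branch s) := by
  have := continuous_negOmegaSq (p := p)
  unfold branch; fun_prop

theorem hasDerivAt_negOmegaSq (ζ : ℝ) :
    HasDerivAt p.negOmegaSq (4 * ζ ^ 3 - 2 * p.omega * ζ - p.c) ζ := by
  have h := (((((hasDerivAt_id ζ).pow 4).sub (((hasDerivAt_id ζ).pow 2).const_mul
    p.omega)).sub ((hasDerivAt_id ζ).const_mul p.c)).add_const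
    ((1 / 16) * (4 * p.omega * p.b + 3 * p.b ^ 2 + (1 - p.k ^ 2) ^ 2)))
  refine h.congr_deriv ?_
  simp; ring

theorem hasDerivAt_branch (hs : s ^ 2 = 1) (hpos : 0 < p.negOmegaSq ζ) :
    HasDerivAt (p.branch s) (p.branchDeriv s ζ) ζ := by
  refine (((hasDerivAt_negOmegaSq ζ).sqrt hpos.ne').const_mul s).congr_deriv ?_
  have h1 := branch_ne_zero hs hpos
  have h2 := (Real.sqrt_pos.mpr hpos).ne'
  rw [branchDeriv]
  rw [branch] at h1 ⊢
  have h3 : s ≠ 0 := left_ne_zero_of_mul h1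
  field_simp
  rw [hs]; ring

theorem hasDerivAt_phaseDensity (hs : s ^ 2 = 1) (hpos : 0 < p.negOmegaSq ζ) {x : ℝ}
    (hne : p.aReal ζ x + p.branch s ζ ≠ 0) :
    HasDerivAt (fun ζ => p.phaseDensity s ζ x) (p.phaseDensityDeriv s ζ x) ζ := by
  have ha : HasDerivAt (fun ζ => p.aReal ζ x) (-2 * ζ) ζ := by
    refine (((((hasDerivAt_id ζ).pow 2).neg).add_const (p.ampSq x / 2)).add_const
      (p.omega / 2)).congr_deriv ?_
    simp
  refine ((hasDerivAt_id ζ).neg.add ((((hasDerivAt_id ζ).mul_const (p.ampSq x)).sub_const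
    (p.c / 2)).div (ha.add (hasDerivAt_branch hs hpos)) hne)).congr_deriv ?_
  rw [phaseDensityDeriv]
  simp only [Pi.add_apply, id]
  field_simp
  ring

/-- The last fraction is the quotient-rule expression for the `x`-derivative of `h / (4w(a + w))`.
It integrates to zero over a period, so only `-a/w`, the density that also governs `K₂`, survives.
-/
theorem phaseDensityDeriv_identity {ζ ω c w a q h D : ℝ} (hw : w ≠ 0) (haw : a + w ≠ 0)
    (ha : a = -ζ ^ 2 + q / 2 + ω / 2) (hh : h ^ 2 = -q ^ 3 - 2 * ω * q ^ 2 + D * q - c ^ 2)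
    (hw2 : w ^ 2 = (ω / 2 - ζ ^ 2) ^ 2 - c * ζ + D / 4) :
    -1 + q / (a + w) - (ζ * q - c / 2) * (-2 * ζ + (4 * ζ ^ 3 - 2 * ω * ζ - c) / (2 * w))
      / (a + w) ^ 2
    = -a / w - ((-3 * q ^ 2 - 4 * ω * q + D) * (4 * w * (a + w)) - h * (4 * w * h))
      / (4 * w * (a + w)) ^ 2 := by
  have hD : D = 4 * (w ^ 2 - (ω / 2 - ζ ^ 2) ^ 2 + c * ζ) := by linarith
  have hq : q = 2 * (a + ζ ^ 2 - ω / 2) := by linarith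
  have hh' : h * (4 * w * h) = 4 * w * h ^ 2 := by ring
  rw [hh', hh, hD, hq]
  field_simp
  ring

theorem hasDerivAt_phase_correction {w : ℝ} (hw : w ≠ 0) (x : ℝ) (hne : p.aReal ζ x + w ≠ 0) :
    HasDerivAt (fun x => p.halfDerivAmpSq x / (4 * w * (p.aReal ζ x + w)))
      (((-3 * p.ampSq x ^ 2 - 4 * p.omega * p.ampSq x + p.firstIntegral)
        * (4 * w * (p.aReal ζ x + w)) - p.halfDerivAmpSq x * (4 * w * p.halfDerivAmpSq x))
        / (4 * w * (p.aReal ζ x + w)) ^ 2) x :=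
  (p.hasDerivAt_halfDerivAmpSq x).div (((p.hasDerivAt_aReal ζ x).add_const w).const_mul (4 * w))
    (by positivity)

theorem continuous_phaseDensity (hne : ∀ x, p.aReal ζ x + p.branch s ζ ≠ 0) :
    Continuous (p.phaseDensity s ζ) := by
  have h1 := p.continuous_ampSq
  have h2 := p.continuous_aReal ζ
  unfold phaseDensity
  exact continuous_const.add (((continuous_const.mul h1).sub continuous_const).div
    (h2.add continuous_const) hne)

theorem continuousOn_phaseDensityDeriv {U : Set ℝ} (hs : s ^ 2 = 1)
    (hpos : ∀ ζ ∈ U, 0 < p.negOmegaSq ζ) (hne : ∀ ζ ∈ U, ∀ x, p.aReal ζ x + p.branch s ζ ≠ 0) :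
    ContinuousOn (fun z : ℝ × ℝ => p.phaseDensityDeriv s z.1 z.2) (U ×ˢ Set.univ) := by
  have h1 : Continuous fun z : ℝ × ℝ => p.ampSq z.2 := p.continuous_ampSq.comp continuous_snd
  have h2 : Continuous fun z : ℝ × ℝ => p.aReal z.1 z.2 := by
    unfold aReal; fun_prop
  have h3 : Continuous fun z : ℝ × ℝ => p.branch s z.1 := continuous_branch.comp continuous_fst
  have h4 : ContinuousOn (fun z : ℝ × ℝ => p.branchDeriv s z.1) (U ×ˢ Set.univ) := by
    unfold branchDeriv
    refine (by fun_prop : Continuous _).continuousOn.div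
      (continuous_const.mul h3).continuousOn fun z hz => ?_
    exact mul_ne_zero two_ne_zero (branch_ne_zero hs (hpos _ hz.1))
  have h5 : ContinuousOn (fun z : ℝ × ℝ => p.aReal z.1 z.2 + p.branch s z.1) (U ×ˢ Set.univ) :=
    (h2.add h3).continuousOn
  have h6 : Continuous fun z : ℝ × ℝ => z.1 * p.ampSq z.2 - p.c / 2 := by fun_prop
  have h7 : Continuous fun z : ℝ × ℝ => -2 * z.1 := by fun_prop
  unfold phaseDensityDeriv
  refine (continuousOn_const.add (h1.continuousOn.div h5 fun z hz => hne _ hz.1 _)).sub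
    ((h6.continuousOn.mul (h7.continuousOn.add h4)).div (h5.pow 2) fun z hz =>
      pow_ne_zero 2 (hne _ hz.1 _))

theorem aReal_add_T (x : ℝ) : p.aReal ζ (x + p.T) = p.aReal ζ x := by
  rw [aReal, ampSq_add_T, aReal]

theorem integral_phaseDensityDeriv (hs : s ^ 2 = 1) (hpos : 0 < p.negOmegaSq ζ)
    (hne : ∀ x, p.aReal ζ x + p.branch s ζ ≠ 0) :
    ∫ x in (0 : ℝ)..p.T, p.phaseDensityDeriv s ζ x
      = p.T / p.branch s ζ * (ζ ^ 2 - p.zetaCSq) := by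
  have hw := branch_ne_zero hs hpos
  have ca := p.continuous_aReal ζ
  have cq := p.continuous_ampSq
  have ch := p.continuous_halfDerivAmpSq
  have hI1 : ∫ x in (0 : ℝ)..p.T, p.aReal ζ x = p.T * (p.zetaCSq - ζ ^ 2) := by
    have h := integral_aReal p ζ 1
    have hper : Function.Periodic (p.aReal ζ) p.T := aReal_add_T
    have h2 := hper.intervalIntegral_add_eq 0 (-(p.T / 2))
    rw [zero_add, show -(p.T / 2) + p.T = p.T / 2 by ring] at h2
    rw [h2]
    simpa using h
  have hd := fun x => hasDerivAt_phase_correction hw x (hne x)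
  have hI2 := intervalIntegral.integral_eq_sub_of_hasDerivAt (a := 0) (b := p.T)
    (fun x _ => hd x) (Continuous.intervalIntegrable (by
      refine Continuous.div (by fun_prop) (by fun_prop) fun x => ?_
      exact pow_ne_zero 2 (mul_ne_zero (mul_ne_zero (by norm_num) hw) (hne x))) _ _)
  have e1 := aReal_add_T (p := p) (ζ := ζ) 0
  have e2 := p.halfDerivAmpSq_add_T 0
  rw [zero_add] at e1 e2
  rw [e1, e2, sub_self] at hI2
  have key : ∀ x, p.phaseDensityDeriv s ζ x = -(1 / p.branch s ζ) * p.aReal ζ x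
      - ((-3 * p.ampSq x ^ 2 - 4 * p.omega * p.ampSq x + p.firstIntegral)
        * (4 * p.branch s ζ * (p.aReal ζ x + p.branch s ζ))
          - p.halfDerivAmpSq x * (4 * p.branch s ζ * p.halfDerivAmpSq x))
        / (4 * p.branch s ζ * (p.aReal ζ x + p.branch s ζ)) ^ 2 := fun x => by
    rw [phaseDensityDeriv, branchDeriv, phaseDensityDeriv_identity hw (hne x) rfl
      (p.halfDerivAmpSq_sq x) ((branch_sq hs ζ).trans (p.negOmegaSq_eq ζ))]
    ring
  simp only [key]
  rw [intervalIntegral.integral_sub, hI2, intervalIntegral.integral_const_mul, hI1]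
  · field_simp; ring
  · exact Continuous.intervalIntegrable (by fun_prop) _ _
  · refine Continuous.intervalIntegrable ?_ _ _
    refine Continuous.div (by fun_prop) (by fun_prop) fun x => ?_
    exact pow_ne_zero 2 (mul_ne_zero (mul_ne_zero (by norm_num) hw) (hne x))

/-- The derivative of the Floquet exponent vanishes exactly at `± ζ_c`. -/
theorem hasDerivAt_floquetPhase {U : Set ℝ} (hU : IsOpen U) (hs : s ^ 2 = 1)
    (hpos : ∀ ζ ∈ U, 0 < p.negOmegaSq ζ) (hne : ∀ ζ ∈ U, ∀ x, p.aReal ζ x + p.branch s ζ ≠ 0)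
    (hζ : ζ ∈ U) :
    HasDerivAt (p.floquetPhase s) (p.T / p.branch s ζ * (ζ ^ 2 - p.zetaCSq)) ζ := by
  obtain ⟨ε, hε, hεU⟩ := Metric.nhds_basis_closedBall.mem_iff.mp (hU.mem_nhds hζ)
  have hc := continuousOn_phaseDensityDeriv hs hpos hne
  obtain ⟨M, hM⟩ := ((isCompact_closedBall ζ ε).prod
    (isCompact_uIcc (a := (0 : ℝ)) (b := p.T))).exists_bound_of_continuousOn
    (hc.mono (Set.prod_mono hεU (Set.subset_univ _)))
  have hcx : Continuous (p.phaseDensityDeriv s ζ) := by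
    have : p.phaseDensityDeriv s ζ
        = (fun z : ℝ × ℝ => p.phaseDensityDeriv s z.1 z.2) ∘ fun x => (ζ, x) := rfl
    rw [this, ← continuousOn_univ]
    exact hc.comp (by fun_prop) fun x _ => ⟨hζ, Set.mem_univ _⟩
  -- The integrand's `ζ`-derivative is bounded by `M` on a compact product of a ball in `U` and one
  -- period.
  have h := intervalIntegral.hasDerivAt_integral_of_dominated_loc_of_deriv_le
    (μ := MeasureTheory.volume) (a := 0) (b := p.T)
    (F := fun ζ x => p.phaseDensity s ζ x) (F' := fun ζ x => p.phaseDensityDeriv s ζ x)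
    (x₀ := ζ) (s := Metric.closedBall ζ ε) (bound := fun _ => M)
    (Metric.closedBall_mem_nhds ζ hε)
    (by
      filter_upwards [hU.mem_nhds hζ] with z hz
      exact (continuous_phaseDensity (hne z hz)).aestronglyMeasurable)
    ((continuous_phaseDensity (hne ζ hζ)).intervalIntegrable _ _)
    hcx.aestronglyMeasurable
    (Eventually.of_forall fun x hx z hz => hM (z, x) ⟨hz, Set.uIoc_subset_uIcc hx⟩)
    (by simp)
    (Eventually.of_forall fun x _ z hz =>
      hasDerivAt_phaseDensity hs (hpos z (hεU hz)) (hne z (hεU hz) x))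
  rw [← integral_phaseDensityDeriv hs (hpos ζ hζ) (hne ζ hζ)]
  exact h.2

/-- Two parameters with the same Floquet multiplier are separated by a zero of
`ζ ^ 2 - ζ_c ^ 2`. -/
theorem exists_between_sq_eq_zetaCSq {l r M ζ₁ ζ₂ : ℝ} (hs : s ^ 2 = 1)
    (hpos : ∀ ζ ∈ Set.Ioo l r, 0 < p.negOmegaSq ζ)
    (hne : ∀ ζ ∈ Set.Ioo l r, ∀ x, p.aReal ζ x + p.branch s ζ ≠ 0)
    (hM : ∀ ζ ∈ Set.Ioo l r, |p.T / p.branch s ζ * (ζ ^ 2 - p.zetaCSq)| ≤ M)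
    (h₁ : ζ₁ ∈ Set.Ioo l r) (h₂ : ζ₂ ∈ Set.Ioo l r) (hlt : ζ₁ < ζ₂)
    (hclose : M * |ζ₂ - ζ₁| < Real.pi)
    (hexp : Complex.exp (2 * Complex.I * p.floquetPhase s ζ₁)
      = Complex.exp (2 * Complex.I * p.floquetPhase s ζ₂)) :
    ∃ ξ ∈ Set.Ioo ζ₁ ζ₂, ξ ^ 2 = p.zetaCSq := by
  have hd := fun ζ hζ => hasDerivAt_floquetPhase (p := p) (ζ := ζ) isOpen_Ioo hs hpos hne hζ
  have hle : |p.floquetPhase s ζ₂ - p.floquetPhase s ζ₁| ≤ M * |ζ₂ - ζ₁| :=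
    (convex_Ioo l r).norm_image_sub_le_of_norm_hasDerivWithin_le
      (fun ζ hζ => (hd ζ hζ).hasDerivWithinAt) hM h₁ h₂
  -- Equal multipliers leave a difference in `π ℤ`; the mean value bound makes it smaller than `π`,
  -- hence zero, and Rolle's theorem applies.
  have heq : p.floquetPhase s ζ₁ = p.floquetPhase s ζ₂ := by
    obtain ⟨n, hn⟩ := Complex.exp_eq_exp_iff_exists_int.mp hexp
    have hn' : (p.floquetPhase s ζ₁ : ℂ) = p.floquetPhase s ζ₂ + n * Real.pi := by
      have : 2 * Complex.I * ((p.floquetPhase s ζ₁ : ℂ)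
          - (p.floquetPhase s ζ₂ + n * Real.pi)) = 0 := by linear_combination hn
      have h0 : (2 * Complex.I : ℂ) ≠ 0 := mul_ne_zero two_ne_zero Complex.I_ne_zero
      exact sub_eq_zero.mp ((mul_eq_zero.mp this).resolve_left h0)
    have hn'' : p.floquetPhase s ζ₁ = p.floquetPhase s ζ₂ + n * Real.pi := by
      exact_mod_cast hn'
    have hlt' := hle.trans_lt hclose
    rw [hn'', show p.floquetPhase s ζ₂ - (p.floquetPhase s ζ₂ + n * Real.pi)
      = -(n * Real.pi) by ring, abs_neg, abs_mul, abs_of_pos Real.pi_pos] at hlt'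
    have h1 : |(n : ℝ)| < 1 := by
      by_contra! h
      nlinarith [Real.pi_pos]
    have h2 : n = 0 := by
      rw [← Int.abs_lt_one_iff]; exact_mod_cast h1
    rw [hn'', h2]; simp
  have hsub : Set.Icc ζ₁ ζ₂ ⊆ Set.Ioo l r := fun z hz => ⟨h₁.1.trans_le hz.1, hz.2.trans_lt h₂.2⟩
  obtain ⟨ξ, hξ, h0⟩ := exists_hasDerivAt_eq_zero hlt
    (fun z hz => (hd z (hsub hz)).continuousAt.continuousWithinAt) heq
    (fun z hz => hd z (hsub (Set.Ioo_subset_Icc_self hz)))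
  refine ⟨ξ, hξ, ?_⟩
  have hb := branch_ne_zero hs (hpos ξ (hsub (Set.Ioo_subset_Icc_self hξ)))
  rcases mul_eq_zero.mp h0 with h | h
  · exact absurd h (div_ne_zero p.T_pos.ne' hb)
  · linarith

/-- The first component of a Lax eigenfunction over a period. -/
theorem IsLaxEigenfunction.fst_sq_T {f₁ f₂ : ℝ → ℂ}
    (hf : p.IsLaxEigenfunction ζ (Complex.I * p.branch s ζ) f₁ f₂)
    (hne : ∀ x, p.aReal ζ x + p.branch s ζ ≠ 0) :
    f₁ p.T ^ 2 = Complex.exp (2 * Complex.I * p.floquetPhase s ζ) * f₁ 0 ^ 2 ∧ f₁ 0 ≠ 0 := by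
  have hneC : ∀ x, ((p.aReal ζ x + p.branch s ζ : ℝ) : ℂ) ≠ 0 := fun x => by
    exact_mod_cast hne x
  have hq : ∀ x, f₂ x * ((p.aReal ζ x + p.branch s ζ : ℝ) : ℂ)
      = Complex.I * conj (p.B ζ x) * f₁ x := fun x => by
    have h := hf.time_snd x
    rw [A_ofReal, C_ofReal] at h
    push_cast
    linear_combination Complex.I * h + (p.aReal ζ x + p.branch s ζ) * f₂ x * Complex.I_sq
  -- The logarithmic derivative of `f₁²` has real part `h/(a + w)`, which is that of `a + w`. The
  -- division leaves a pure phase, and `a + w` is periodic, so it does not affect the multiplier.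
  have hd : ∀ x, HasDerivAt (fun x => f₁ x ^ 2 / ((p.aReal ζ x + p.branch s ζ : ℝ) : ℂ))
      (2 * Complex.I * p.phaseDensity s ζ x
        * (f₁ x ^ 2 / ((p.aReal ζ x + p.branch s ζ : ℝ) : ℂ))) x := fun x => by
    refine ((hf.hasDerivAt_fst_sq x).div
      ((p.hasDerivAt_aReal ζ x).add_const (p.branch s ζ)).ofReal_comp (hneC x)).congr_deriv ?_
    have h1 := hneC x
    have h2 := hq x
    have h3 := congrArg conj (p.B_mul_conj_phi ζ x)
    simp only [map_mul, map_add, Complex.conj_conj, Complex.conj_I, Complex.conj_ofReal] at h3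
    rw [phaseDensity]
    push_cast at h1 h2 h3 ⊢
    field_simp
    linear_combination 2 * p.phi x * f₁ x * h2 + 2 * Complex.I * f₁ x ^ 2 * h3
      - p.halfDerivAmpSq x * f₁ x ^ 2 * Complex.I_sq
  have cG := continuous_phaseDensity hne
  have he : ∀ x, HasDerivAt
      (fun x => Complex.exp (-(2 * Complex.I * (∫ y in (0 : ℝ)..x, p.phaseDensity s ζ y : ℝ))))
      (Complex.exp (-(2 * Complex.I * (∫ y in (0 : ℝ)..x, p.phaseDensity s ζ y : ℝ)))
        * (-(2 * Complex.I * p.phaseDensity s ζ x))) x := fun x =>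
    (((cG.integral_hasStrictDerivAt 0 x).hasDerivAt.ofReal_comp.const_mul
      (2 * Complex.I)).neg).cexp
  have hconst := is_const_of_deriv_eq_zero
    (fun x => ((hd x).mul (he x)).differentiableAt)
    (fun x => ((hd x).mul (he x)).deriv.trans (by ring)) p.T 0
  have e1 := aReal_add_T (p := p) (ζ := ζ) 0
  rw [zero_add] at e1
  refine ⟨?_, fun h0 => ?_⟩
  · simp only [Pi.mul_apply, intervalIntegral.integral_same, Complex.ofReal_zero, mul_zero,
      neg_zero, Complex.exp_zero, mul_one, e1] at hconst
    rw [← floquetPhase, Complex.exp_neg] at hconst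
    have h1 := hneC 0
    have h2 := Complex.exp_ne_zero (2 * Complex.I * p.floquetPhase s ζ)
    field_simp at hconst
    linear_combination hconst
  · have h1 := hq 0
    rw [h0, mul_zero] at h1
    have h2 := (mul_eq_zero.mp h1).resolve_right (hneC 0)
    have h3 := hf.norm_sq_add_pos 0
    rw [h0, h2] at h3
    simp at h3

end Phase

end EllipticParams

end NLSKrein

namespace NLSKrein

namespace EllipticParams

/-! ### Collisions at `± ζ_c` -/

variable {p : EllipticParams}

theorem abs_zetaCSq_le (p : EllipticParams) : |p.zetaCSq| ≤ 1 := by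
  have hK := ellK_pos p.k_nonneg p.k_lt_one
  have hE := ellE_nonneg (k := p.k)
  have hEK := ellE_le_ellK p.k_nonneg p.k_lt_one
  have hb := p.b_le_one
  have hkb := p.k_sq_le
  have hk := sq_nonneg p.k
  have h1 : 0 ≤ (p.b - p.k ^ 2) * ellK p.k := mul_nonneg (by linarith) hK.le
  have h2 : 0 ≤ (1 - (p.b - p.k ^ 2)) * ellK p.k := mul_nonneg (by linarith) hK.le
  rw [zetaCSq, abs_le]
  constructor
  · rw [le_div_iff₀ (by positivity)]; linarith
  · rw [div_le_iff₀ (by positivity)]; linarith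

/-- `a` is increasing in `|φ|²`, so its extremes are at `K` and `0`. Nonvanishing for all `x` thus
follows from an open condition on finitely many parameters, which passes from the limit to the
sequence. -/
theorem aReal_add_ne_zero {ζ w : ℝ}
    (h : 0 < (p.aReal ζ (ellK p.k) + w) * (p.aReal ζ 0 + w)) (x : ℝ) : p.aReal ζ x + w ≠ 0 := by
  have h1 := p.le_ampSq x
  have h2 := p.ampSq_le x
  have e1 : p.aReal ζ (ellK p.k) ≤ p.aReal ζ x := by
    rw [aReal, aReal, ampSq_ellK]; linarith
  have e2 : p.aReal ζ x ≤ p.aReal ζ 0 := by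
    rw [aReal, aReal, ampSq_zero]; linarith
  rcases pos_and_pos_or_neg_and_neg_of_mul_pos h with ⟨h3, h4⟩ | ⟨h3, h4⟩
  · exact (show 0 < p.aReal ζ x + w by linarith).ne'
  · exact (show p.aReal ζ x + w < 0 by linarith).ne

/-- For `ζ ≠ 0`, one of `A + Ω` and `A - Ω` does not vanish. -/
theorem exists_sign_aReal_add {ζ w : ℝ} (hζ : ζ ≠ 0) (hw0 : w ≠ 0)
    (hw : w ^ 2 = p.negOmegaSq ζ) : ∃ τ : ℝ, (τ = 1 ∨ τ = -1) ∧
      0 < (p.aReal ζ (ellK p.k) + τ * w) * (p.aReal ζ 0 + τ * w) := by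
  have hle := fun x => sq_le_sq.mp (hw ▸ p.aReal_sq_le ζ x)
  -- As `|a| ≤ |w|`, the two factors never have opposite signs, so failure of the claim means that
  -- both products vanish.
  have hnn : ∀ t : ℝ, |t| = |w| → 0 ≤ (p.aReal ζ (ellK p.k) + t) * (p.aReal ζ 0 + t) := by
    intro t ht
    have h1 := hle 0
    have h2 := hle (ellK p.k)
    rw [← ht] at h1 h2
    rcases le_total 0 t with h | h
    · rw [abs_of_nonneg h] at h1 h2
      exact mul_nonneg (by linarith [neg_abs_le (p.aReal ζ (ellK p.k))])
        (by linarith [neg_abs_le (p.aReal ζ 0)])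
    · rw [abs_of_nonpos h] at h1 h2
      exact mul_nonneg_of_nonpos_of_nonpos (by linarith [le_abs_self (p.aReal ζ (ellK p.k))])
        (by linarith [le_abs_self (p.aReal ζ 0)])
  by_contra! h
  have h1 := le_antisymm (h 1 (Or.inl rfl)) (hnn (1 * w) (by simp))
  have h2 := le_antisymm (h (-1) (Or.inr rfl)) (hnn (-1 * w) (by simp))
  -- Then `B = 0` at both extremes of `|φ|²`, and `ζ|φ|² = c/2` there with `ζ ≠ 0` forces `k = 0`,
  -- which in turn forces `w = 0`.
  have key : p.aReal ζ (ellK p.k) ^ 2 = w ^ 2 ∧ p.aReal ζ 0 ^ 2 = w ^ 2 := by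
    rcases mul_eq_zero.mp h1 with h3 | h3 <;> rcases mul_eq_zero.mp h2 with h4 | h4
    · exact absurd (by linarith) hw0
    · exact ⟨by rw [eq_neg_of_add_eq_zero_left h3]; ring,
        by rw [eq_neg_of_add_eq_zero_left h4]; ring⟩
    · exact ⟨by rw [eq_neg_of_add_eq_zero_left h4]; ring,
        by rw [eq_neg_of_add_eq_zero_left h3]; ring⟩
    · exact absurd (by linarith) hw0
  have hK := p.mul_ampSq_of_B_eq_zero (p.B_eq_zero_of_aReal_sq_eq (key.1.trans hw))
  have hB0 := p.B_eq_zero_of_aReal_sq_eq (key.2.trans hw)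
  have h0 := p.mul_ampSq_of_B_eq_zero hB0
  rw [ampSq_ellK] at hK
  rw [ampSq_zero] at h0
  have hk : p.k = 0 := by
    have : ζ * p.k ^ 2 = 0 := by linear_combination h0 - hK
    exact pow_eq_zero_iff two_ne_zero |>.mp ((mul_eq_zero.mp this).resolve_left hζ)
  have h5 := (p.aReal_eq_zero_of_B_eq_zero hk hB0).1
  rw [h5] at key
  exact hw0 (pow_eq_zero_iff two_ne_zero |>.mp (by linarith [key.2]))

/-- The Floquet exponent of the squared eigenfunctions in terms of `floquetPhase`. -/
theorem IsLaxEigenfunction.exp_floquetPhase {s ζ w τ μ : ℝ} {lam : ℂ} {f₁ f₂ : ℝ → ℂ}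
    (hf : p.IsLaxEigenfunction ζ (Complex.I * w) f₁ f₂)
    (hb : p.IsBlochEigenfunction lam μ (p.sqU f₁ f₂) (p.sqV f₁ f₂))
    (hτ : τ = 1 ∨ τ = -1) (hs : p.branch s ζ = τ * w)
    (hne : ∀ x, p.aReal ζ x + p.branch s ζ ≠ 0) :
    Complex.exp (2 * Complex.I * p.floquetPhase s ζ)
      = Complex.exp (Complex.I * p.theta p.T) * Complex.exp (τ * (Complex.I * μ * p.T)) := by
  have h0 : p.theta 0 = 0 := by simp [theta]
  have hexp : Complex.exp (Complex.I * p.theta p.T) * Complex.exp (-Complex.I * p.theta p.T)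
      = 1 := by rw [← Complex.exp_add]; simp
  rcases hτ with rfl | rfl
  · rw [one_mul] at hs
    rw [← hs] at hf
    obtain ⟨h1, h2⟩ := hf.fst_sq_T hne
    have h3 := hb.fst_sq_add_T 0
    rw [zero_add, h0, Complex.ofReal_zero, mul_zero, Complex.exp_zero, one_mul, h1] at h3
    apply mul_right_cancel₀ (pow_ne_zero 2 h2)
    rw [Complex.ofReal_one, one_mul]
    linear_combination Complex.exp (Complex.I * p.theta p.T) * h3
      - Complex.exp (2 * Complex.I * p.floquetPhase s ζ) * f₁ 0 ^ 2 * hexp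
  -- When only `a - w` is free of zeros, the phase of `conj f₂` is used instead; conjugation
  -- reverses the sign of `μ`.
  · have hg := hf.conj_swap
    rw [← neg_one_mul, ← hs] at hg
    obtain ⟨h1, h2⟩ := hg.fst_sq_T hne
    have h3 := congrArg conj (hb.snd_sq_add_T 0)
    rw [zero_add, h0] at h3
    simp only [map_mul, map_pow, ← Complex.exp_conj, Complex.conj_I, Complex.conj_ofReal,
      Complex.ofReal_zero, mul_zero, Complex.exp_zero, one_mul] at h3
    rw [h1] at h3
    apply mul_right_cancel₀ (pow_ne_zero 2 h2)
    rw [Complex.ofReal_neg, Complex.ofReal_one, neg_one_mul, ← neg_mul, ← neg_mul]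
    linear_combination Complex.exp (Complex.I * p.theta p.T) * h3
      - Complex.exp (2 * Complex.I * p.floquetPhase s ζ) * conj (f₂ 0) ^ 2 * hexp

/-- The interval lies on one side of `0`, so `ζ²` is strictly monotone on it, and a zero of `ζ² -
ζ_c²` between the two parameters separates the signs. -/
theorem sign_sub_zetaCSq_opposite {s l r M ζ₁ ζ₂ : ℝ} (hs : s ^ 2 = 1)
    (hpos : ∀ ζ ∈ Set.Ioo l r, 0 < p.negOmegaSq ζ)
    (hne : ∀ ζ ∈ Set.Ioo l r, ∀ x, p.aReal ζ x + p.branch s ζ ≠ 0)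
    (hM : ∀ ζ ∈ Set.Ioo l r, |p.T / p.branch s ζ * (ζ ^ 2 - p.zetaCSq)| ≤ M)
    (hlr : 0 ≤ l ∨ r ≤ 0)
    (h₁ : ζ₁ ∈ Set.Ioo l r) (h₂ : ζ₂ ∈ Set.Ioo l r) (h₁₂ : ζ₁ ≠ ζ₂)
    (hclose : M * |ζ₂ - ζ₁| < Real.pi)
    (hexp : Complex.exp (2 * Complex.I * p.floquetPhase s ζ₁)
      = Complex.exp (2 * Complex.I * p.floquetPhase s ζ₂)) :
    SignType.sign (ζ₁ ^ 2 - p.zetaCSq) ≠ 0 ∧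
      SignType.sign (ζ₁ ^ 2 - p.zetaCSq) = -SignType.sign (ζ₂ ^ 2 - p.zetaCSq) := by
  have key : ∀ a b, a ∈ Set.Ioo l r → b ∈ Set.Ioo l r → (∃ ξ ∈ Set.Ioo a b, ξ ^ 2 = p.zetaCSq) →
      (a ^ 2 - p.zetaCSq < 0 ∧ 0 < b ^ 2 - p.zetaCSq) ∨
      (0 < a ^ 2 - p.zetaCSq ∧ b ^ 2 - p.zetaCSq < 0) := by
    rintro a b ⟨ha1, ha2⟩ ⟨hb1, hb2⟩ ⟨ξ, ⟨hξ1, hξ2⟩, hξ⟩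
    rw [← hξ]
    rcases hlr with h | h
    · exact Or.inl ⟨by nlinarith, by nlinarith⟩
    · exact Or.inr ⟨by nlinarith, by nlinarith⟩
  have concl : ∀ u v : ℝ, (u < 0 ∧ 0 < v) ∨ (0 < u ∧ v < 0) →
      SignType.sign u ≠ 0 ∧ SignType.sign u = -SignType.sign v := by
    rintro u v (⟨hu, hv⟩ | ⟨hu, hv⟩)
    · rw [sign_neg hu, sign_pos hv]; decide
    · rw [sign_pos hu, sign_neg hv]; decide
  rcases lt_or_gt_of_ne h₁₂ with h | h
  · exact concl _ _ (key _ _ h₁ h₂ (exists_between_sq_eq_zetaCSq hs hpos hne hM h₁ h₂ h hclose hexp))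
  · rw [abs_sub_comm] at hclose
    have := key _ _ h₂ h₁
      (exists_between_sq_eq_zetaCSq hs hpos hne hM h₂ h₁ h hclose hexp.symm)
    exact concl _ _ (by tauto)

/-! ### Limits in the parameters, with uniform bounds -/

section Limits

variable {α : Type*} {l : Filter α} {P : α → EllipticParams} {q : EllipticParams} {z : α → ℝ}
  {ζ : ℝ} (hk : Tendsto (fun i => (P i).k) l (𝓝 q.k)) (hb : Tendsto (fun i => (P i).b) l (𝓝 q.b))
  (hz : Tendsto z l (𝓝 ζ))
include hk hb hz

theorem tendsto_negOmegaSq (hc : Tendsto (fun i => (P i).c) l (𝓝 q.c)) :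
    Tendsto (fun i => (P i).negOmegaSq (z i)) l (𝓝 (q.negOmegaSq ζ)) := by
  have h : Continuous fun v : (ℝ × ℝ) × (ℝ × ℝ) =>
      v.2.2 ^ 4 - (1 + v.1.1 ^ 2 - 3 * v.1.2) / 2 * v.2.2 ^ 2 - v.2.1 * v.2.2
    + (1 / 16) * (4 * ((1 + v.1.1 ^ 2 - 3 * v.1.2) / 2) * v.1.2 + 3 * v.1.2 ^ 2
      + (1 - v.1.1 ^ 2) ^ 2) := by fun_prop
  have h2 := (h.tendsto ((q.k, q.b), (q.c, ζ))).comp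
    ((hk.prodMk_nhds hb).prodMk_nhds (hc.prodMk_nhds hz))
  simp only [negOmegaSq, omega]
  exact h2

theorem tendsto_aReal_zero :
    Tendsto (fun i => (P i).aReal (z i) 0) l (𝓝 (q.aReal ζ 0)) := by
  have h : Continuous fun v : (ℝ × ℝ) × ℝ =>
      -v.2 ^ 2 + v.1.2 / 2 + (1 + v.1.1 ^ 2 - 3 * v.1.2) / 2 / 2 := by fun_prop
  have h2 := (h.tendsto ((q.k, q.b), ζ)).comp ((hk.prodMk_nhds hb).prodMk_nhds hz)
  simp only [aReal, ampSq_zero]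
  exact h2

theorem tendsto_aReal_ellK :
    Tendsto (fun i => (P i).aReal (z i) (ellK (P i).k)) l (𝓝 (q.aReal ζ (ellK q.k))) := by
  have h : Continuous fun v : (ℝ × ℝ) × ℝ =>
      -v.2 ^ 2 + (v.1.2 - v.1.1 ^ 2) / 2 + (1 + v.1.1 ^ 2 - 3 * v.1.2) / 2 / 2 := by fun_prop
  have h2 := (h.tendsto ((q.k, q.b), ζ)).comp ((hk.prodMk_nhds hb).prodMk_nhds hz)
  simp only [aReal, ampSq_ellK]
  exact h2

end Limits

theorem T_le (p : EllipticParams) {k' : ℝ} (hk : p.k ≤ k') (hk' : k' < 1) :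
    p.T ≤ Real.pi / Real.sqrt (1 - k' ^ 2) := by
  have h0 := p.k_nonneg
  have h1 := ellK_le p.k_nonneg p.k_lt_one
  have h2 : 0 < 1 - k' ^ 2 := by nlinarith
  have h3 : Real.sqrt (1 - k' ^ 2) ≤ Real.sqrt (1 - p.k ^ 2) := Real.sqrt_le_sqrt (by nlinarith)
  have h4 : Real.pi / Real.sqrt (1 - p.k ^ 2) ≤ Real.pi / Real.sqrt (1 - k' ^ 2) :=
    div_le_div_of_nonneg_left Real.pi_pos.le (Real.sqrt_pos.mpr h2) h3
  rw [T]
  calc 2 * ellK p.k ≤ 2 * (Real.pi / 2 / Real.sqrt (1 - p.k ^ 2)) := by linarith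
    _ = Real.pi / Real.sqrt (1 - p.k ^ 2) := by ring
    _ ≤ _ := h4

/-- Uniform control of the Floquet exponent near the collision. -/
theorem exists_uniform_neighborhood {p : ℕ → EllipticParams} {q : EllipticParams} {ζs ws τ s : ℝ}
    (hk : Tendsto (fun n => (p n).k) atTop (𝓝 q.k))
    (hb : Tendsto (fun n => (p n).b) atTop (𝓝 q.b))
    (hc : Tendsto (fun n => (p n).c) atTop (𝓝 q.c)) (hζs : ζs ≠ 0) (hws : ws ≠ 0)
    (hw : ws ^ 2 = q.negOmegaSq ζs)
    (hτ : 0 < (q.aReal ζs (ellK q.k) + τ * ws) * (q.aReal ζs 0 + τ * ws))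
    (hs : s ^ 2 = 1) (hsw : s * |ws| = τ * ws) :
    ∃ δ > 0, ∃ M : ℝ, (0 ≤ ζs - δ ∨ ζs + δ ≤ 0) ∧
      ∀ᶠ n in atTop, ∀ ζ ∈ Set.Ioo (ζs - δ) (ζs + δ),
        0 < (p n).negOmegaSq ζ ∧ (∀ x, (p n).aReal ζ x + (p n).branch s ζ ≠ 0) ∧
        |(p n).T / (p n).branch s ζ * (ζ ^ 2 - (p n).zetaCSq)| ≤ M := by
  -- Limits along `atTop ×ˢ 𝓝 ζs` give one neighbourhood of `ζs` that works for all large `n`.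
  have hk2 : Tendsto (fun z : ℕ × ℝ => (p z.1).k) (atTop ×ˢ 𝓝 ζs) (𝓝 q.k) := hk.comp tendsto_fst
  have hb2 : Tendsto (fun z : ℕ × ℝ => (p z.1).b) (atTop ×ˢ 𝓝 ζs) (𝓝 q.b) := hb.comp tendsto_fst
  have hc2 : Tendsto (fun z : ℕ × ℝ => (p z.1).c) (atTop ×ˢ 𝓝 ζs) (𝓝 q.c) := hc.comp tendsto_fst
  have hz : Tendsto (fun z : ℕ × ℝ => z.2) (atTop ×ˢ 𝓝 ζs) (𝓝 ζs) := tendsto_snd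
  have hN := tendsto_negOmegaSq hk2 hb2 hz hc2
  have hB : Tendsto (fun z : ℕ × ℝ => (p z.1).branch s z.2) (atTop ×ˢ 𝓝 ζs) (𝓝 (τ * ws)) := by
    have := ((Real.continuous_sqrt.tendsto _).comp hN).const_mul s
    rw [← hw, Real.sqrt_sq_eq_abs, hsw] at this
    exact this
  have hprod := ((tendsto_aReal_ellK hk2 hb2 hz).add hB).mul ((tendsto_aReal_zero hk2 hb2 hz).add hB)
  have hw2 : 0 < ws ^ 2 := by positivity
  have hev := (hN.eventually_const_lt (u := ws ^ 2 / 2) (by rw [← hw]; linarith)).and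
    (hprod.eventually_const_lt hτ)
  obtain ⟨pa, hpa, pb, hpb, hab⟩ := eventually_prod_iff.mp hev
  obtain ⟨ε, hε, hεb⟩ := Metric.eventually_nhds_iff.mp hpb
  have hζa := abs_pos.mpr hζs
  have hk1 := q.k_lt_one
  set T₀ := Real.pi / Real.sqrt (1 - ((q.k + 1) / 2) ^ 2) with hT₀
  -- The bound `|ζs|` keeps the interval on one side of `0` and gives `|ζ| ≤ 2|ζs|`. In `M`, `T₀`
  -- bounds the periods because eventually `k ≤ (q.k + 1)/2 < 1`, the root bounds `|branch|` from
  -- below, and the summand `1` bounds `|ζ_c²|`.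
  refine ⟨min ε |ζs|, lt_min hε hζa,
    T₀ / Real.sqrt (ws ^ 2 / 2) * ((2 * |ζs|) ^ 2 + 1), ?_, ?_⟩
  · have h1 := min_le_right ε |ζs|
    rcases le_total 0 ζs with h | h
    · rw [abs_of_nonneg h] at h1 ⊢; left; linarith
    · rw [abs_of_nonpos h] at h1 ⊢; right; linarith
  · filter_upwards [hpa, hk.eventually_lt_const (show q.k < (q.k + 1) / 2 by linarith)]
      with n hn hkn ζ hζ
    have hdist : dist ζ ζs < min ε |ζs| := by
      rw [Real.dist_eq, abs_lt]; constructor <;> linarith [hζ.1, hζ.2]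
    obtain ⟨h1, h2⟩ := hab hn (hεb (hdist.trans_le (min_le_left _ _)))
    simp only at h1 h2
    have hpos : 0 < (p n).negOmegaSq ζ := by linarith
    refine ⟨hpos, aReal_add_ne_zero h2, ?_⟩
    have hT := (p n).T_le hkn.le (by linarith)
    have hTp := (p n).T_pos
    have hs1 : |s| = 1 := by
      rw [← Real.sqrt_sq_eq_abs, hs, Real.sqrt_one]
    have hbr : Real.sqrt (ws ^ 2 / 2) ≤ |(p n).branch s ζ| := by
      rw [branch, abs_mul, hs1, one_mul, abs_of_nonneg (Real.sqrt_nonneg _)]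
      exact Real.sqrt_le_sqrt h1.le
    have hsq : 0 < Real.sqrt (ws ^ 2 / 2) := Real.sqrt_pos.mpr (by positivity)
    have hζ2 : |ζ| ≤ 2 * |ζs| := by
      have h3 : |ζ - ζs| < |ζs| := hdist.trans_le (min_le_right _ _)
      have h4 := abs_sub_abs_le_abs_sub ζ ζs
      linarith
    have hz2 : |ζ ^ 2 - (p n).zetaCSq| ≤ (2 * |ζs|) ^ 2 + 1 := by
      refine (abs_sub _ _).trans (add_le_add ?_ (p n).abs_zetaCSq_le)
      rw [abs_pow]
      exact pow_le_pow_left₀ (abs_nonneg _) hζ2 2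
    rw [abs_mul, abs_div, abs_of_pos hTp]
    exact mul_le_mul (div_le_div₀ (hTp.le.trans hT) hT hsq hbr) hz2 (abs_nonneg _)
      (div_nonneg (hTp.le.trans hT) hsq.le)

theorem branch_eq_of_sq_eq {s τ w ζ : ℝ} (hs : s ^ 2 = 1) (hτ : τ ^ 2 = 1)
    (hw : w ^ 2 = p.negOmegaSq ζ) (hpos : 0 < s * τ * w) : p.branch s ζ = τ * w := by
  have h1 : |s * τ * w| = |w| := by
    rw [← Real.sqrt_sq_eq_abs, ← Real.sqrt_sq_eq_abs, mul_pow, mul_pow, hs, hτ, one_mul, one_mul]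
  rw [branch, ← hw, Real.sqrt_sq_eq_abs, ← h1, abs_of_pos hpos]
  linear_combination τ * w * hs

end EllipticParams

end NLSKrein

/-! ### Assembly of the two statements -/

theorem mainTheorem10 :
    -- For each elliptic solution and each real Lax parameter `ζ`:
    (∀ (p : NLSKrein.EllipticParams) (ζ : ℝ),
      (ζ : ℂ) ∈ p.LaxSpectrum ∧
      (p.OmegaSq ζ).im = 0 ∧ (p.OmegaSq ζ).re ≤ 0 ∧ (0 < p.k → (p.OmegaSq ζ).re < 0) ∧
      ∀ Ω : ℂ, Ω ^ 2 = p.OmegaSq ζ → Ω ≠ 0 →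
        -- there is a normalized eigenfunction of the Lax pair,
        (∃ f₁ f₂ : ℝ → ℂ, p.IsLaxEigenfunction ζ Ω f₁ f₂ ∧ p.IsNormalized ζ Ω f₁ f₂) ∧
        ∀ f₁ f₂ : ℝ → ℂ, p.IsLaxEigenfunction ζ Ω f₁ f₂ → p.IsNormalized ζ Ω f₁ f₂ →
          -- it is unique up to constant multiples,
          (∀ g₁ g₂ : ℝ → ℂ, p.IsLaxEigenfunction ζ Ω g₁ g₂ →
            ∃ a : ℂ, ∀ x, g₁ x = a * f₁ x ∧ g₂ x = a * f₂ x) ∧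
          -- its squares are eigenfunctions for the eigenvalue `2 Ω`,
          (∃ μ : ℝ, p.IsBlochEigenfunction (2 * Ω) μ (p.sqU f₁ f₂) (p.sqV f₁ f₂)) ∧
          p.IsHamEigenfunction (2 * Ω) (NLSKrein.sqW₁ f₁ f₂) (NLSKrein.sqW₂ f₁ f₂) ∧
          ∀ P : ℕ, 1 ≤ P →
            -- the formula for `K₂`, and the Krein signature,
            NLSKrein.K₂ p P f₁ f₂ = -16 * Ω ^ 2 * P * p.T * ((ζ : ℂ) ^ 2 - p.zetaCSq) ∧
            NLSKrein.kreinSignature p P f₁ f₂ = SignType.sign (ζ ^ 2 - p.zetaCSq) ∧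
            -- and its change of sign at `± ζ_c` when `ζ_c` is real.
            ∀ zc : ℝ, 0 < zc → zc ^ 2 = p.zetaCSq →
              ((NLSKrein.K₂ p P f₁ f₂).re < 0 ↔ -zc < ζ ∧ ζ < zc) ∧
              (0 < (NLSKrein.K₂ p P f₁ f₂).re ↔ ζ < -zc ∨ zc < ζ)) ∧
    -- Two eigenvalues `2 Ω̂ n`, `2 Ω̃ n`, of the same Bloch operator and with distinct real Lax
    -- parameters, that collide at the Lax parameter `± ζ_c` of a limiting elliptic solution, at a
    -- point `2 Ωs ≠ 0`, have opposite Krein signatures before the collision.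
    (∀ (p : ℕ → NLSKrein.EllipticParams) (ps : NLSKrein.EllipticParams)
      (ζh ζt : ℕ → ℝ) (ζs : ℝ) (Ωh Ωt : ℕ → ℂ) (Ωs : ℂ) (μ : ℕ → ℝ)
      (fh₁ fh₂ ft₁ ft₂ : ℕ → ℝ → ℂ),
      Filter.Tendsto (fun n => (p n).k) Filter.atTop (nhds ps.k) →
      Filter.Tendsto (fun n => (p n).b) Filter.atTop (nhds ps.b) →
      Filter.Tendsto (fun n => (p n).c) Filter.atTop (nhds ps.c) →
      0 < ps.zetaCSq → ζs ^ 2 = ps.zetaCSq → Ωs ≠ 0 →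
      (∀ n, ζh n ≠ ζt n) →
      Filter.Tendsto ζh Filter.atTop (nhds ζs) → Filter.Tendsto ζt Filter.atTop (nhds ζs) →
      Filter.Tendsto Ωh Filter.atTop (nhds Ωs) → Filter.Tendsto Ωt Filter.atTop (nhds Ωs) →
      (∀ n, (p n).IsLaxEigenfunction (ζh n) (Ωh n) (fh₁ n) (fh₂ n) ∧
        (p n).IsNormalized (ζh n) (Ωh n) (fh₁ n) (fh₂ n) ∧
        (p n).IsBlochEigenfunction (2 * Ωh n) (μ n)
          ((p n).sqU (fh₁ n) (fh₂ n)) ((p n).sqV (fh₁ n) (fh₂ n))) →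
      (∀ n, (p n).IsLaxEigenfunction (ζt n) (Ωt n) (ft₁ n) (ft₂ n) ∧
        (p n).IsNormalized (ζt n) (Ωt n) (ft₁ n) (ft₂ n) ∧
        (p n).IsBlochEigenfunction (2 * Ωt n) (μ n)
          ((p n).sqU (ft₁ n) (ft₂ n)) ((p n).sqV (ft₁ n) (ft₂ n))) →
      ∀ᶠ n in Filter.atTop, ∀ P : ℕ, 1 ≤ P →
        NLSKrein.kreinSignature (p n) P (fh₁ n) (fh₂ n) ≠ 0 ∧
        NLSKrein.kreinSignature (p n) P (fh₁ n) (fh₂ n)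
          = -NLSKrein.kreinSignature (p n) P (ft₁ n) (ft₂ n)) := by
  refine ⟨fun p ζ => ⟨p.ofReal_mem_laxSpectrum ζ, ?_, ?_, ?_, ?_⟩, ?_⟩
  · rw [p.OmegaSq_ofReal]; simp
  · rw [p.OmegaSq_ofReal]; simpa using p.negOmegaSq_nonneg ζ
  · intro hk
    rw [p.OmegaSq_ofReal]
    simp only [Complex.neg_re, Complex.ofReal_re, Left.neg_neg_iff]
    exact lt_of_le_of_ne (p.negOmegaSq_nonneg ζ)
      fun h => hk.ne' (p.k_eq_zero_of_negOmegaSq_eq_zero h.symm)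
  · intro Ω hΩ hΩ0
    obtain ⟨w, rfl, hw⟩ := p.exists_real_of_sq_eq hΩ
    have hw0 : w ≠ 0 := by rintro rfl; simp at hΩ0
    refine ⟨?_, fun f₁ f₂ hf hn => ⟨fun g₁ g₂ hg => hf.eq_const_mul hΩ0 hg,
      hf.exists_isBlochEigenfunction hΩ0, hf.isHamEigenfunction, fun P hP => ?_⟩⟩
    · obtain ⟨f₁, f₂, hf⟩ := NLSKrein.EllipticParams.exists_isLaxEigenfunction hw0 hw
      exact hf.exists_isNormalized hw0
    · have hT := p.T_pos
      have hP' : (0 : ℝ) < P := by exact_mod_cast hP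
      have hpos : 0 < 16 * w ^ 2 * P * p.T := by positivity
      have hK := hf.K₂_eq hw0 hn P
      refine ⟨?_, hf.kreinSignature_eq hw0 hn hP, fun zc hzc hzc2 => ?_⟩
      · rw [hK, mul_pow, Complex.I_sq]; push_cast; ring
      · rw [hK, Complex.ofReal_re, ← hzc2, mul_pos_iff_of_pos_left hpos, ← not_le,
          mul_nonneg_iff_of_pos_left hpos, not_le, sub_neg, sub_pos]
        refine ⟨?_, ?_⟩
        · rw [sq_lt_sq, abs_of_pos hzc, abs_lt]
        · rw [sq_lt_sq, abs_of_pos hzc, lt_abs, or_comm, lt_neg]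
  · intro p ps ζh ζt ζs Ωh Ωt Ωs μ fh₁ fh₂ ft₁ ft₂ hk hb hc hzc hζs hΩs hne hζh hζt hΩh hΩt hfh hft
    choose wh hwh hwh2 using fun n => (p n).exists_real_of_sq_eq (hfh n).1.sq_eq_OmegaSq
    choose wt hwt hwt2 using fun n => (p n).exists_real_of_sq_eq (hft n).1.sq_eq_OmegaSq
    have him : ∀ w : ℝ, (Complex.I * w).im = w := fun w => by simp
    have hlh : Filter.Tendsto wh Filter.atTop (nhds Ωs.im) := by
      have := (Complex.continuous_im.tendsto Ωs).comp hΩh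
      simpa only [Function.comp_def, hwh, him] using this
    have hlt : Filter.Tendsto wt Filter.atTop (nhds Ωs.im) := by
      have := (Complex.continuous_im.tendsto Ωs).comp hΩt
      simpa only [Function.comp_def, hwt, him] using this
    have hws0 : Ωs.im ≠ 0 := by
      intro h
      have h1 : Filter.Tendsto Ωh Filter.atTop (nhds (Complex.I * (Ωs.im : ℝ))) := by
        rw [funext hwh]
        exact ((Complex.continuous_ofReal.tendsto _).comp hlh).const_mul Complex.I
      rw [h] at h1
      exact hΩs (by simpa using tendsto_nhds_unique hΩh h1)
    have hws : Ωs.im ^ 2 = ps.negOmegaSq ζs := by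
      refine tendsto_nhds_unique (hlh.pow 2) ?_
      simp only [hwh2]
      exact NLSKrein.EllipticParams.tendsto_negOmegaSq hk hb hζh hc
    have hζs0 : ζs ≠ 0 := by rintro rfl; norm_num at hζs; exact hzc.ne hζs
    obtain ⟨τ, hτ, hτpos⟩ := NLSKrein.EllipticParams.exists_sign_aReal_add hζs0 hws0 hws
    have hτ2 : τ ^ 2 = 1 := by rcases hτ with rfl | rfl <;> norm_num
    have habs := abs_pos.mpr hws0
    -- `s` is `τ` times the sign of `Ωs.im`, so that `branch s` has the value `τ Ωs.im` at the
    -- collision and equals `τ w` along both sequences for large `n`.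
    have hs : (τ * Ωs.im / |Ωs.im|) ^ 2 = 1 := by
      rw [div_pow, mul_pow, hτ2, sq_abs, one_mul, div_self (pow_ne_zero 2 hws0)]
    have hsw : τ * Ωs.im / |Ωs.im| * |Ωs.im| = τ * Ωs.im := div_mul_cancel₀ _ habs.ne'
    generalize τ * Ωs.im / |Ωs.im| = s at hs hsw
    obtain ⟨δ, hδ, M, hlr, hev⟩ := NLSKrein.EllipticParams.exists_uniform_neighborhood
      hk hb hc hζs0 hws0 hws hτpos hs hsw
    have hsτ : 0 < s * τ * Ωs.im := by
      rw [mul_assoc, ← hsw, ← mul_assoc, ← sq, hs, one_mul]; exact habs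
    have hnear := Ioo_mem_nhds (show ζs - δ < ζs by linarith) (show ζs < ζs + δ by linarith)
    have hdiff : Filter.Tendsto (fun n => M * |ζt n - ζh n|) Filter.atTop (nhds 0) := by
      simpa using ((hζt.sub hζh).abs).const_mul M
    filter_upwards [hev, hζh.eventually_mem hnear, hζt.eventually_mem hnear,
      (hlh.const_mul (s * τ)).eventually_const_lt hsτ,
      (hlt.const_mul (s * τ)).eventually_const_lt hsτ,
      hdiff.eventually_lt_const Real.pi_pos] with n hn hnh hnt hsh hst hcl P hP
    obtain ⟨hfh1, hfh2, hfh3⟩ := hfh n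
    obtain ⟨hft1, hft2, hft3⟩ := hft n
    rw [hwh n] at hfh1 hfh2 hfh3
    rw [hwt n] at hft1 hft2 hft3
    have hwh0 : wh n ≠ 0 := by intro h; rw [h, mul_zero] at hsh; exact lt_irrefl _ hsh
    have hwt0 : wt n ≠ 0 := by intro h; rw [h, mul_zero] at hst; exact lt_irrefl _ hst
    rw [hfh1.kreinSignature_eq hwh0 hfh2 hP, hft1.kreinSignature_eq hwt0 hft2 hP]
    refine NLSKrein.EllipticParams.sign_sub_zetaCSq_opposite hs (fun ζ hζ => (hn ζ hζ).1)
      (fun ζ hζ => (hn ζ hζ).2.1) (fun ζ hζ => (hn ζ hζ).2.2) hlr hnh hnt (hne n) hcl ?_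
    rw [hfh1.exp_floquetPhase hfh3 hτ
        (NLSKrein.EllipticParams.branch_eq_of_sq_eq hs hτ2 (hwh2 n) hsh) (hn _ hnh).2.1,
      hft1.exp_floquetPhase hft3 hτ
        (NLSKrein.EllipticParams.branch_eq_of_sq_eq hs hτ2 (hwt2 n) hst) (hn _ hnt).2.1]
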